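/- **Theorem 1.4.** For every $\varepsilon \in (0,1/2)$ there is $N_0 = N_0(\varepsilon)$ such that for every integer $N \ge N_0$ and every set of integers $A \subseteq \{1,\dots,N\}$ with $|A| \ge (1 - 1/e + \varepsilon)N$, there is a subset $A' \subseteq A$ with $$\sum_{n \in A'} \frac1n = 1.$$ The constant $1 - 1/e$ is sharp: for every $\gamma > 0$ there is $N_0 = N_0(\gamma)$ such that for every integer $N \ge N_0$ there is a set of integers $A \subseteq \{1,\dots,N\}$ with $|A| \ge (1 - 1/e - \gamma)N$ and $\sum_{n \in A} \frac1n < 1$; in particular, no subset $A' \subseteq A$ satisfies $\sum_{n \in A'} \frac1n = 1$. -/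

import Mathlib

/-! Keep each `n ∈ A` independently with probability `p = 1/R`, where `R` is the reciprocal sum of
`A`, so that the expected reciprocal sum is `1`. With `Q` the lcm of `A`, summing the characteristic
function `∏ (1 - p + p e(h/n))` over `h` modulo `Q` detects integral reciprocal sums. If `R < 2` and
no subset has sum `1`, only the empty set survives and the total is `Q (1 - p)^|A|`
(`sum_prod_bernoulliChar_eq`), which is tiny when every prime power dividing an element is at most
`N^(1-δ)`. As `h = 0` alone contributes `1`, a contradiction follows once the other frequencies
cannot cancel it; this is `exists_subset_sum_inv_eq_one`.

For `|h| ≤ H` the product has nonnegative real part, because its total phase is centred at the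
integer `h`. For `H < |h| ≤ K` all the `h/n` stay away from the integers. For the remaining `h` one
needs many `n ∈ A` dividing no integer in `[h - K, h + K]`, since each such `n` gives a factor
bounded away from `1` in norm.

The arithmetic heart is `eventually_exists_common_multiple`: one `x` within `K` of `h` is divisible
by every prime power `q` for which a fair share of the multiples of `q` in `A` do divide an element
of the window. To see this, write such a multiple as `q r s b` with `r ≤ T` prime, `s ≤ T` the
smooth part and `b` the rough part of the cofactor. Then `q b > 2K`, so `b` determines the element
`y` of the window that is divisible by `q b`, and `s b` must avoid the small primes not dividing
`y`. If every multiple of `q` in the window missed many small primes, a sieve would leave too few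
such integers. So some `y` is divisible by `q` and by most small primes, and two such integers in
one window coincide, whence `y` does not depend on `q`.

The prime powers of `Q` not dividing `x` are exceptional. If there are none, then `Q ∣ x`, which
forces `x = 0` and `|h| ≤ K`. Otherwise each of them multiplies the number of possible `h` by at
most `N` but brings a saving larger than any power of `N`.

To reach this situation, a set of density above `1 - 1/e` has reciprocal sum exceeding `1`, since
the worst case is a final segment (`one_add_le_sum_inv`). It is then trimmed below `2` and pruned
until each occurring prime power is small and has many multiples
(`eventually_exists_regular_subset`). Sharpness comes from the integers just beyond `N/e`. -/

/-! ### Mertens' theorems with explicit constants. -/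

open Nat in
lemma sub_one_mul_factorization_factorial_le {p : ℕ} (hp : p.Prime) (n : ℕ) :
    (p - 1) * (n !).factorization p ≤ n := by
  have := Fact.mk hp
  rw [Nat.factorization_def _ hp, sub_one_mul_padicValNat_factorial]
  exact Nat.sub_le _ _

open Nat in
lemma div_le_factorization_factorial {p : ℕ} (hp : p.Prime) (n : ℕ) :
    n / p ≤ (n !).factorization p := by
  have := Fact.mk hp
  rw [Nat.factorization_def _ hp, ← padicValNat_mul_div_factorial, padicValNat_factorial_mul]
  exact Nat.le_add_left _ _

open Nat in
lemma log_factorial_eq_sum_primes (n : ℕ) :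
    Real.log (n ! : ℕ) = ∑ p ∈ n.primesLE, ((n !).factorization p : ℝ) * Real.log p := by
  rw [Real.log_nat_eq_sum_factorization, Finsupp.sum]
  apply Finset.sum_subset
  · intro p hp
    have h := Nat.support_factorization (n !) ▸ hp
    have hpp := Nat.prime_of_mem_primeFactors h
    have := (hpp.dvd_factorial).1 (Nat.dvd_of_mem_primeFactors h)
    rw [Nat.primesLE_eq_filter_range, Finset.mem_filter, Finset.mem_range]
    exact ⟨by omega, hpp⟩
  · intro p _ hp
    rw [Finsupp.notMem_support_iff.1 hp]
    simp

/-- The second term dominates the tail of the series, which lets the induction close. The bound `2`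
controls the contribution of higher prime powers in Legendre's formula. -/
lemma sum_log_div_mul_sub_one_le (n : ℕ) (hn : 1 ≤ n) :
    ∑ k ∈ Finset.range (n + 1), Real.log k / (k * (k - 1)) + (Real.log n + 2) / n ≤ 2 := by
  induction n, hn using Nat.le_induction with
  | base => norm_num [Finset.sum_range_succ]
  | succ n hn ih =>
    rw [Finset.sum_range_succ]
    have hn0 : (0 : ℝ) < n := by exact_mod_cast hn
    have h1 : Real.log ((n : ℝ) + 1) - Real.log n ≤ 1 / n := by
      rw [← Real.log_div (by positivity) (by positivity)]
      refine (Real.log_le_sub_one_of_pos (by positivity)).trans (le_of_eq ?_)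
      field_simp
      ring
    have h2 : 1 / (n : ℝ) ≤ 1 := by
      rw [div_le_one hn0]; exact_mod_cast hn
    have key : Real.log ((n : ℝ) + 1) / ((n + 1) * n) + (Real.log ((n : ℝ) + 1) + 2) / (n + 1)
        ≤ (Real.log n + 2) / n := by
      rw [div_add_div _ _ (by positivity) (by positivity),
        div_le_div_iff₀ (by positivity) (by positivity)]
      have h3 : n * (Real.log ((n : ℝ) + 1) - Real.log n) ≤ 1 := by
        have := mul_le_mul_of_nonneg_left h1 hn0.le
        rwa [mul_one_div_cancel hn0.ne'] at this
      have h4 : 0 ≤ (Real.log n + 2 - n * (Real.log ((n : ℝ) + 1) - Real.log n)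
          - Real.log ((n : ℝ) + 1)) * ((n + 1) * n) := by
        apply mul_nonneg _ (by positivity)
        linarith
      nlinarith
    push_cast
    have e : ((n : ℝ) + 1) * ((n : ℝ) + 1 - 1) = (n + 1) * n := by ring
    rw [e]
    linarith

/-- Mertens' first theorem. -/
theorem mertens_first (n : ℕ) (hn : 1 ≤ n) :
    |∑ p ∈ n.primesLE, Real.log p / p - Real.log n| ≤ 3 := by
  have hn0 : (0 : ℝ) < n := by exact_mod_cast hn
  have hprime : ∀ p ∈ n.primesLE, p.Prime := fun p hp ↦ by
    rw [Nat.primesLE_eq_filter_range] at hp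
    exact (Finset.mem_filter.1 hp).2
  have hfac := log_factorial_eq_sum_primes n
  have hup : Real.log (n.factorial : ℕ) ≤ n * Real.log n := by
    rw [← Real.log_pow]
    apply Real.log_le_log (by exact_mod_cast n.factorial_pos)
    exact_mod_cast Nat.factorial_le_pow n
  have hlo : n * Real.log n - n ≤ Real.log (n.factorial : ℕ) := by
    have := Stirling.le_log_factorial_stirling (n := n) (by omega)
    have h1 : 0 ≤ Real.log n := Real.log_nonneg (by exact_mod_cast hn)
    have h2 : 0 ≤ Real.log (2 * Real.pi) := Real.log_nonneg (by linarith [Real.pi_gt_three])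
    linarith
  have htheta : ∑ p ∈ n.primesLE, Real.log p ≤ Real.log 4 * n := by
    rw [← Chebyshev.theta_eq_sum_primesLE_log]
    exact Chebyshev.theta_le_log4_mul_x hn0.le
  have hlog4 : Real.log 4 ≤ 3 := by
    have := Real.log_le_sub_one_of_pos (show (0 : ℝ) < 4 by norm_num)
    linarith
  rw [abs_le]
  constructor
  -- Lower bound: the exponent of `p` in `n!` is at most `n / (p - 1)`, and `1 / (p - 1) = 1 / p + 1
  -- / (p (p - 1))`.
  · have h1 : Real.log (n.factorial : ℕ) ≤ ∑ p ∈ n.primesLE,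
        n * (Real.log p / p + Real.log p / (p * (p - 1))) := by
      rw [hfac]
      apply Finset.sum_le_sum
      intro p hp
      have hpp := hprime p hp
      have hp1 : (1 : ℝ) < p := by exact_mod_cast hpp.one_lt
      have hle := sub_one_mul_factorization_factorial_le hpp n
      have hle' : ((p : ℝ) - 1) * (n.factorial.factorization p : ℝ) ≤ n := by
        have := (Nat.cast_le (α := ℝ)).2 hle
        rwa [Nat.cast_mul, Nat.cast_sub hpp.one_lt.le, Nat.cast_one] at this
      have e : n * (Real.log p / p + Real.log p / (p * (p - 1))) =
          n / (p - 1) * Real.log p := by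
        have : (p : ℝ) - 1 ≠ 0 := by linarith
        field_simp
        ring
      rw [e]
      apply mul_le_mul_of_nonneg_right _ (Real.log_nonneg hp1.le)
      rw [le_div_iff₀ (by linarith)]
      linarith
    have h2 : ∑ p ∈ n.primesLE, Real.log p / ((p : ℝ) * (p - 1)) ≤ 2 := by
      have h3 := sum_log_div_mul_sub_one_le n hn
      have h4 : 0 ≤ (Real.log n + 2) / n :=
        div_nonneg (by linarith [Real.log_nonneg (show (1 : ℝ) ≤ n by exact_mod_cast hn)]) hn0.le
      refine le_trans ?_ (by linarith : ∑ k ∈ Finset.range (n + 1),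
        Real.log k / ((k : ℝ) * (k - 1)) ≤ 2)
      apply Finset.sum_le_sum_of_subset_of_nonneg
      · rw [Nat.primesLE_eq_filter_range]; exact Finset.filter_subset _ _
      · intro k _ _
        rcases Nat.eq_zero_or_pos k with rfl | hk
        · simp
        · have : (1 : ℝ) ≤ k := by exact_mod_cast hk
          exact div_nonneg (Real.log_nonneg this) (mul_nonneg (by linarith) (by linarith))
    rw [← Finset.mul_sum, Finset.sum_add_distrib] at h1
    have h5 : n * (Real.log n - 1) ≤ n * (∑ p ∈ n.primesLE, Real.log p / p +
      ∑ p ∈ n.primesLE, Real.log p / ((p : ℝ) * (p - 1))) := by linarith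
    have h6 := le_of_mul_le_mul_left h5 hn0
    linarith
  -- Upper bound: the exponent is at least `n / p - 1`, and the loss `∑ log p` is `O(n)` by
  -- Chebyshev.
  · have h1 : ∑ p ∈ n.primesLE, (n * (Real.log p / p) - Real.log p) ≤
        Real.log (n.factorial : ℕ) := by
      rw [hfac]
      apply Finset.sum_le_sum
      intro p hp
      have hpp := hprime p hp
      have hp1 : (1 : ℝ) < p := by exact_mod_cast hpp.one_lt
      have hle := div_le_factorization_factorial hpp n
      have h2 : (n : ℝ) / p - 1 ≤ n.factorial.factorization p := by
        have := (Nat.cast_le (α := ℝ)).2 hle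
        refine le_trans ?_ this
        rw [sub_le_iff_le_add, div_le_iff₀ (by linarith)]
        have := Nat.lt_div_mul_add (a := n) hpp.pos
        have h3 : n ≤ (n / p + 1) * p := by
          rw [add_mul, one_mul]; exact this.le
        exact_mod_cast h3
      have e : n * (Real.log p / p) - Real.log p = (n / p - 1) * Real.log p := by ring
      rw [e]
      exact mul_le_mul_of_nonneg_right h2 (Real.log_nonneg hp1.le)
    rw [Finset.sum_sub_distrib, ← Finset.mul_sum] at h1
    have h5 : n * (∑ p ∈ n.primesLE, Real.log p / p) ≤ n * (Real.log n + Real.log 4) := by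
      linarith
    have h6 := le_of_mul_le_mul_left h5 hn0
    linarith

/-- The primes in the interval `(a, b]`. -/
def primesIoc (a b : ℕ) : Finset ℕ := (Finset.Ioc a b).filter Nat.Prime

lemma mem_primesIoc {a b p : ℕ} : p ∈ primesIoc a b ↔ (a < p ∧ p ≤ b) ∧ p.Prime := by
  simp [primesIoc]

lemma primesIoc_succ {a b : ℕ} (h : a ≤ b) (f : ℕ → ℝ) :
    ∑ p ∈ primesIoc a (b + 1), f p =
      ∑ p ∈ primesIoc a b, f p + if (b + 1).Prime then f (b + 1) else 0 := by
  simp only [primesIoc, Finset.sum_filter]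
  rw [← Finset.sum_Ioc_consecutive _ h (Nat.le_succ b)]
  congr 1
  have : Finset.Ioc b (b + 1) = {b + 1} := by
    ext x; simp only [Finset.mem_Ioc, Finset.mem_singleton]; omega
  rw [this, Finset.sum_singleton]

/-- For `u = log n` and `v = log (n + 1)` this compares one step of a partial summation with the
increment of `log log`. The error has a form that telescopes. -/
lemma log_div_log_bound {u v : ℝ} (hu : 0 < u) (huv : u ≤ v) (h1 : v - u ≤ 1) :
    |(v - u) / v - (Real.log v - Real.log u)| ≤ 1 / u - 1 / v := by
  have hv : 0 < v := hu.trans_le huv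
  have a1 : Real.log v - Real.log u ≤ (v - u) / u := by
    rw [← Real.log_div hv.ne' hu.ne']
    refine (Real.log_le_sub_one_of_pos (by positivity)).trans (le_of_eq ?_)
    field_simp
  have a2 : (v - u) / v ≤ Real.log v - Real.log u := by
    have := Real.log_le_sub_one_of_pos (show 0 < u / v by positivity)
    rw [Real.log_div hu.ne' hv.ne'] at this
    have e : (v - u) / v = 1 - u / v := by field_simp
    linarith
  have a3 : (v - u) / u - (v - u) / v ≤ 1 / u - 1 / v := by
    have e : (v - u) / u - (v - u) / v = (v - u) * (1 / u - 1 / v) := by ring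
    rw [e]
    have : 0 ≤ 1 / u - 1 / v := sub_nonneg.2 (one_div_le_one_div_of_le hu huv)
    nlinarith
  rw [abs_le]
  constructor <;> linarith

/-- Mertens' second theorem, for intervals with integer endpoints. -/
theorem mertens_second_nat {m n : ℕ} (hm : 2 ≤ m) (hmn : m ≤ n) :
    |∑ p ∈ primesIoc m n, (1 : ℝ) / p -
      (Real.log (Real.log n) - Real.log (Real.log m))| ≤ 10 / Real.log m := by
  set A : ℕ → ℝ := fun n ↦ ∑ p ∈ n.primesLE, Real.log p / p - Real.log n with hA
  set b : ℕ → ℝ := fun n ↦ 1 / Real.log n with hb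
  have hAb : ∀ n, 2 ≤ n → |A n| ≤ 3 := fun n hn ↦ mertens_first n (by omega)
  have hlog : ∀ n : ℕ, 2 ≤ n → 0 < Real.log n := fun n hn ↦
    Real.log_pos (by exact_mod_cast hn)
  have hbpos : ∀ n, 2 ≤ n → 0 < b n := fun n hn ↦ one_div_pos.2 (hlog n hn)
  -- Partial summation with weight `b n = 1 / log n`, done by induction. The constant `4` is `3`
  -- from Mertens' first theorem plus `1` from `log_div_log_bound`.
  have main : |∑ p ∈ primesIoc m n, (1 : ℝ) / p -
      (Real.log (Real.log n) - Real.log (Real.log m)) - (A n * b n - A m * b m)| ≤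
      4 * (b m - b n) := by
    induction n, hmn using Nat.le_induction with
    | base => simp [primesIoc]
    | succ n hmn ih =>
      have hn2 : 2 ≤ n := hm.trans hmn
      rw [primesIoc_succ hmn]
      have hu := hlog n hn2
      have hv := hlog (n + 1) (by omega)
      have huv : Real.log n ≤ Real.log (n + 1 : ℕ) :=
        Real.log_le_log (by exact_mod_cast (by omega : 0 < n)) (by exact_mod_cast n.le_succ)
      have h1 : Real.log (n + 1 : ℕ) - Real.log n ≤ 1 := by
        have hn0 : (0 : ℝ) < n := by exact_mod_cast (by omega : 0 < n)
        rw [← Real.log_div (by positivity) (by positivity)]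
        refine (Real.log_le_sub_one_of_pos (by positivity)).trans ?_
        rw [sub_le_iff_le_add, div_le_iff₀ hn0]
        push_cast
        have : (2 : ℝ) ≤ n := by exact_mod_cast hn2
        linarith
      have hbd := log_div_log_bound hu huv h1
      have hAn := hAb n hn2
      have hstep : (if (n + 1).Prime then (1 : ℝ) / (n + 1 : ℕ) else 0) =
          (A (n + 1) - A n + (Real.log (n + 1 : ℕ) - Real.log n)) * b (n + 1) := by
        have : ∑ p ∈ (n + 1).primesLE, Real.log p / p = ∑ p ∈ n.primesLE, Real.log p / p +
            if (n + 1).Prime then Real.log (n + 1 : ℕ) / (n + 1 : ℕ) else 0 := by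
          simp only [Nat.primesLE_eq_filter_range, Finset.sum_filter]
          rw [Finset.sum_range_succ]
        simp only [hA, hb, this]
        split_ifs
        · have : Real.log (n + 1 : ℕ) ≠ 0 := hv.ne'
          field_simp
          ring
        · ring
      rw [hstep]
      have hbb : 0 ≤ b n - b (n + 1) := sub_nonneg.2 (one_div_le_one_div_of_le hu huv)
      have e : ∑ p ∈ primesIoc m n, (1 : ℝ) / p +
          (A (n + 1) - A n + (Real.log (n + 1 : ℕ) - Real.log n)) * b (n + 1) -
          (Real.log (Real.log (n + 1 : ℕ)) - Real.log (Real.log m)) -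
          (A (n + 1) * b (n + 1) - A m * b m) =
          (∑ p ∈ primesIoc m n, (1 : ℝ) / p -
            (Real.log (Real.log n) - Real.log (Real.log m)) - (A n * b n - A m * b m)) +
          A n * (b n - b (n + 1)) +
          ((Real.log (n + 1 : ℕ) - Real.log n) / Real.log (n + 1 : ℕ) -
            (Real.log (Real.log (n + 1 : ℕ)) - Real.log (Real.log n))) := by
        simp only [hb]; ring
      rw [e]
      have h3 : |A n * (b n - b (n + 1))| ≤ 3 * (b n - b (n + 1)) := by
        rw [abs_mul, abs_of_nonneg hbb]
        exact mul_le_mul_of_nonneg_right hAn hbb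
      refine (abs_add_three _ _ _).trans ?_
      have : 1 / Real.log n - 1 / Real.log (n + 1 : ℕ) = b n - b (n + 1) := rfl
      linarith
  have h1 : |A n * b n| ≤ 3 * b n := by
    rw [abs_mul, abs_of_pos (hbpos n (hm.trans hmn))]
    exact mul_le_mul_of_nonneg_right (hAb n (hm.trans hmn)) (hbpos n (hm.trans hmn)).le
  have h2 : |A m * b m| ≤ 3 * b m := by
    rw [abs_mul, abs_of_pos (hbpos m hm)]
    exact mul_le_mul_of_nonneg_right (hAb m hm) (hbpos m hm).le
  have e : 10 / Real.log m = 10 * b m := by simp only [hb]; ring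
  have := hbpos n (hm.trans hmn)
  rw [e]
  rw [abs_le] at *
  constructor <;> linarith

/-- Mertens' second theorem, for real intervals. -/
theorem mertens_second {u v : ℝ} (hu : 2 ≤ u) (huv : u ≤ v) :
    |∑ p ∈ primesIoc ⌊u⌋₊ ⌊v⌋₊, (1 : ℝ) / p -
      (Real.log (Real.log v) - Real.log (Real.log u))| ≤ 24 / Real.log u := by
  -- Passing to the floor at most doubles `10 / log` and shifts each `log log` by at most `2 / log`,
  -- hence `24 = 20 + 2 + 2`.
  have aux : ∀ w : ℝ, 2 ≤ w → 0 < Real.log ⌊w⌋₊ ∧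
      |Real.log (Real.log w) - Real.log (Real.log ⌊w⌋₊)| ≤ 2 / Real.log w ∧
      1 / Real.log ⌊w⌋₊ ≤ 2 / Real.log w := by
    intro w hw
    have hf2 : 2 ≤ ⌊w⌋₊ := Nat.le_floor (by exact_mod_cast hw)
    have hf2' : (2 : ℝ) ≤ ⌊w⌋₊ := by exact_mod_cast hf2
    have hle : (⌊w⌋₊ : ℝ) ≤ w := Nat.floor_le (by linarith)
    have hlt : w < ⌊w⌋₊ + 1 := Nat.lt_floor_add_one w
    have hpos : 0 < Real.log ⌊w⌋₊ := Real.log_pos (by linarith)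
    have hlw : Real.log w ≤ 2 * Real.log ⌊w⌋₊ := by
      rw [show 2 * Real.log ⌊w⌋₊ = Real.log ((⌊w⌋₊ : ℝ) ^ 2) by rw [Real.log_pow]; norm_num]
      apply Real.log_le_log (by linarith)
      nlinarith
    have hmono : Real.log ⌊w⌋₊ ≤ Real.log w := Real.log_le_log (by linarith) hle
    have h3 : 1 / Real.log ⌊w⌋₊ ≤ 2 / Real.log w := by
      rw [div_le_div_iff₀ hpos (hpos.trans_le hmono)]
      linarith
    refine ⟨hpos, ?_, h3⟩
    rw [abs_of_nonneg (sub_nonneg.2 (Real.log_le_log hpos hmono)),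
      ← Real.log_div (by linarith) hpos.ne']
    refine (Real.log_le_sub_one_of_pos (div_pos (by linarith) hpos)).trans ?_
    refine le_trans ?_ h3
    rw [div_sub_one hpos.ne']
    gcongr
    rw [← Real.log_div (by linarith) (by linarith)]
    refine (Real.log_le_sub_one_of_pos (div_pos (by linarith) (by linarith))).trans ?_
    rw [sub_le_iff_le_add, div_le_iff₀ (by linarith)]
    linarith
  obtain ⟨a1, a2, a3⟩ := aux u hu
  obtain ⟨b1, b2, b3⟩ := aux v (hu.trans huv)
  have h := mertens_second_nat (Nat.le_floor (by exact_mod_cast hu) : 2 ≤ ⌊u⌋₊)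
    (Nat.floor_le_floor huv)
  have hlu : 0 < Real.log u := Real.log_pos (by linarith)
  have hluv : 2 / Real.log v ≤ 2 / Real.log u := by
    apply div_le_div_of_nonneg_left (by norm_num) hlu (Real.log_le_log (by linarith) huv)
  have e1 : 10 / Real.log ⌊u⌋₊ ≤ 20 / Real.log u := by
    calc 10 / Real.log ⌊u⌋₊ = 10 * (1 / Real.log ⌊u⌋₊) := by ring
      _ ≤ 10 * (2 / Real.log u) := by gcongr
      _ = 20 / Real.log u := by ring
  have e2 : 24 / Real.log u = 20 / Real.log u + 2 / Real.log u + 2 / Real.log u := by ring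
  rw [e2]
  rw [abs_le] at *
  constructor <;> linarith

/-! ### Smooth and rough parts, and reciprocal sums through Euler products. -/

lemma mem_primesLE {p n : ℕ} : p ∈ n.primesLE ↔ p ≤ n ∧ p.Prime := by
  rw [Nat.primesLE_eq_filter_range, Finset.mem_filter, Finset.mem_range, Nat.lt_succ_iff]

/-- The largest divisor of `m` composed of primes at most `z`. -/
def smoothPart (z m : ℕ) : ℕ := ∏ p ∈ z.primesLE, p ^ m.factorization p

/-- The largest divisor of `m` composed of primes exceeding `z`. -/
def roughPart (z m : ℕ) : ℕ := ∏ p ∈ m.primeFactors with z < p, p ^ m.factorization p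

lemma smoothPart_mul_roughPart (z : ℕ) {m : ℕ} (hm : m ≠ 0) :
    smoothPart z m * roughPart z m = m := by
  have h1 : smoothPart z m = ∏ p ∈ m.primeFactors with ¬ z < p, p ^ m.factorization p := by
    unfold smoothPart
    symm
    apply Finset.prod_subset
    · intro p hp
      rw [Finset.mem_filter] at hp
      exact mem_primesLE.2 ⟨not_lt.1 hp.2, Nat.prime_of_mem_primeFactors hp.1⟩
    · intro p hp hn
      have hp' := mem_primesLE.1 hp
      rw [Finset.mem_filter, not_and] at hn
      have : p ∉ m.primeFactors := fun h ↦ hn h (not_lt.2 hp'.1)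
      rw [← Nat.support_factorization, Finsupp.notMem_support_iff] at this
      rw [this, pow_zero]
  rw [h1, mul_comm, roughPart, Finset.prod_filter_mul_prod_filter_not]
  exact Nat.prod_factorization_pow_eq_self hm

lemma smoothPart_dvd_smoothPart {z m n : ℕ} (h : m ∣ n) (hn : n ≠ 0) :
    smoothPart z m ∣ smoothPart z n := by
  apply Finset.prod_dvd_prod_of_dvd
  intro p _
  apply pow_dvd_pow
  exact (Nat.factorization_le_iff_dvd (ne_zero_of_dvd_ne_zero hn h) hn).2 h p

lemma smoothPart_pos (z m : ℕ) : 0 < smoothPart z m :=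
  Finset.prod_pos fun _ hp ↦ pow_pos (mem_primesLE.1 hp).2.pos _

lemma roughPart_pos (z m : ℕ) : 0 < roughPart z m :=
  Finset.prod_pos fun _ hp ↦
    pow_pos (Nat.prime_of_mem_primeFactors (Finset.mem_filter.1 hp).1).pos _

lemma smoothPart_dvd {z m : ℕ} (hm : m ≠ 0) : smoothPart z m ∣ m :=
  ⟨_, (smoothPart_mul_roughPart z hm).symm⟩

lemma roughPart_dvd {z m : ℕ} (hm : m ≠ 0) : roughPart z m ∣ m :=
  ⟨smoothPart z m, by rw [mul_comm, smoothPart_mul_roughPart z hm]⟩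

lemma le_of_prime_dvd_smoothPart {z m p : ℕ} (hp : p.Prime) (h : p ∣ smoothPart z m) : p ≤ z := by
  obtain ⟨q, hq, hpq⟩ := (Prime.dvd_finsetProd_iff hp.prime _).1 h
  have hq' := mem_primesLE.1 hq
  rw [(Nat.prime_dvd_prime_iff_eq hp hq'.2).1 (hp.dvd_of_dvd_pow hpq)]
  exact hq'.1

lemma lt_of_prime_dvd_roughPart {z m p : ℕ} (hp : p.Prime) (h : p ∣ roughPart z m) : z < p := by
  obtain ⟨q, hq, hpq⟩ := (Prime.dvd_finsetProd_iff hp.prime _).1 h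
  have hq' := Finset.mem_filter.1 hq
  rw [(Nat.prime_dvd_prime_iff_eq hp (Nat.prime_of_mem_primeFactors hq'.1)).1
    (hp.dvd_of_dvd_pow hpq)]
  exact hq'.2

lemma sum_inv_mul_pred_le (n : ℕ) (hn : 1 ≤ n) :
    ∑ k ∈ Finset.range (n + 1), (1 : ℝ) / (k * (k - 1)) ≤ 1 - 1 / n := by
  induction n, hn using Nat.le_induction with
  | base => norm_num [Finset.sum_range_succ]
  | succ n hn ih =>
    rw [Finset.sum_range_succ]
    have hn0 : (0 : ℝ) < n := by exact_mod_cast hn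
    push_cast
    have e : (1 : ℝ) / (((n : ℝ) + 1) * (n + 1 - 1)) = 1 / n - 1 / (n + 1) := by
      rw [add_sub_cancel_right, div_sub_div _ _ hn0.ne' (by positivity)]
      congr 1 <;> ring
    rw [e]
    linarith

/-- Each factor is `1 + 1/p + 1/(p(p-1))`, and the corrections `1/(p(p-1))` sum to at most `1`,
whatever `S` is. -/
lemma prod_one_sub_inv_le (S : Finset ℕ) (hS : ∀ p ∈ S, p.Prime) :
    ∏ p ∈ S, (1 - (p : ℝ)⁻¹)⁻¹ ≤ Real.exp (∑ p ∈ S, (1 : ℝ) / p + 1) := by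
  have h1 : ∀ p ∈ S, (1 - (p : ℝ)⁻¹)⁻¹ ≤ Real.exp ((1 : ℝ) / p + 1 / (p * (p - 1))) := by
    intro p hp
    have hp1 : (1 : ℝ) < p := by exact_mod_cast (hS p hp).one_lt
    have hp2 : (p : ℝ) - 1 ≠ 0 := by linarith
    have e : (1 - (p : ℝ)⁻¹)⁻¹ = ((1 : ℝ) / p + 1 / (p * (p - 1))) + 1 := by
      have : (1 - (p : ℝ)⁻¹) ≠ 0 := by
        rw [sub_ne_zero]; exact (inv_lt_one_of_one_lt₀ hp1).ne'
      field_simp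
      ring
    rw [e]
    exact Real.add_one_le_exp _
  have h0 : ∀ p ∈ S, 0 ≤ (1 - (p : ℝ)⁻¹)⁻¹ := by
    intro p hp
    have hp1 : (1 : ℝ) < p := by exact_mod_cast (hS p hp).one_lt
    exact inv_nonneg.2 (sub_nonneg.2 (inv_lt_one_of_one_lt₀ hp1).le)
  refine (Finset.prod_le_prod h0 h1).trans ?_
  rw [← Real.exp_sum, Finset.sum_add_distrib]
  apply Real.exp_le_exp.2
  gcongr
  set n := S.sup id + 1
  have h2 := sum_inv_mul_pred_le n (by omega)
  have : (0 : ℝ) ≤ 1 / n := by positivity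
  refine le_trans ?_ (by linarith : ∑ k ∈ Finset.range (n + 1), (1 : ℝ) / (k * (k - 1)) ≤ 1)
  apply Finset.sum_le_sum_of_subset_of_nonneg
  · intro p hp
    rw [Finset.mem_range]
    have : p ≤ S.sup id := Finset.le_sup (f := id) hp
    omega
  · intro k _ _
    rcases Nat.eq_zero_or_pos k with rfl | hk
    · simp
    · have : (1 : ℝ) ≤ k := by exact_mod_cast hk
      exact div_nonneg zero_le_one (mul_nonneg (by linarith) (by linarith))

/-- Reciprocal sums over integers composed of primes of `S`. -/
lemma sum_inv_le_exp_of_primeFactors (S M : Finset ℕ) (hS : ∀ p ∈ S, p.Prime)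
    (hM : ∀ m ∈ M, m ≠ 0 ∧ ∀ p, p.Prime → p ∣ m → p ∈ S) :
    ∑ m ∈ M, (1 : ℝ) / m ≤ Real.exp (∑ p ∈ S, (1 : ℝ) / p + 1) := by
  classical
  let f : ℕ →* ℝ :=
    { toFun := fun n ↦ (n : ℝ)⁻¹
      map_one' := by simp
      map_mul' := fun a b ↦ by push_cast; rw [mul_inv] }
  have hf : ∀ {p : ℕ}, p.Prime → ‖f p‖ < 1 := by
    intro p hp
    have hp1 : (1 : ℝ) < p := by exact_mod_cast hp.one_lt
    change ‖(p : ℝ)⁻¹‖ < 1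
    rw [norm_inv, Real.norm_natCast]
    exact inv_lt_one_of_one_lt₀ hp1
  have hs := (EulerProduct.summable_and_hasSum_factoredNumbers_prod_filter_prime_geometric hf S).2
  have hfil : S.filter Nat.Prime = S := Finset.filter_true_of_mem hS
  rw [hfil] at hs
  have hmem : ∀ m ∈ M, m ∈ Nat.factoredNumbers S := by
    intro m hm
    rw [Nat.mem_factoredNumbers']
    exact fun p hp hpm ↦ (hM m hm).2 p hp hpm
  have h1 : ∑ m ∈ M.subtype (· ∈ Nat.factoredNumbers S), f m ≤ ∏ p ∈ S, (1 - f p)⁻¹ := by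
    apply sum_le_hasSum _ _ hs
    intro i _
    change (0 : ℝ) ≤ ((i : ℕ) : ℝ)⁻¹
    positivity
  rw [Finset.sum_subtype_of_mem (fun n ↦ f n) hmem] at h1
  refine le_trans (le_of_eq ?_) (h1.trans (prod_one_sub_inv_le S hS))
  exact Finset.sum_congr rfl fun m _ ↦ one_div _

lemma exists_sum_primes_le :
    ∃ C : ℝ, 0 < C ∧ ∀ X : ℕ, 2 ≤ X →
      ∑ p ∈ primesIoc 0 X, (1 : ℝ) / p ≤ Real.log (Real.log X) + C := by
  refine ⟨1 + 10 / Real.log 2 + |Real.log (Real.log 2)|, ?_, fun X hX ↦ ?_⟩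
  · have := Real.log_pos (show (1 : ℝ) < 2 by norm_num)
    positivity
  · have h := mertens_second_nat le_rfl hX
    have e : primesIoc 0 X = insert 2 (primesIoc 2 X) := by
      ext p
      simp only [mem_primesIoc, Finset.mem_insert]
      constructor
      · rintro ⟨h, hp⟩
        have := hp.two_le
        by_cases h2 : p = 2
        · exact Or.inl h2
        · exact Or.inr ⟨⟨by omega, h.2⟩, hp⟩
      · rintro (rfl | h)
        · exact ⟨⟨by norm_num, hX⟩, Nat.prime_two⟩
        · exact ⟨⟨by omega, h.1.2⟩, h.2⟩
    rw [e, Finset.sum_insert (by simp [mem_primesIoc])]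
    have h1 := (abs_le.1 h).2
    have h2 := neg_abs_le (Real.log (Real.log 2))
    push_cast at *
    linarith

/-- Every prime beyond `v` adds at least `log v` to Chebyshev's `θ(y)`. -/
lemma card_mul_log_le_theta (v y : ℕ) (hv : 1 ≤ v) :
    ((primesIoc v y).card : ℝ) * Real.log v ≤ Real.log 4 * y := by
  refine le_trans ?_ (Chebyshev.theta_le_log4_mul_x (Nat.cast_nonneg y))
  rw [Chebyshev.theta_eq_sum_primesLE_log, ← nsmul_eq_mul, ← Finset.sum_const]
  refine (Finset.sum_le_sum (g := fun p : ℕ ↦ Real.log p) fun p hp ↦ ?_).trans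
    (Finset.sum_le_sum_of_subset_of_nonneg ?_ ?_)
  · exact Real.log_le_log (by exact_mod_cast hv)
      (by exact_mod_cast (mem_primesIoc.1 hp).1.1.le)
  · intro p hp
    have := mem_primesIoc.1 hp
    exact mem_primesLE.2 ⟨this.1.2, this.2⟩
  · intro p hp _
    exact Real.log_nonneg (by exact_mod_cast (mem_primesLE.1 hp).2.one_lt.le)

/-- The reciprocal sum of the `m ≤ X` whose `z`-smooth part avoids a set of primes depending on
the `z`-rough part. -/
lemma exists_sum_inv_avoiding_le :
    ∃ C : ℝ, 0 < C ∧ ∀ (X z : ℕ) (W : ℝ) (E : ℕ → Finset ℕ), 2 ≤ X → z ≤ X →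
      (∀ b, E b ⊆ primesIoc 0 z) → (∀ b, W ≤ ∑ p ∈ E b, (1 : ℝ) / p) →
      ∑ m ∈ Finset.Icc 1 X with Disjoint (E (roughPart z m)) m.primeFactors, (1 : ℝ) / m ≤
        C * Real.log X * Real.exp (-W) := by
  obtain ⟨C, hC, hCX⟩ := exists_sum_primes_le
  refine ⟨Real.exp (C + 2), by positivity, fun X z W E hX hz hE hW ↦ ?_⟩
  classical
  set M := (Finset.Icc 1 X).filter (fun m ↦ Disjoint (E (roughPart z m)) m.primeFactors) with hM
  have hM1 : ∀ m ∈ M, m ≠ 0 := fun m hm ↦ by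
    have := (Finset.mem_Icc.1 (Finset.mem_filter.1 hm).1).1
    omega
  rw [← Finset.sum_fiberwise_of_maps_to (g := roughPart z) (t := M.image (roughPart z))
    (fun m hm ↦ Finset.mem_image_of_mem _ hm)]
  -- With the rough part `b` fixed, the forbidden set `E b` is fixed too, so the smooth parts run
  -- over integers composed of the primes up to `z` outside `E b`. This saves `exp (-W)` uniformly
  -- in `b`.
  have inner : ∀ b ∈ M.image (roughPart z), ∑ m ∈ M with roughPart z m = b, (1 : ℝ) / m ≤
      1 / b * Real.exp (∑ p ∈ primesIoc 0 z, (1 : ℝ) / p - W + 1) := by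
    intro b _
    have h1 : ∑ m ∈ M with roughPart z m = b, (1 : ℝ) / m =
        1 / b * ∑ c ∈ (M.filter (fun m ↦ roughPart z m = b)).image (smoothPart z),
          (1 : ℝ) / c := by
      rw [Finset.sum_image, Finset.mul_sum]
      · refine Finset.sum_congr rfl fun m hm ↦ ?_
        have hm' := Finset.mem_filter.1 hm
        have h2 := smoothPart_mul_roughPart z (hM1 m hm'.1)
        rw [hm'.2] at h2
        rw [div_mul_div_comm, one_mul, mul_comm (b : ℝ), ← Nat.cast_mul, h2]
      · intro m hm n hn hmn
        have hm' := Finset.mem_filter.1 hm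
        have hn' := Finset.mem_filter.1 hn
        rw [← smoothPart_mul_roughPart z (hM1 m hm'.1),
          ← smoothPart_mul_roughPart z (hM1 n hn'.1), hm'.2, hn'.2, hmn]
    rw [h1]
    apply mul_le_mul_of_nonneg_left _ (by positivity)
    refine (sum_inv_le_exp_of_primeFactors (primesIoc 0 z \ E b) _ ?_ ?_).trans ?_
    · exact fun p hp ↦ (mem_primesIoc.1 (Finset.mem_sdiff.1 hp).1).2
    · intro c hc
      obtain ⟨m, hm, rfl⟩ := Finset.mem_image.1 hc
      have hm' := Finset.mem_filter.1 hm
      refine ⟨(smoothPart_pos z m).ne', fun p hp hpc ↦ ?_⟩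
      rw [Finset.mem_sdiff]
      refine ⟨mem_primesIoc.2 ⟨⟨hp.pos, le_of_prime_dvd_smoothPart hp hpc⟩, hp⟩, fun hpE ↦ ?_⟩
      have hd := (Finset.mem_filter.1 hm'.1).2
      rw [hm'.2] at hd
      refine Finset.disjoint_left.1 hd hpE ?_
      exact Nat.mem_primeFactors.2
        ⟨hp, hpc.trans (smoothPart_dvd (hM1 m hm'.1)), hM1 m hm'.1⟩
    · apply Real.exp_le_exp.2
      have := Finset.sum_sdiff (f := fun p : ℕ ↦ (1 : ℝ) / p) (hE b)
      have := hW b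
      linarith
  refine (Finset.sum_le_sum inner).trans ?_
  rw [← Finset.sum_mul]
  have outer : ∑ b ∈ M.image (roughPart z), (1 : ℝ) / b ≤
      Real.exp (∑ p ∈ primesIoc z X, (1 : ℝ) / p + 1) := by
    apply sum_inv_le_exp_of_primeFactors
    · exact fun p hp ↦ (mem_primesIoc.1 hp).2
    · intro b hb
      obtain ⟨m, hm, rfl⟩ := Finset.mem_image.1 hb
      refine ⟨(roughPart_pos z m).ne', fun p hp hpb ↦ mem_primesIoc.2
        ⟨⟨lt_of_prime_dvd_roughPart hp hpb, ?_⟩, hp⟩⟩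
      have h1 := Nat.le_of_dvd (Nat.pos_of_ne_zero (hM1 m hm))
        (hpb.trans (roughPart_dvd (hM1 m hm)))
      exact h1.trans (Finset.mem_Icc.1 (Finset.mem_filter.1 hm).1).2
  refine (mul_le_mul_of_nonneg_right outer (Real.exp_pos _).le).trans ?_
  have hsplit : ∑ p ∈ primesIoc 0 z, (1 : ℝ) / p + ∑ p ∈ primesIoc z X, (1 : ℝ) / p =
      ∑ p ∈ primesIoc 0 X, (1 : ℝ) / p := by
    simp only [primesIoc, Finset.sum_filter]
    exact Finset.sum_Ioc_consecutive _ (Nat.zero_le z) hz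
  have hlog : 0 < Real.log X := Real.log_pos (by exact_mod_cast hX)
  rw [← Real.exp_add]
  calc _ ≤ Real.exp (Real.log (Real.log X) + (C + 2) - W) := by
        apply Real.exp_le_exp.2
        have := hCX X hX
        linarith
    _ = _ := by
        rw [sub_eq_add_neg, Real.exp_add, Real.exp_add, Real.exp_log hlog]
        ring

/-! ### Sieve bounds. -/

/-- Upper bound sieve. -/
lemma exists_card_sifted_le :
    ∃ C : ℝ, 0 < C ∧ ∀ (X : ℕ) (S : Finset ℕ), 2 ≤ X → S ⊆ primesIoc 0 X →
      (((Finset.Icc 1 X).filter (fun m ↦ ∀ r ∈ S, ¬ r ∣ m)).card : ℝ) ≤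
        C * X * Real.exp (-∑ p ∈ S, (1 : ℝ) / p) := by
  obtain ⟨C, hC, hCX⟩ := exists_sum_inv_avoiding_le
  have hl4 : 0 < Real.log 4 := Real.log_pos (by norm_num)
  refine ⟨(Real.log 4 + 5) * C, by positivity, fun X S hX hS ↦ ?_⟩
  set M := (Finset.Icc 1 X).filter (fun m ↦ ∀ r ∈ S, ¬ r ∣ m) with hM
  have hMmem : ∀ m ∈ M, 1 ≤ m ∧ m ≤ X ∧ ∀ r ∈ S, ¬ r ∣ m := fun m hm ↦ by
    have := Finset.mem_filter.1 hm
    have h2 := Finset.mem_Icc.1 this.1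
    exact ⟨h2.1, h2.2, this.2⟩
  have hX0 : (0 : ℝ) < X := by exact_mod_cast (by omega : 0 < X)
  have hsum : ∑ m ∈ M, (1 : ℝ) / m ≤ C * Real.log X * Real.exp (-∑ p ∈ S, (1 : ℝ) / p) := by
    refine le_trans (Finset.sum_le_sum_of_subset_of_nonneg ?_ fun _ _ _ ↦ by positivity)
      (hCX X X _ (fun _ ↦ S) hX le_rfl (fun _ ↦ hS) (fun _ ↦ le_rfl))
    intro m hm
    have h := hMmem m hm
    refine Finset.mem_filter.2 ⟨(Finset.mem_filter.1 hm).1, ?_⟩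
    rw [Finset.disjoint_left]
    exact fun p hpS hpm ↦ h.2.2 p hpS (Nat.dvd_of_mem_primeFactors hpm)
  -- Expand `log m = ∑_{d ∣ m} Λ(d)` and regroup by `m / d`. This quotient stays in `M`, because `M`
  -- is closed under divisors, and then `d ≤ X / (m / d)`, so Chebyshev's bound for `ψ` applies.
  have hlogsum : ∑ m ∈ M, Real.log m ≤ (Real.log 4 + 4) * X * ∑ m ∈ M, (1 : ℝ) / m := by
    have e : ∑ m ∈ M, Real.log m =
        ∑ x ∈ M.sigma fun m ↦ m.divisors, ArithmeticFunction.vonMangoldt x.2 := by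
      rw [Finset.sum_sigma]
      exact Finset.sum_congr rfl fun m _ ↦ ArithmeticFunction.vonMangoldt_sum.symm
    have hinj : Set.InjOn (fun x : (_ : ℕ) × ℕ ↦ (⟨x.1 / x.2, x.2⟩ : (_ : ℕ) × ℕ))
        (M.sigma fun m ↦ m.divisors : Finset ((_ : ℕ) × ℕ)) := by
      rintro ⟨m, d⟩ hx ⟨m', d'⟩ hx' h
      simp only [Finset.coe_sigma, Set.mem_sigma_iff, Finset.mem_coe, Nat.mem_divisors] at hx hx'
      simp only [Sigma.mk.injEq, heq_eq_eq] at h ⊢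
      obtain ⟨h1, rfl⟩ := h
      refine ⟨?_, rfl⟩
      rw [← Nat.div_mul_cancel hx.2.1, ← Nat.div_mul_cancel hx'.2.1, h1]
    have e2 : ∑ x ∈ M.sigma (fun m ↦ m.divisors), ArithmeticFunction.vonMangoldt x.2 =
        ∑ x ∈ (M.sigma fun m ↦ m.divisors).image
          (fun x : (_ : ℕ) × ℕ ↦ (⟨x.1 / x.2, x.2⟩ : (_ : ℕ) × ℕ)),
          ArithmeticFunction.vonMangoldt x.2 := by
      rw [Finset.sum_image hinj]
    rw [e, e2]
    refine (Finset.sum_le_sum_of_subset_of_nonneg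
      (t := M.sigma fun m ↦ Finset.Ioc 0 (X / m)) ?_ ?_).trans ?_
    · rintro ⟨m', d⟩ hx
      obtain ⟨⟨m, d'⟩, h1, h2⟩ := Finset.mem_image.1 hx
      simp only [Sigma.mk.injEq, heq_eq_eq] at h2
      obtain ⟨h2, rfl⟩ := h2
      rw [Finset.mem_sigma] at h1 ⊢
      obtain ⟨hm, hd⟩ := h1
      have hdm : d' ∣ m := Nat.dvd_of_mem_divisors hd
      have h := hMmem m hm
      have hd0 : 0 < d' := Nat.pos_of_mem_divisors hd
      have hm0 : 0 < m' := by
        rw [← h2]; exact Nat.div_pos (Nat.le_of_dvd (by omega) hdm) hd0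
      have hmul : m' * d' = m := by rw [← h2]; exact Nat.div_mul_cancel hdm
      refine ⟨Finset.mem_filter.2 ⟨Finset.mem_Icc.2 ⟨hm0, ?_⟩, fun r hr hrm ↦ ?_⟩, ?_⟩
      · exact (Nat.le_of_dvd (by omega) ⟨d', hmul.symm⟩).trans h.2.1
      · exact h.2.2 r hr (hrm.trans ⟨d', hmul.symm⟩)
      · rw [Finset.mem_Ioc]
        refine ⟨hd0, (Nat.le_div_iff_mul_le hm0).2 ?_⟩
        change d' * m' ≤ X
        rw [mul_comm, hmul]
        exact h.2.1
    · exact fun _ _ _ ↦ ArithmeticFunction.vonMangoldt_nonneg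
    · rw [Finset.sum_sigma, Finset.mul_sum]
      refine Finset.sum_le_sum fun m hm ↦ ?_
      have h := hMmem m hm
      have hm0 : (0 : ℝ) < m := by exact_mod_cast h.1
      have h1 := Chebyshev.psi_le_const_mul_self (x := (X : ℝ) / m) (by positivity)
      rw [Chebyshev.psi, Nat.floor_div_eq_div] at h1
      refine h1.trans (le_of_eq ?_)
      ring
  -- This replaces `log m` by `log X`, so that the cardinality of `M` is controlled by its
  -- reciprocal sum.
  have hlogdiff : ∑ m ∈ M, (Real.log X - Real.log m) ≤ X * ∑ m ∈ M, (1 : ℝ) / m := by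
    rw [Finset.mul_sum]
    refine Finset.sum_le_sum fun m hm ↦ ?_
    have hm0 : (0 : ℝ) < m := by exact_mod_cast (hMmem m hm).1
    rw [← Real.log_div hX0.ne' hm0.ne']
    refine (Real.log_le_sub_one_of_pos (by positivity)).trans ?_
    rw [mul_one_div]
    linarith
  have hlog : 0 < Real.log X := Real.log_pos (by exact_mod_cast hX)
  have hcard : (M.card : ℝ) * Real.log X =
      ∑ m ∈ M, (Real.log X - Real.log m) + ∑ m ∈ M, Real.log m := by
    rw [← Finset.sum_add_distrib]
    simp
  have hfin : (M.card : ℝ) * Real.log X ≤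
      (Real.log 4 + 5) * X * (C * Real.log X * Real.exp (-∑ p ∈ S, (1 : ℝ) / p)) := by
    have := mul_le_mul_of_nonneg_left hsum (show 0 ≤ (Real.log 4 + 5) * X by positivity)
    rw [hcard]
    linarith
  refine le_of_mul_le_mul_right (hfin.trans (le_of_eq ?_)) hlog
  ring

/-- Few integers have a large smooth part. -/
lemma card_large_smoothPart_mul_log_le {X z : ℕ} {T : ℝ} (hz : 1 ≤ z) (hT : 1 ≤ T) :
    (((Finset.Icc 1 X).filter (fun m ↦ T < smoothPart z m)).card : ℝ) * Real.log T ≤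
      X * (Real.log z + 5) := by
  have hlogs : ∀ m, Real.log (smoothPart z m) =
      ∑ p ∈ z.primesLE, (m.factorization p : ℝ) * Real.log p := by
    intro m
    rw [smoothPart, Nat.cast_prod, Real.log_prod]
    · refine Finset.sum_congr rfl fun p _ ↦ ?_
      rw [Nat.cast_pow, Real.log_pow]
    · intro p hp
      have := (mem_primesLE.1 hp).2.pos
      positivity
  -- Markov's inequality for the logarithm of the smooth part. The mean is then computed prime by
  -- prime from the exponents in `X!`.
  have h1 : (((Finset.Icc 1 X).filter (fun m ↦ T < smoothPart z m)).card : ℝ) * Real.log T ≤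
      ∑ m ∈ Finset.Icc 1 X, Real.log (smoothPart z m) := by
    rw [← nsmul_eq_mul, ← Finset.sum_const]
    refine (Finset.sum_le_sum fun m hm ↦ ?_).trans
      (Finset.sum_le_sum_of_subset_of_nonneg (Finset.filter_subset _ _) ?_)
    · exact Real.log_le_log (by linarith) (Finset.mem_filter.1 hm).2.le
    · intro m _ _
      exact Real.log_nonneg (by exact_mod_cast smoothPart_pos z m)
  refine h1.trans ?_
  simp only [hlogs]
  rw [Finset.sum_comm]
  have h2 : ∀ p ∈ z.primesLE, ∑ m ∈ Finset.Icc 1 X, (m.factorization p : ℝ) * Real.log p ≤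
      X * (Real.log p / p + Real.log p / (p * (p - 1))) := by
    intro p hp
    have hpp := (mem_primesLE.1 hp).2
    have hp1 : (1 : ℝ) < p := by exact_mod_cast hpp.one_lt
    have hle := sub_one_mul_factorization_factorial_le hpp X
    have hfac : X.factorial = ∏ x ∈ Finset.Icc 1 X, x := by
      rw [← Finset.prod_Ico_id_eq_factorial]
      rfl
    rw [hfac, Nat.factorization_prod (by
      intro x hx; have := (Finset.mem_Icc.1 hx).1; omega), Finsupp.finsetSum_apply] at hle
    rw [← Finset.sum_mul]
    have e : X * (Real.log p / p + Real.log p / (p * (p - 1))) = X / (p - 1) * Real.log p := by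
      have : (p : ℝ) - 1 ≠ 0 := by linarith
      field_simp
      ring
    rw [e]
    apply mul_le_mul_of_nonneg_right _ (Real.log_nonneg hp1.le)
    rw [le_div_iff₀ (by linarith)]
    have := (Nat.cast_le (α := ℝ)).2 hle
    rw [Nat.cast_mul, Nat.cast_sub hpp.one_lt.le, Nat.cast_one, Nat.cast_sum] at this
    linarith
  refine (Finset.sum_le_sum h2).trans ?_
  rw [← Finset.mul_sum, Finset.sum_add_distrib]
  have h3 := (abs_le.1 (mertens_first z hz)).2
  have h4 : ∑ p ∈ z.primesLE, Real.log p / ((p : ℝ) * (p - 1)) ≤ 2 := by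
    have h3 := sum_log_div_mul_sub_one_le z hz
    have h4 : 0 ≤ (Real.log z + 2) / z :=
      div_nonneg (by linarith [Real.log_nonneg (show (1 : ℝ) ≤ z by exact_mod_cast hz)])
        (Nat.cast_nonneg _)
    refine le_trans ?_ (by linarith : ∑ k ∈ Finset.range (z + 1),
      Real.log k / ((k : ℝ) * (k - 1)) ≤ 2)
    apply Finset.sum_le_sum_of_subset_of_nonneg
    · rw [Nat.primesLE_eq_filter_range]; exact Finset.filter_subset _ _
    · intro k _ _
      rcases Nat.eq_zero_or_pos k with rfl | hk
      · simp
      · have : (1 : ℝ) ≤ k := by exact_mod_cast hk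
        exact div_nonneg (Real.log_nonneg this) (mul_nonneg (by linarith) (by linarith))
  apply mul_le_mul_of_nonneg_left _ (Nat.cast_nonneg X)
  linarith

/-- If removing a prime of `(v, T]` from `m ∈ M` always leaves an integer avoiding a set of small
primes that depends only on its rough part, then `M` is sparse. -/
theorem exists_card_avoiding_le :
    ∃ C : ℝ, 0 < C ∧ ∀ (X z v T : ℕ) (W : ℝ) (E : ℕ → Finset ℕ) (M : Finset ℕ),
      2 ≤ X → 2 ≤ z → z ≤ X → 2 ≤ v → 2 ≤ T → T ≤ X →
      (∀ b, E b ⊆ primesIoc 0 z) → (∀ b, W ≤ ∑ p ∈ E b, (1 : ℝ) / p) →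
      M ⊆ Finset.Icc 1 X →
      (∀ m ∈ M, ∀ r m', r.Prime → v < r → r ≤ T → m = r * m' → smoothPart z m' ≤ T →
        Disjoint (E (roughPart z m')) m'.primeFactors) →
      (M.card : ℝ) ≤ C * X * (Real.exp (-∑ p ∈ primesIoc v T, (1 : ℝ) / p) +
        (Real.log z + 5) / Real.log T + Real.log X / Real.log v * Real.exp (-W)) := by
  obtain ⟨C₁, hC₁, h₁⟩ := exists_card_sifted_le
  obtain ⟨C₂, hC₂, h₂⟩ := exists_sum_inv_avoiding_le
  have hl4 : 0 < Real.log 4 := Real.log_pos (by norm_num)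
  refine ⟨C₁ + 1 + Real.log 4 * C₂, by positivity, ?_⟩
  intro X z v T W E M hX hz hzX hv hT hTX hE hW hMX hM
  classical
  set M₁ := (Finset.Icc 1 X).filter (fun m ↦ ∀ r ∈ primesIoc v T, ¬ r ∣ m)
  set M₂ := (Finset.Icc 1 X).filter (fun m ↦ (T : ℝ) < smoothPart z m)
  set B := (Finset.Icc 1 X).filter (fun m ↦ Disjoint (E (roughPart z m)) m.primeFactors)
  set M₃ := (B.sigma fun m ↦ primesIoc v (X / m)).image (fun x ↦ x.2 * x.1)
  have hlv : 0 < Real.log v := Real.log_pos (by exact_mod_cast hv)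
  have hlT : 0 < Real.log T := Real.log_pos (by exact_mod_cast hT)
  have hlX : 0 < Real.log X := Real.log_pos (by exact_mod_cast hX)
  have hlz : 0 < Real.log z := Real.log_pos (by exact_mod_cast hz)
  -- Either `m` has no prime factor in `(v, T]`, or its smooth part is large, or `m = r m'` with
  -- `m'` counted by the avoiding sum. In the last case there are `O((X / m') / log v)` choices of
  -- `r` for each `m'`.
  have hcover : M ⊆ (M₁ ∪ M₂) ∪ M₃ := by
    intro m hm
    have hmX := hMX hm
    have hmX' := Finset.mem_Icc.1 hmX
    by_cases hm1 : m ∈ M₁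
    · exact Finset.mem_union_left _ (Finset.mem_union_left _ hm1)
    by_cases hm2 : m ∈ M₂
    · exact Finset.mem_union_left _ (Finset.mem_union_right _ hm2)
    apply Finset.mem_union_right
    have hm1' : ¬ ∀ r ∈ primesIoc v T, ¬ r ∣ m := fun h ↦ hm1 (Finset.mem_filter.2 ⟨hmX, h⟩)
    push Not at hm1'
    obtain ⟨r, hr, m', rfl⟩ := hm1'
    obtain ⟨⟨hvr, hrT⟩, hrp⟩ := mem_primesIoc.1 hr
    have hm2' : smoothPart z (r * m') ≤ T := by
      by_contra h
      exact hm2 (Finset.mem_filter.2 ⟨hmX, by exact_mod_cast not_le.1 h⟩)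
    have hne : r * m' ≠ 0 := by omega
    have hm0 : 0 < m' := Nat.pos_of_ne_zero (right_ne_zero_of_mul hne)
    have hs : smoothPart z m' ≤ T :=
      (Nat.le_of_dvd (smoothPart_pos _ _)
        (smoothPart_dvd_smoothPart (Dvd.intro_left r rfl) hne)).trans hm2'
    have hdis := hM _ hm r m' hrp hvr hrT rfl hs
    refine Finset.mem_image.2 ⟨⟨m', r⟩, Finset.mem_sigma.2 ⟨Finset.mem_filter.2
      ⟨Finset.mem_Icc.2 ⟨hm0, ?_⟩, hdis⟩, mem_primesIoc.2 ⟨⟨hvr, ?_⟩, hrp⟩⟩, rfl⟩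
    · exact (Nat.le_mul_of_pos_left m' hrp.pos).trans hmX'.2
    · exact (Nat.le_div_iff_mul_le hm0).2 hmX'.2
  have c₁ : (M₁.card : ℝ) ≤ C₁ * X * Real.exp (-∑ p ∈ primesIoc v T, (1 : ℝ) / p) := by
    apply h₁ X _ hX
    intro p hp
    have := mem_primesIoc.1 hp
    exact mem_primesIoc.2 ⟨⟨by omega, by omega⟩, this.2⟩
  have c₂ : (M₂.card : ℝ) ≤ 1 * X * ((Real.log z + 5) / Real.log T) := by
    rw [one_mul, ← mul_div_assoc, le_div_iff₀ hlT]
    exact card_large_smoothPart_mul_log_le (by omega) (by exact_mod_cast (by omega : 1 ≤ T))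
  have c₃ : (M₃.card : ℝ) ≤
      Real.log 4 * C₂ * X * (Real.log X / Real.log v * Real.exp (-W)) := by
    have h3 : (M₃.card : ℝ) ≤ ∑ m ∈ B, ((primesIoc v (X / m)).card : ℝ) := by
      rw [← Nat.cast_sum, ← Finset.card_sigma]
      exact_mod_cast Finset.card_image_le
    have h4 : ∑ m ∈ B, ((primesIoc v (X / m)).card : ℝ) ≤
        ∑ m ∈ B, Real.log 4 * X / Real.log v * (1 / m) := by
      refine Finset.sum_le_sum fun m _ ↦ ?_
      have h5 := card_mul_log_le_theta v (X / m) (by omega)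
      have h6 : ((X / m : ℕ) : ℝ) ≤ X / m := Nat.cast_div_le
      rw [div_mul_eq_mul_div, le_div_iff₀ hlv]
      refine h5.trans ?_
      rw [mul_one_div, mul_div_assoc]
      gcongr
    refine h3.trans (h4.trans ?_)
    rw [← Finset.mul_sum]
    refine (mul_le_mul_of_nonneg_left (h₂ X z W E hX hzX hE hW) (by positivity)).trans
      (le_of_eq ?_)
    field_simp
  have hcard : (M.card : ℝ) ≤ M₁.card + M₂.card + M₃.card := by
    have := (Finset.card_le_card hcover).trans ((Finset.card_union_le _ _).trans
      (Nat.add_le_add_right (Finset.card_union_le _ _) _))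
    exact_mod_cast this
  set a := Real.exp (-∑ p ∈ primesIoc v T, (1 : ℝ) / p)
  set b := (Real.log z + 5) / Real.log T
  set c := Real.log X / Real.log v * Real.exp (-W)
  have ha : 0 ≤ X * a := by positivity
  have hb : 0 ≤ X * b := by positivity
  have hc : 0 ≤ X * c := by positivity
  have t1 : 0 ≤ C₁ * (X * b) := by positivity
  have t2 : 0 ≤ C₁ * (X * c) := by positivity
  have t3 : 0 ≤ Real.log 4 * C₂ * (X * a) := by positivity
  have t4 : 0 ≤ Real.log 4 * C₂ * (X * b) := by positivity
  nlinarith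

/-! ### From the sieve to integers divisible by most small primes. -/

/-- If many multiples of `q` divide elements of the interval `[h - K, h + K]`, then some multiple
of `q` in this interval is divisible by most small primes. -/
theorem exists_card_lt_imp_exists_dvd :
    ∃ C : ℝ, 0 < C ∧ ∀ (N q z v T y₀ : ℕ) (h : ℤ) (K W : ℝ) (G : Finset ℕ),
      0 < q → 2 ≤ N / q → 2 ≤ z → z ≤ N / q → 2 ≤ v → 2 ≤ T → T ≤ N / q →
      G ⊆ Finset.Icc 1 N → (∀ n ∈ G, q ∣ n) → (∀ n ∈ G, 2 * K * T ^ 2 < n) →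
      (∀ n ∈ G, ∃ y : ℤ, |(y : ℝ) - h| ≤ K ∧ (n : ℤ) ∣ y) →
      W ≤ ∑ p ∈ primesIoc y₀ z, (1 : ℝ) / p →
      C * (N / q : ℕ) * (Real.exp (-∑ p ∈ primesIoc v T, (1 : ℝ) / p) +
        (Real.log z + 5) / Real.log T + Real.log (N / q : ℕ) / Real.log v * Real.exp (-W))
        < G.card →
      ∃ y : ℤ, |(y : ℝ) - h| ≤ K ∧ (q : ℤ) ∣ y ∧
        ∑ p ∈ primesIoc y₀ z with ¬ ((p : ℕ) : ℤ) ∣ y, (1 : ℝ) / p < W := by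
  obtain ⟨C, hC, hmain⟩ := exists_card_avoiding_le
  refine ⟨C, hC, ?_⟩
  intro N q z v T y₀ h K W G hq hX hz hzX hv hT hTX hGN hqG hlarge hgood hW hcard
  by_contra hcon
  push Not at hcon
  classical
  -- If `q b` has a multiple in the window, choose one; the forbidden primes are those not dividing
  -- it. Under the negated conclusion they have reciprocal mass at least `W`.
  let E : ℕ → Finset ℕ := fun b ↦
    if hb : ∃ y : ℤ, |(y : ℝ) - h| ≤ K ∧ ((q * b : ℕ) : ℤ) ∣ y then
      (primesIoc y₀ z).filter (fun p ↦ ¬ ((p : ℕ) : ℤ) ∣ hb.choose) else primesIoc y₀ z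
  have hEsub : ∀ b, E b ⊆ primesIoc 0 z := by
    intro b
    have h1 : E b ⊆ primesIoc y₀ z := by
      simp only [E]
      split_ifs
      · exact Finset.filter_subset _ _
      · exact subset_rfl
    refine h1.trans fun p hp ↦ ?_
    have := mem_primesIoc.1 hp
    exact mem_primesIoc.2 ⟨⟨by omega, this.1.2⟩, this.2⟩
  have hEW : ∀ b, W ≤ ∑ p ∈ E b, (1 : ℝ) / p := by
    intro b
    simp only [E]
    split_ifs with hb
    · refine hcon _ hb.choose_spec.1 (dvd_trans ?_ hb.choose_spec.2)
      exact_mod_cast Dvd.intro b rfl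
    · exact hW
  have hinj : Set.InjOn (fun n ↦ n / q) (G : Set ℕ) := by
    intro m hm n hn hmn
    have hmn' : m / q = n / q := hmn
    rw [← Nat.mul_div_cancel' (hqG m hm), ← Nat.mul_div_cancel' (hqG n hn), hmn']
  have hle := hmain (N / q) z v T W E (G.image (fun n ↦ n / q)) hX hz hzX hv hT hTX hEsub hEW
    (by
      intro m hm
      obtain ⟨n, hn, rfl⟩ := Finset.mem_image.1 hm
      have hn' := Finset.mem_Icc.1 (hGN hn)
      exact Finset.mem_Icc.2 ⟨Nat.div_pos (Nat.le_of_dvd (by omega) (hqG n hn)) hq,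
        Nat.div_le_div_right hn'.2⟩)
    (by
      intro m hm r m' hr hvr hrT hmr hsm
      obtain ⟨n, hn, hnm⟩ := Finset.mem_image.1 hm
      have hn' := Finset.mem_Icc.1 (hGN hn)
      have hnq : n = q * (r * m') := by
        rw [← hmr, ← hnm]; exact (Nat.mul_div_cancel' (hqG n hn)).symm
      have hm0 : m' ≠ 0 := by
        rintro rfl
        simp at hnq
        omega
      set b := roughPart z m' with hbdef
      have hm'eq : smoothPart z m' * b = m' := smoothPart_mul_roughPart z hm0
      obtain ⟨y, hyK, hny⟩ := hgood n hn
      have hqbn : q * b ∣ n := by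
        rw [hnq]
        exact mul_dvd_mul_left q ((roughPart_dvd hm0).mul_left r)
      have hex : ∃ y : ℤ, |(y : ℝ) - h| ≤ K ∧ ((q * b : ℕ) : ℤ) ∣ y :=
        ⟨y, hyK, (Int.natCast_dvd_natCast.2 hqbn).trans hny⟩
      have hEb : E b = (primesIoc y₀ z).filter (fun p ↦ ¬ ((p : ℕ) : ℤ) ∣ hex.choose) := by
        simp only [E]
        rw [dif_pos hex]
      -- Here `n = q r s b` with `r, s ≤ T`, so `q b ≥ n / T ^ 2 > 2K`. Hence the window holds at
      -- most one multiple of `q b`, and the chosen one is the `y` divisible by `n`. Removing the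
      -- prime `r` in advance leaves a cofactor whose rough part alone fixes `y`.
      have hsize : 2 * K < (q * b : ℕ) := by
        have h1 : n ≤ T ^ 2 * (q * b) := by
          calc n = q * (r * m') := hnq
            _ = q * (r * (smoothPart z m' * b)) := by rw [hm'eq]
            _ = (r * smoothPart z m') * (q * b) := by ring
            _ ≤ (T * T) * (q * b) := by gcongr
            _ = T ^ 2 * (q * b) := by ring
        have h2 : (n : ℝ) ≤ T ^ 2 * (q * b : ℕ) := by exact_mod_cast h1
        have h3 := (hlarge n hn).trans_le h2
        have hT2 : (0 : ℝ) < (T : ℝ) ^ 2 := by positivity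
        nlinarith
      have heq : hex.choose = y := by
        by_contra hne
        have hd : ((q * b : ℕ) : ℤ) ∣ hex.choose - y :=
          dvd_sub hex.choose_spec.2 ((Int.natCast_dvd_natCast.2 hqbn).trans hny)
        have h1 := Int.le_of_dvd (abs_pos.2 (sub_ne_zero.2 hne)) ((dvd_abs _ _).2 hd)
        have h2 : (((q * b : ℕ) : ℤ) : ℝ) ≤ |(hex.choose : ℝ) - y| := by exact_mod_cast h1
        have h3 : |(hex.choose : ℝ) - y| ≤ K + K := by
          have := abs_sub_le (hex.choose : ℝ) h y
          have h4 := hex.choose_spec.1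
          rw [abs_sub_comm (h : ℝ) y] at this
          linarith
        rw [Int.cast_natCast] at h2
        linarith
      rw [hEb, heq, Finset.disjoint_left]
      intro p hp hpm
      refine (Finset.mem_filter.1 hp).2 (dvd_trans ?_ hny)
      rw [Int.natCast_dvd_natCast, hnq]
      exact (Nat.dvd_of_mem_primeFactors hpm).mul_left _ |>.mul_left _)
  rw [Finset.card_image_of_injOn hinj] at hle
  linarith

/-- Two nearby integers divisible by most primes of an interval coincide. -/
lemma eq_of_dvd_most_primes {y₀ z : ℕ} {h y y' : ℤ} {K W : ℝ} (hy₀ : 3 ≤ y₀)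
    (hKy : Real.log (2 * K) ≤ y₀) (hW : 2 * W + 1 ≤ ∑ p ∈ primesIoc y₀ z, (1 : ℝ) / p)
    (hy : |(y : ℝ) - h| ≤ K) (hy' : |(y' : ℝ) - h| ≤ K)
    (hyW : ∑ p ∈ primesIoc y₀ z with ¬ ((p : ℕ) : ℤ) ∣ y, (1 : ℝ) / p < W)
    (hyW' : ∑ p ∈ primesIoc y₀ z with ¬ ((p : ℕ) : ℤ) ∣ y', (1 : ℝ) / p < W) : y = y' := by
  by_contra hne
  set P := primesIoc y₀ z with hP
  set S := P.filter (fun p ↦ ((p : ℕ) : ℤ) ∣ y ∧ ((p : ℕ) : ℤ) ∣ y') with hS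
  have hcov : P ⊆ S ∪ (P.filter (fun p ↦ ¬ ((p : ℕ) : ℤ) ∣ y) ∪
      P.filter (fun p ↦ ¬ ((p : ℕ) : ℤ) ∣ y')) := by
    intro p hp
    simp only [hS, Finset.mem_union, Finset.mem_filter]
    tauto
  have hnn : ∀ p : ℕ, (0 : ℝ) ≤ 1 / p := fun p ↦ by positivity
  have hunion : ∀ A B : Finset ℕ, ∑ p ∈ A ∪ B, (1 : ℝ) / p ≤
      ∑ p ∈ A, (1 : ℝ) / p + ∑ p ∈ B, (1 : ℝ) / p := fun A B ↦ by
    rw [← Finset.sum_union_inter]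
    exact le_add_of_nonneg_right (Finset.sum_nonneg fun p _ ↦ hnn p)
  have hsum := (Finset.sum_le_sum_of_subset_of_nonneg hcov fun p _ _ ↦ hnn p).trans
    ((hunion _ _).trans (add_le_add_right (hunion _ _) _))
  -- The primes dividing both integers have reciprocal mass above `1`. However, their product
  -- divides a nonzero difference of size at most `2K`, so there are at most `y₀` of them, each
  -- exceeding `y₀`.
  have hSgt : 1 < ∑ p ∈ S, (1 : ℝ) / p := by linarith
  have hSp : ∀ p ∈ S, p.Prime ∧ y₀ < p ∧ (p : ℤ) ∣ y - y' := fun p hp ↦ by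
    have h1 := Finset.mem_filter.1 hp
    have h2 := mem_primesIoc.1 h1.1
    exact ⟨h2.2, h2.1.1, dvd_sub h1.2.1 h1.2.2⟩
  have hdvd : ∏ p ∈ S, p ∣ (y - y').natAbs :=
    Finset.prod_primes_dvd _ (fun p hp ↦ (hSp p hp).1.prime)
      fun p hp ↦ Int.natCast_dvd.1 (hSp p hp).2.2
  have hle := Nat.le_of_dvd (Int.natAbs_pos.2 (sub_ne_zero.2 hne)) hdvd
  have hpow : y₀ ^ S.card ≤ ∏ p ∈ S, p :=
    Finset.pow_card_le_prod S _ _ fun p hp ↦ (hSp p hp).2.1.le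
  have h1 : (y₀ : ℝ) ^ S.card ≤ 2 * K := by
    have h2 : ((y₀ ^ S.card : ℕ) : ℝ) ≤ ((y - y').natAbs : ℝ) := by exact_mod_cast hpow.trans hle
    rw [Nat.cast_pow, Nat.cast_natAbs] at h2
    have h3 := abs_sub_le (y : ℝ) h y'
    rw [abs_sub_comm (h : ℝ) y'] at h3
    push_cast at h2
    linarith
  have hy₀' : (3 : ℝ) ≤ y₀ := by exact_mod_cast hy₀
  have hlog1 : 1 ≤ Real.log y₀ := by
    rw [Real.le_log_iff_exp_le (by linarith)]
    linarith [Real.exp_one_lt_d9]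
  have h2 : (S.card : ℝ) ≤ y₀ := by
    have h3 := Real.log_le_log (by positivity) h1
    rw [Real.log_pow] at h3
    have : (S.card : ℝ) * 1 ≤ S.card * Real.log y₀ := by gcongr
    linarith
  have h3 : ∑ p ∈ S, (1 : ℝ) / p ≤ ∑ p ∈ S, (1 : ℝ) / y₀ := by
    refine Finset.sum_le_sum fun p hp ↦ ?_
    apply one_div_le_one_div_of_le (by linarith)
    exact_mod_cast (hSp p hp).2.1.le
  rw [Finset.sum_const, nsmul_eq_mul, mul_one_div] at h3
  have h4 : (S.card : ℝ) / y₀ ≤ 1 := (div_le_one (by linarith)).2 h2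
  linarith

/-! ### Choice of the sieve parameters and the common multiple. -/

open Filter Topology

lemma log_le_two_mul_log_floor {w : ℝ} (hw : 2 ≤ w) : Real.log w ≤ 2 * Real.log ⌊w⌋₊ := by
  have hf2 : 2 ≤ ⌊w⌋₊ := Nat.le_floor (by exact_mod_cast hw)
  have hf2' : (2 : ℝ) ≤ ⌊w⌋₊ := by exact_mod_cast hf2
  have hlt : w < ⌊w⌋₊ + 1 := Nat.lt_floor_add_one w
  rw [show 2 * Real.log ⌊w⌋₊ = Real.log ((⌊w⌋₊ : ℝ) ^ 2) by rw [Real.log_pow]; norm_num]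
  apply Real.log_le_log (by linarith)
  nlinarith

lemma eventually_const_mul_rpow_le {a b : ℝ} (hab : a < b) (C : ℝ) {c : ℝ} (hc : 0 < c) :
    ∀ᶠ t : ℝ in atTop, C * t ^ a ≤ c * t ^ b := by
  have h : Tendsto (fun t : ℝ ↦ t ^ (b - a)) atTop atTop := tendsto_rpow_atTop (by linarith)
  filter_upwards [h.eventually_ge_atTop (C / c), eventually_gt_atTop 0] with t ht ht0
  rw [div_le_iff₀ hc] at ht
  have e : t ^ b = t ^ (b - a) * t ^ a := by rw [← Real.rpow_add ht0]; congr 1; ring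
  rw [e, ← mul_assoc, mul_comm c]
  gcongr

lemma eventually_log_succ_le : ∀ᶠ t : ℝ in atTop, Real.log (t + 1) ≤ t ^ (1 / 5 : ℝ) := by
  have h := (isLittleO_log_rpow_atTop (show (0 : ℝ) < 1 / 5 by norm_num)).bound
    (show (0 : ℝ) < 1 / 2 by norm_num)
  have h2 : Tendsto (fun t : ℝ ↦ t ^ (1 / 5 : ℝ)) atTop atTop :=
    tendsto_rpow_atTop (by norm_num)
  filter_upwards [h, eventually_ge_atTop 1, h2.eventually_ge_atTop 2] with t ht h1 h3
  rw [Real.norm_of_nonneg (Real.log_nonneg h1), Real.norm_of_nonneg (by positivity)] at ht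
  have h4 : Real.log (t + 1) ≤ Real.log (t * 2) := Real.log_le_log (by linarith) (by linarith)
  rw [Real.log_mul (by linarith) (by norm_num)] at h4
  have h5 : Real.log 2 ≤ 1 := by
    have := Real.log_le_sub_one_of_pos (show (0 : ℝ) < 2 by norm_num)
    linarith
  linarith

/-- The error terms of the sieve are small for a suitable choice of parameters. -/
lemma eventually_sieve_terms_lt {δ : ℝ} (hδ : 0 < δ) {C : ℝ} (hC : 0 < C) :
    ∀ᶠ t : ℝ in atTop, ∃ W : ℝ,
      2 * W + 1 ≤ ∑ p ∈ primesIoc ⌊t + 1⌋₊ ⌊Real.exp (t ^ (4 / 5 : ℝ))⌋₊, (1 : ℝ) / p ∧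
      W ≤ ∑ p ∈ primesIoc ⌊t + 1⌋₊ ⌊Real.exp (t ^ (4 / 5 : ℝ))⌋₊, (1 : ℝ) / p ∧
      C * (Real.exp (-∑ p ∈ primesIoc ⌊Real.exp (t ^ (9 / 10 : ℝ))⌋₊ ⌊Real.exp (t * (δ / 32))⌋₊,
          (1 : ℝ) / p) +
        (Real.log ⌊Real.exp (t ^ (4 / 5 : ℝ))⌋₊ + 5) / Real.log ⌊Real.exp (t * (δ / 32))⌋₊ +
        t / Real.log ⌊Real.exp (t ^ (9 / 10 : ℝ))⌋₊ * Real.exp (-W)) <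
      t ^ (-(1 / 20) : ℝ) / 2 := by
  have hd : 0 < δ / 32 := by positivity
  have hlog2 : 24 / Real.log 2 ≤ 40 := by
    rw [div_le_iff₀ (Real.log_pos (by norm_num))]
    linarith [Real.log_two_gt_d9]
  filter_upwards [eventually_ge_atTop 2, eventually_log_succ_le,
    eventually_const_mul_rpow_le (show (9 / 10 : ℝ) < 1 by norm_num) 1 hd,
    (tendsto_rpow_atTop (show (0 : ℝ) < 4 / 5 by norm_num)).eventually_ge_atTop 5,
    eventually_const_mul_rpow_le (show (1 / 5 : ℝ) < 4 / 5 by norm_num) 1 one_pos,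
    (tendsto_rpow_atTop (show (0 : ℝ) < 9 / 10 by norm_num)).eventually_ge_atTop 1,
    eventually_const_mul_rpow_le (show (-(1 / 10) : ℝ) < -(1 / 20) by norm_num)
      (C * Real.exp 40 / (δ / 32)) (show (0 : ℝ) < 1 / 8 by norm_num),
    eventually_const_mul_rpow_le (show (-(1 / 5) : ℝ) < -(1 / 20) by norm_num)
      (C * (4 / (δ / 32))) (show (0 : ℝ) < 1 / 8 by norm_num),
    eventually_const_mul_rpow_le (show (-(1 / 5) : ℝ) < -(1 / 20) by norm_num)
      (C * (2 * Real.exp 21)) (show (0 : ℝ) < 1 / 8 by norm_num)]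
    with t ht2 hlogt h910 h45 h1545 h91 e1 e2 e3
  have ht0 : 0 < t := by linarith
  rw [Real.rpow_one, one_mul] at h910
  rw [one_mul, one_mul] at h1545
  set z := Real.exp (t ^ (4 / 5 : ℝ)) with hz
  set v := Real.exp (t ^ (9 / 10 : ℝ)) with hv
  set T := Real.exp (t * (δ / 32)) with hT
  have hv2 : 2 ≤ v := by
    have := Real.add_one_le_exp (t ^ (9 / 10 : ℝ))
    linarith
  have hvT : v ≤ T := Real.exp_le_exp.2 (by linarith)
  have hz2 : 2 ≤ z := by
    have := Real.add_one_le_exp (t ^ (4 / 5 : ℝ))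
    linarith
  have htz : t + 1 ≤ z := by
    rw [← Real.log_le_iff_le_exp (by linarith)]
    linarith
  have hfin : ∀ u : ℝ, 2 ≤ u → 24 / Real.log u ≤ 40 := by
    intro u hu
    refine le_trans ?_ hlog2
    exact div_le_div_of_nonneg_left (by norm_num) (Real.log_pos (by norm_num))
      (Real.log_le_log (by norm_num) hu)
  set w := ∑ p ∈ primesIoc ⌊t + 1⌋₊ ⌊z⌋₊, (1 : ℝ) / p with hw
  have hw0 : 0 ≤ w := Finset.sum_nonneg fun p _ ↦ by positivity
  -- The largest `W` with `2 W + 1 ≤ w`. Since `w ≥ (4/5 - 1/5) log t - O(1)`, this gives `exp (-W)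
  -- ≪ t ^ (-3/10)`. The three error terms are then of order `t ^ (-1/10)`, `t ^ (-1/5)` and `t ^
  -- (1/10 - 3/10)`, all below `t ^ (-1/20)`.
  refine ⟨(w - 1) / 2, by linarith, by linarith, ?_⟩
  have m1 := (abs_le.1 (mertens_second hv2 hvT)).1
  have m2 := (abs_le.1 (mertens_second (by linarith : (2 : ℝ) ≤ t + 1) htz)).1
  have f1 := hfin v hv2
  have f2 := hfin (t + 1) (by linarith)
  have hlz : Real.log z = t ^ (4 / 5 : ℝ) := Real.log_exp _
  have hlv : Real.log v = t ^ (9 / 10 : ℝ) := Real.log_exp _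
  have hlT : Real.log T = t * (δ / 32) := Real.log_exp _
  have hlt : 0 < Real.log t := Real.log_pos (by linarith)
  have b1 : Real.exp (-∑ p ∈ primesIoc ⌊v⌋₊ ⌊T⌋₊, (1 : ℝ) / p) ≤
      Real.exp 40 / (δ / 32) * t ^ (-(1 / 10) : ℝ) := by
    rw [hlv, hlT, Real.log_rpow ht0, Real.log_mul ht0.ne' hd.ne'] at m1
    rw [hlv] at f1
    calc _ ≤ Real.exp (40 - Real.log (δ / 32) + Real.log t * (-(1 / 10))) := by
          apply Real.exp_le_exp.2
          linarith
      _ = _ := by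
          rw [Real.exp_add, Real.exp_sub, Real.exp_log hd, ← Real.rpow_def_of_pos ht0]
  have b2 : (Real.log ⌊z⌋₊ + 5) / Real.log ⌊T⌋₊ ≤ 4 / (δ / 32) * t ^ (-(1 / 5) : ℝ) := by
    have g1 : Real.log ⌊z⌋₊ ≤ t ^ (4 / 5 : ℝ) := by
      rw [← hlz]
      apply Real.log_le_log
      · exact_mod_cast Nat.floor_pos.2 (by linarith)
      · exact Nat.floor_le (by linarith)
    have g2 := log_le_two_mul_log_floor (hv2.trans hvT)
    rw [hlT] at g2
    have hpos : 0 < t * (δ / 32) := by positivity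
    rw [div_le_iff₀ (by linarith)]
    have e : t ^ (4 / 5 : ℝ) = t ^ (-(1 / 5) : ℝ) * t := by
      conv_rhs => rw [← Real.rpow_one t, ← Real.rpow_mul ht0.le, ← Real.rpow_add ht0]
      norm_num
    have hp : 0 < t ^ (-(1 / 5) : ℝ) := by positivity
    calc Real.log ⌊z⌋₊ + 5 ≤ 2 * (t ^ (-(1 / 5) : ℝ) * t) := by linarith
      _ = 4 / (δ / 32) * t ^ (-(1 / 5) : ℝ) * (t * (δ / 32) / 2) := by field_simp; ring
      _ ≤ _ := by
        gcongr
        linarith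
  have b3 : t / Real.log ⌊v⌋₊ * Real.exp (-((w - 1) / 2)) ≤
      2 * Real.exp 21 * t ^ (-(1 / 5) : ℝ) := by
    have g2 := log_le_two_mul_log_floor hv2
    rw [hlv] at g2
    have hp : 0 < t ^ (9 / 10 : ℝ) := by positivity
    have h1 : t / Real.log ⌊v⌋₊ ≤ 2 * t ^ (1 / 10 : ℝ) := by
      rw [div_le_iff₀ (by linarith)]
      have e : t = t ^ (1 / 10 : ℝ) * t ^ (9 / 10 : ℝ) := by
        rw [← Real.rpow_add ht0]; norm_num
      calc t = t ^ (1 / 10 : ℝ) * t ^ (9 / 10 : ℝ) := e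
        _ ≤ t ^ (1 / 10 : ℝ) * (2 * Real.log ⌊v⌋₊) := by gcongr
        _ = _ := by ring
    have h2 : Real.exp (-((w - 1) / 2)) ≤ Real.exp 21 * t ^ (-(3 / 10) : ℝ) := by
      rw [hlz, Real.log_rpow ht0] at m2
      have h3 : Real.log (Real.log (t + 1)) ≤ 1 / 5 * Real.log t := by
        rw [← Real.log_rpow ht0]
        exact Real.log_le_log (Real.log_pos (by linarith)) hlogt
      rw [Real.rpow_def_of_pos ht0, ← Real.exp_add]
      apply Real.exp_le_exp.2
      linarith
    calc _ ≤ 2 * t ^ (1 / 10 : ℝ) * (Real.exp 21 * t ^ (-(3 / 10) : ℝ)) := by gcongr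
      _ = 2 * Real.exp 21 * (t ^ (1 / 10 : ℝ) * t ^ (-(3 / 10) : ℝ)) := by ring
      _ = _ := by rw [← Real.rpow_add ht0]; norm_num
  have hp : 0 < t ^ (-(1 / 20) : ℝ) := by positivity
  calc _ ≤ C * (Real.exp 40 / (δ / 32) * t ^ (-(1 / 10) : ℝ) +
        4 / (δ / 32) * t ^ (-(1 / 5) : ℝ) + 2 * Real.exp 21 * t ^ (-(1 / 5) : ℝ)) := by gcongr
    _ = C * Real.exp 40 / (δ / 32) * t ^ (-(1 / 10) : ℝ) +
        C * (4 / (δ / 32)) * t ^ (-(1 / 5) : ℝ) + C * (2 * Real.exp 21) * t ^ (-(1 / 5) : ℝ) := by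
      ring
    _ ≤ 1 / 8 * t ^ (-(1 / 20) : ℝ) + 1 / 8 * t ^ (-(1 / 20) : ℝ) +
        1 / 8 * t ^ (-(1 / 20) : ℝ) := by gcongr
    _ < _ := by linarith

lemma tendsto_log_natCast : Tendsto (fun N : ℕ ↦ Real.log N) atTop atTop :=
  Real.tendsto_log_atTop.comp tendsto_natCast_atTop_atTop

open Classical in
/-- If, for every `q ∈ D`, a positive proportion (up to logarithms) of the multiples of `q` divide
elements of a short interval, then a single element of this interval is a multiple of all
`q ∈ D`. -/
theorem eventually_exists_common_multiple {δ c : ℝ} (hδ : 0 < δ) (hc : 0 < c) :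
    ∀ᶠ N : ℕ in atTop, ∀ (h : ℤ) (A D : Finset ℕ), A ⊆ Finset.Icc 1 N →
      (∀ n ∈ A, c * N ≤ n) →
      (∀ q ∈ D, 0 < q ∧ (q : ℝ) ≤ (N : ℝ) ^ (1 - δ) ∧
        Real.log N ^ (-(1 / 20) : ℝ) / 2 * (N / q) ≤
          ((A.filter (fun n ↦ q ∣ n ∧
            ∃ y : ℤ, |(y : ℝ) - h| ≤ (N : ℝ) ^ (1 - δ / 8) ∧ (n : ℤ) ∣ y)).card : ℝ)) →
      ∃ x : ℤ, |(x : ℝ) - h| ≤ (N : ℝ) ^ (1 - δ / 8) ∧ ∀ q ∈ D, (q : ℤ) ∣ x := by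
  obtain ⟨C, hC, hmain⟩ := exists_card_lt_imp_exists_dvd
  have hexp : Tendsto (fun t : ℝ ↦ Real.exp (t * (δ / 16))) atTop atTop :=
    Real.tendsto_exp_atTop.comp (tendsto_id.atTop_mul_const (by positivity))
  have hexp2 : Tendsto (fun t : ℝ ↦ Real.exp (t * (δ / 32))) atTop atTop :=
    Real.tendsto_exp_atTop.comp (tendsto_id.atTop_mul_const (by positivity))
  have hexp3 : Tendsto (fun t : ℝ ↦ Real.exp (t * (δ / 8))) atTop atTop :=
    Real.tendsto_exp_atTop.comp (tendsto_id.atTop_mul_const (by positivity))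
  filter_upwards [tendsto_log_natCast.eventually (eventually_sieve_terms_lt hδ hC),
    tendsto_log_natCast.eventually (eventually_ge_atTop 2),
    tendsto_log_natCast.eventually (hexp.eventually_gt_atTop (2 / c)),
    tendsto_log_natCast.eventually (hexp2.eventually_ge_atTop 2),
    tendsto_log_natCast.eventually (hexp3.eventually_ge_atTop 2),
    tendsto_log_natCast.eventually
      (eventually_const_mul_rpow_le (show (4 / 5 : ℝ) < 1 by norm_num) 1 hδ),
    tendsto_log_natCast.eventually
      ((tendsto_rpow_atTop (show (0 : ℝ) < 4 / 5 by norm_num)).eventually_ge_atTop 1),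
    tendsto_log_natCast.eventually
      ((tendsto_rpow_atTop (show (0 : ℝ) < 9 / 10 by norm_num)).eventually_ge_atTop 1),
    eventually_gt_atTop 0] with N hterms ht2 hc2 hT2 hK2 h45 hz1 hv1 hN0 h A D hA hAc hD
  set t := Real.log N with ht
  have hN : (0 : ℝ) < N := by exact_mod_cast hN0
  have hNexp : (N : ℝ) = Real.exp t := (Real.exp_log hN).symm
  set K := (N : ℝ) ^ (1 - δ / 8) with hK
  have hKexp : K = Real.exp (t * (1 - δ / 8)) := by rw [hK, Real.rpow_def_of_pos hN]
  obtain ⟨W, hW1, hW2, hW3⟩ := hterms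
  set z := ⌊Real.exp (t ^ (4 / 5 : ℝ))⌋₊ with hz
  set v := ⌊Real.exp (t ^ (9 / 10 : ℝ))⌋₊ with hv
  set T := ⌊Real.exp (t * (δ / 32))⌋₊ with hT
  set y₀ := ⌊t + 1⌋₊ with hy₀
  have hfl : ∀ s : ℝ, 1 ≤ s → 2 ≤ ⌊Real.exp s⌋₊ := fun s hs ↦ Nat.le_floor (by
    have := Real.add_one_le_exp s
    push_cast
    linarith)
  have hz2 : 2 ≤ z := hfl _ hz1
  have hv2 : 2 ≤ v := hfl _ hv1
  have hTnat : 2 ≤ T := Nat.le_floor (by exact_mod_cast hT2)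
  have hy3 : 3 ≤ y₀ := Nat.le_floor (by push_cast; linarith)
  have key : ∀ q ∈ D, ∃ y : ℤ, |(y : ℝ) - h| ≤ K ∧ (q : ℤ) ∣ y ∧
      ∑ p ∈ primesIoc y₀ z with ¬ ((p : ℕ) : ℤ) ∣ y, (1 : ℝ) / p < W := by
    intro q hq
    obtain ⟨hq0, hqN, hcard⟩ := hD q hq
    have hq0' : (0 : ℝ) < q := by exact_mod_cast hq0
    have hXlow : Real.exp (t * δ) ≤ N / q := by
      rw [le_div_iff₀ hq0']
      rw [Real.rpow_def_of_pos hN] at hqN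
      calc Real.exp (t * δ) * q ≤ Real.exp (t * δ) * Real.exp (t * (1 - δ)) := by gcongr
        _ = N := by rw [← Real.exp_add, hNexp]; congr 1; ring
    have hfloor : N / q = ⌊(N : ℝ) / q⌋₊ := (Nat.floor_div_eq_div N q).symm
    have hzX : z ≤ N / q := by
      rw [hfloor]
      apply Nat.floor_le_floor
      refine le_trans (Real.exp_le_exp.2 ?_) hXlow
      rw [Real.rpow_one] at h45
      linarith
    have hTX : T ≤ N / q := by
      rw [hfloor]
      apply Nat.floor_le_floor
      refine le_trans (Real.exp_le_exp.2 ?_) hXlow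
      gcongr
      linarith
    have hXle : ((N / q : ℕ) : ℝ) ≤ N / q := Nat.cast_div_le
    have hXpos : (0 : ℝ) < (N / q : ℕ) := by exact_mod_cast (by omega : 0 < N / q)
    refine hmain N q z v T y₀ h K W (A.filter (fun n ↦ q ∣ n ∧
      ∃ y : ℤ, |(y : ℝ) - h| ≤ K ∧ (n : ℤ) ∣ y)) hq0 (hz2.trans hzX) hz2 hzX hv2 hTnat hTX
      ((Finset.filter_subset _ _).trans hA) (fun n hn ↦ (Finset.mem_filter.1 hn).2.1) ?_
      (fun n hn ↦ (Finset.mem_filter.1 hn).2.2) hW2 ?_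
    · intro n hn
      refine lt_of_lt_of_le ?_ (hAc n (Finset.mem_filter.1 hn).1)
      have h1 : (T : ℝ) ≤ Real.exp (t * (δ / 32)) := Nat.floor_le (Real.exp_pos _).le
      have hK0 : 0 < K := by rw [hKexp]; positivity
      -- The exponent `δ / 32` of `T` makes `K T ^ 2` at most `N ^ (1 - δ / 16)`, still below `c N`.
      calc 2 * K * (T : ℝ) ^ 2 ≤ 2 * K * Real.exp (t * (δ / 32)) ^ 2 := by gcongr
        _ = 2 * Real.exp (t * (1 - δ / 16)) := by
          rw [hKexp, ← Real.exp_nat_mul, mul_assoc, ← Real.exp_add]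
          congr 2
          push_cast
          ring
        _ < c * Real.exp (t * (δ / 16)) * Real.exp (t * (1 - δ / 16)) := by
          gcongr
          rw [div_lt_iff₀ hc] at hc2
          linarith
        _ = c * N := by
          rw [mul_assoc, ← Real.exp_add, hNexp]
          congr 2
          ring
    · refine lt_of_lt_of_le ?_ hcard
      have hlogX : Real.log (N / q : ℕ) ≤ t := by
        apply Real.log_le_log hXpos
        exact_mod_cast Nat.div_le_self N q
      have hlv : 0 < Real.log v := Real.log_pos (by exact_mod_cast hv2)
      have hlT : 0 < Real.log T := Real.log_pos (by exact_mod_cast hTnat)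
      have hlz : 0 < Real.log z := Real.log_pos (by exact_mod_cast hz2)
      calc _ ≤ C * (N / q : ℕ) * (Real.exp (-∑ p ∈ primesIoc v T, (1 : ℝ) / p) +
            (Real.log z + 5) / Real.log T + t / Real.log v * Real.exp (-W)) := by gcongr
        _ = (C * (Real.exp (-∑ p ∈ primesIoc v T, (1 : ℝ) / p) +
            (Real.log z + 5) / Real.log T + t / Real.log v * Real.exp (-W))) * (N / q : ℕ) := by
          ring
        _ < t ^ (-(1 / 20) : ℝ) / 2 * (N / q : ℕ) := by gcongr
        _ ≤ _ := by gcongr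
  rcases D.eq_empty_or_nonempty with rfl | ⟨q₀, hq₀⟩
  · refine ⟨h, ?_, by simp⟩
    rw [sub_self, abs_zero, hKexp]
    positivity
  · obtain ⟨x, hx1, hx2, hx3⟩ := key q₀ hq₀
    refine ⟨x, hx1, fun q hq ↦ ?_⟩
    obtain ⟨y, hy1, hy2, hy3'⟩ := key q hq
    -- The integers found for `q₀` and for `q` lie in one window and both are divisible by most
    -- primes of `(y₀, z]`, so they agree. The choice `y₀ = ⌊t + 1⌋` exceeds `t ≥ log (2K)`.
    have : x = y := by
      refine eq_of_dvd_most_primes hy3 ?_ hW1 hx1 hy1 hx3 hy3'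
      have h1 : Real.log (2 * K) ≤ t := by
        rw [ht]
        apply Real.log_le_log (by rw [hKexp]; positivity)
        calc 2 * K ≤ Real.exp (t * (δ / 8)) * K := by
              gcongr
          _ = N := by rw [hKexp, hNexp, ← Real.exp_add]; congr 1; ring
      have h2 : t + 1 < y₀ + 1 := Nat.lt_floor_add_one _
      linarith
    rw [this]
    exact hy2

/-! ### Additive characters and Bernoulli characteristic functions. -/

/-- The additive character `θ ↦ exp (2πiθ)`. -/
noncomputable def phase (θ : ℝ) : ℂ := Complex.exp ((2 * Real.pi * θ : ℝ) * Complex.I)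

lemma phase_add (a b : ℝ) : phase (a + b) = phase a * phase b := by
  unfold phase
  rw [← Complex.exp_add]
  congr 1
  push_cast
  ring

lemma phase_int (n : ℤ) : phase n = 1 := by
  unfold phase
  rw [Complex.exp_eq_one_iff]
  exact ⟨n, by push_cast; ring⟩

lemma phase_zero : phase 0 = 1 := by
  simpa using phase_int 0

lemma phase_eq_one_iff {θ : ℝ} : phase θ = 1 ↔ ∃ n : ℤ, θ = n := by
  constructor
  · intro h
    obtain ⟨n, hn⟩ := Complex.exp_eq_one_iff.1 h
    refine ⟨n, ?_⟩
    have hI : (2 * Real.pi * Complex.I : ℂ) ≠ 0 := Complex.two_pi_I_ne_zero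
    have h2 : (θ : ℂ) * (2 * Real.pi * Complex.I) = n * (2 * Real.pi * Complex.I) := by
      rw [← hn]; push_cast; ring
    exact_mod_cast mul_right_cancel₀ hI h2
  · rintro ⟨n, rfl⟩
    exact phase_int n

lemma phase_sum {ι : Type*} (s : Finset ι) (f : ι → ℝ) :
    phase (∑ i ∈ s, f i) = ∏ i ∈ s, phase (f i) := by
  classical
  induction s using Finset.induction_on with
  | empty => simp [phase_zero]
  | insert a s ha ih => rw [Finset.sum_insert ha, Finset.prod_insert ha, phase_add, ih]

lemma phase_re (θ : ℝ) : (phase θ).re = Real.cos (2 * Real.pi * θ) := by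
  rw [phase, Complex.exp_ofReal_mul_I_re]

lemma phase_im (θ : ℝ) : (phase θ).im = Real.sin (2 * Real.pi * θ) := by
  rw [phase, Complex.exp_ofReal_mul_I_im]

/-- The characteristic function of a Bernoulli variable. -/
noncomputable def bernoulliChar (p θ : ℝ) : ℂ := (1 - p : ℝ) + (p : ℝ) * phase θ

/-- The squared norm is `1 - 2p(1-p)(1 - cos 2πθ)`, and `1 - cos 2πθ` is at least `8` times the
squared distance from `θ` to the nearest integer. -/
lemma norm_bernoulliChar_le {p θ t : ℝ} (hp0 : 0 ≤ p) (hp1 : p ≤ 1) (ht : 0 ≤ t)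
    (h : ∀ k : ℤ, t ≤ |θ - k|) :
    ‖bernoulliChar p θ‖ ≤ Real.exp (-(8 * p * (1 - p) * t ^ 2)) := by
  have hsq : ‖bernoulliChar p θ‖ ^ 2 = 1 - 2 * p * (1 - p) * (1 - Real.cos (2 * Real.pi * θ)) := by
    rw [← Complex.normSq_eq_norm_sq, Complex.normSq_apply, bernoulliChar]
    simp only [Complex.add_re, Complex.ofReal_re, Complex.mul_re, Complex.ofReal_im, phase_re,
      phase_im, Complex.add_im, Complex.mul_im, zero_mul, sub_zero, zero_add, add_zero]
    have := Real.sin_sq_add_cos_sq (2 * Real.pi * θ)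
    linear_combination p ^ 2 * this
  have hcos : Real.cos (2 * Real.pi * θ) ≤ 1 - 8 * t ^ 2 := by
    have h1 : Real.cos (2 * Real.pi * θ) = Real.cos (2 * Real.pi * (θ - round θ)) := by
      rw [mul_sub, ← Real.cos_sub_int_mul_two_pi (2 * Real.pi * θ) (round θ)]
      congr 1
      ring
    have h2 := abs_sub_round θ
    have h3 := h (round θ)
    set φ := θ - round θ
    have h4 : Real.cos (2 * Real.pi * φ) ≤ 1 - 2 / Real.pi ^ 2 * (2 * Real.pi * φ) ^ 2 := by
      apply Real.cos_le_one_sub_mul_cos_sq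
      rw [abs_mul, abs_of_pos Real.two_pi_pos]
      nlinarith [Real.pi_pos]
    have h5 : 2 / Real.pi ^ 2 * (2 * Real.pi * φ) ^ 2 = 8 * φ ^ 2 := by
      field_simp
      ring
    have h6 : t ^ 2 ≤ φ ^ 2 := by
      rw [← sq_abs φ]
      gcongr
    rw [h1]
    linarith
  have hpp : 0 ≤ p * (1 - p) := mul_nonneg hp0 (by linarith)
  have h1 : ‖bernoulliChar p θ‖ ^ 2 ≤ Real.exp (-(8 * p * (1 - p) * t ^ 2)) ^ 2 := by
    rw [hsq, ← Real.exp_nat_mul]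
    refine le_trans ?_ (Real.add_one_le_exp _)
    push_cast
    nlinarith
  exact (sq_le_sq₀ (norm_nonneg _) (Real.exp_pos _).le).1 h1

lemma norm_bernoulliChar_le_one {p : ℝ} (θ : ℝ) (hp0 : 0 ≤ p) (hp1 : p ≤ 1) :
    ‖bernoulliChar p θ‖ ≤ 1 := by
  have := norm_bernoulliChar_le (θ := θ) hp0 hp1 le_rfl fun k ↦ abs_nonneg _
  simpa using this

lemma abs_sin_sub_le {x : ℝ} (hx : |x| ≤ 1) : |Real.sin x - x| ≤ |x| ^ 3 := by
  have h := Real.sin_bound hx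
  have h1 : |x| ^ 5 ≤ |x| ^ 3 := pow_le_pow_of_le_one (abs_nonneg x) hx (by norm_num)
  have h2 : |x ^ 3 / 6| = |x| ^ 3 / 6 := by rw [abs_div, abs_pow]; norm_num
  have h3 : Real.sin x - x = (Real.sin x - (x - x ^ 3 / 6)) - x ^ 3 / 6 := by ring
  rw [h3]
  refine (abs_sub _ _).trans ?_
  have : 0 ≤ |x| ^ 3 := by positivity
  linarith

/-- The centred Bernoulli characteristic function is nearly real close to the origin. -/
lemma centred_bernoulliChar_bounds {p θ u : ℝ} (hp0 : 0 ≤ p) (hp1 : p ≤ 1)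
    (hθ : |2 * Real.pi * θ| ≤ u) (hu : u ≤ 1) :
    0 ≤ (bernoulliChar p θ * phase (-(p * θ))).re ∧
      |(bernoulliChar p θ * phase (-(p * θ))).im| ≤
        2 * u ^ 3 * (bernoulliChar p θ * phase (-(p * θ))).re := by
  have e : bernoulliChar p θ * phase (-(p * θ)) =
      (1 - p : ℝ) * phase (-(p * θ)) + (p : ℝ) * phase ((1 - p) * θ) := by
    -- After centring, the variable takes the values `-p` and `1 - p` and has mean zero, so the
    -- linear terms of the two sines cancel and the imaginary part is cubic in `u`.
    rw [bernoulliChar, show (1 - p) * θ = θ + -(p * θ) by ring, phase_add]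
    ring
  rw [e]
  simp only [Complex.add_re, Complex.ofReal_re, Complex.mul_re, Complex.ofReal_im, phase_re,
      phase_im, Complex.add_im, Complex.mul_im, zero_mul, sub_zero, add_zero]
  set x := 2 * Real.pi * θ with hx
  have e1 : 2 * Real.pi * -(p * θ) = -(p * x) := by rw [hx]; ring
  have e2 : 2 * Real.pi * ((1 - p) * θ) = (1 - p) * x := by rw [hx]; ring
  rw [e1, e2, Real.cos_neg, Real.sin_neg]
  have hu0 : 0 ≤ u := (abs_nonneg x).trans hθ
  have hq0 : 0 ≤ 1 - p := by linarith
  have a1 : |p * x| ≤ u := by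
    rw [abs_mul, abs_of_nonneg hp0]
    nlinarith [abs_nonneg x]
  have a2 : |(1 - p) * x| ≤ u := by
    rw [abs_mul, abs_of_nonneg hq0]
    nlinarith [abs_nonneg x]
  have hcos : ∀ y : ℝ, |y| ≤ u → 1 / 2 ≤ Real.cos y := by
    intro y hy
    have h1 := Real.one_sub_sq_div_two_le_cos (x := y)
    have h2 : y ^ 2 ≤ 1 := by
      rw [← sq_abs]
      exact pow_le_one₀ (abs_nonneg _) (hy.trans hu)
    linarith
  have hsin : ∀ y : ℝ, |y| ≤ u → |Real.sin y - y| ≤ u ^ 3 := by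
    intro y hy
    exact (abs_sin_sub_le (hy.trans hu)).trans (pow_le_pow_left₀ (abs_nonneg _) hy 3)
  have c1 := hcos _ a1
  have c2 := hcos _ a2
  have s1 := abs_le.1 (hsin _ a1)
  have s2 := abs_le.1 (hsin _ a2)
  have hre : 1 / 2 ≤ (1 - p) * Real.cos (p * x) + p * Real.cos ((1 - p) * x) := by nlinarith
  refine ⟨by linarith, ?_⟩
  have him : |(1 - p) * -Real.sin (p * x) + p * Real.sin ((1 - p) * x)| ≤ u ^ 3 := by
    rw [abs_le]
    constructor <;> nlinarith
  have : 0 ≤ u ^ 3 := by positivity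
  refine him.trans ?_
  nlinarith

/-- Arguments add under multiplication, and `t i` bounds the tangent of the argument of `f i`. The
factor `2` absorbs the failure of tangents to add exactly, and the bound on the inductive tangent is
what keeps the real part nonnegative. -/
lemma prod_nearly_real {ι : Type*} (s : Finset ι) (f : ι → ℂ) (t : ι → ℝ)
    (ht0 : ∀ i ∈ s, 0 ≤ t i) (ht : ∑ i ∈ s, t i ≤ 1 / 4)
    (hf : ∀ i ∈ s, 0 ≤ (f i).re ∧ |(f i).im| ≤ t i * (f i).re) :
    0 ≤ (∏ i ∈ s, f i).re ∧
      |(∏ i ∈ s, f i).im| ≤ 2 * (∑ i ∈ s, t i) * (∏ i ∈ s, f i).re := by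
  classical
  induction s using Finset.induction_on with
  | empty => simp
  | insert a s ha ih =>
    rw [Finset.sum_insert ha] at ht
    have hta := ht0 a (Finset.mem_insert_self a s)
    have hs0 : 0 ≤ ∑ i ∈ s, t i :=
      Finset.sum_nonneg fun i hi ↦ ht0 i (Finset.mem_insert_of_mem hi)
    obtain ⟨h1, h2⟩ := ih (fun i hi ↦ ht0 i (Finset.mem_insert_of_mem hi)) (by linarith)
      (fun i hi ↦ hf i (Finset.mem_insert_of_mem hi))
    obtain ⟨h3, h4⟩ := hf a (Finset.mem_insert_self a s)
    rw [Finset.prod_insert ha, Finset.sum_insert ha, Complex.mul_re, Complex.mul_im]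
    set w := ∏ i ∈ s, f i
    set S := ∑ i ∈ s, t i
    have hrr : 0 ≤ (f a).re * w.re := mul_nonneg h3 h1
    have hii : |(f a).im * w.im| ≤ 2 * t a * S * ((f a).re * w.re) := by
      rw [abs_mul]
      calc _ ≤ (t a * (f a).re) * (2 * S * w.re) :=
            mul_le_mul h4 h2 (abs_nonneg _) (mul_nonneg hta h3)
        _ = _ := by ring
    have h5 := abs_le.1 hii
    have him : |(f a).re * w.im + (f a).im * w.re| ≤ (2 * S + t a) * ((f a).re * w.re) := by
      refine (abs_add_le _ _).trans ?_
      rw [abs_mul, abs_mul, abs_of_nonneg h3, abs_of_nonneg h1]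
      have := mul_le_mul_of_nonneg_left h2 h3
      have := mul_le_mul_of_nonneg_right h4 h1
      linarith
    have htS : t a * S ≤ 1 / 16 := by nlinarith [sq_nonneg (t a - S)]
    constructor
    · nlinarith
    · refine him.trans ?_
      have h6 : (1 - 2 * t a * S) * ((f a).re * w.re) ≤ (f a).re * w.re - (f a).im * w.im := by
        linarith
      have h7 : 2 * (t a + S) * ((1 - 2 * t a * S) * ((f a).re * w.re)) ≤
          2 * (t a + S) * ((f a).re * w.re - (f a).im * w.im) := by
        apply mul_le_mul_of_nonneg_left h6
        linarith
      refine le_trans ?_ h7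
      rw [← mul_assoc (2 * (t a + S))]
      apply mul_le_mul_of_nonneg_right _ hrr
      have h8 : 4 * S * (t a + S) ≤ 1 := by nlinarith
      nlinarith

lemma phase_pow (x : ℝ) (k : ℕ) : phase x ^ k = phase (k * x) := by
  induction k with
  | zero => simp [phase_zero]
  | succ k ih => rw [pow_succ, ih, ← phase_add]; congr 1; push_cast; ring

/-- Orthogonality over a complete residue system. -/
lemma sum_phase_Ico_eq_zero (a : ℤ) (Q : ℕ) {x : ℝ} (hQ : ∃ k : ℤ, Q * x = k)
    (hx : ¬ ∃ k : ℤ, x = k) : ∑ h ∈ Finset.Ico a (a + Q), phase (h * x) = 0 := by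
  have hne : phase x ≠ 1 := fun h ↦ hx (phase_eq_one_iff.1 h)
  have e : ∑ h ∈ Finset.Ico a (a + Q), phase (h * x) =
      ∑ k ∈ Finset.range Q, phase (a * x) * phase x ^ k := by
    symm
    refine Finset.sum_bij (fun k _ ↦ a + k) ?_ ?_ ?_ ?_
    · intro k hk
      have := Finset.mem_range.1 hk
      rw [Finset.mem_Ico]
      omega
    · intro k _ l _ h
      simpa using h
    · intro h hh
      have := Finset.mem_Ico.1 hh
      exact ⟨(h - a).toNat, Finset.mem_range.2 (by omega), by omega⟩
    · intro k _
      rw [phase_pow, ← phase_add]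
      congr 1
      push_cast
      ring
  rw [e, ← Finset.mul_sum]
  have hpow : phase x ^ Q = 1 := by
    obtain ⟨k, hk⟩ := hQ
    rw [phase_pow, hk, phase_int]
  have := mul_geom_sum (phase x) Q
  rw [hpow, sub_self] at this
  rw [(mul_eq_zero.1 this).resolve_left (sub_ne_zero.2 hne), mul_zero]

/-- Expansion of the product of characteristic functions. -/
lemma prod_bernoulliChar_eq (A : Finset ℕ) (p : ℝ) (h : ℤ) :
    ∏ n ∈ A, bernoulliChar p (h / n) = ∑ S ∈ A.powerset,
      ((p ^ S.card * (1 - p) ^ (A \ S).card : ℝ) : ℂ) * phase (h * ∑ n ∈ S, (1 : ℝ) / n) := by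
  unfold bernoulliChar
  rw [Finset.prod_congr rfl fun n _ ↦ add_comm _ _, Finset.prod_add]
  refine Finset.sum_congr rfl fun S _ ↦ ?_
  rw [Finset.prod_mul_distrib, Finset.prod_const, Finset.prod_const, Finset.mul_sum, phase_sum]
  push_cast
  have : ∀ n ∈ S, phase (h * (1 / (n : ℝ))) = phase (h / n) := fun n _ ↦ by rw [mul_one_div]
  rw [Finset.prod_congr rfl this]
  ring

/-- If no subset of `A` has reciprocal sum `1`, then only the empty subset contributes to the
count of subsets with integral reciprocal sum. -/
lemma sum_prod_bernoulliChar_eq (A : Finset ℕ) (p : ℝ) (a : ℤ) (hA0 : ∀ n ∈ A, 0 < n)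
    (hA2 : ∑ n ∈ A, (1 : ℝ) / n < 2)
    (hno : ¬ ∃ S ⊆ A, ∑ n ∈ S, (1 : ℝ) / n = 1) :
    ∑ h ∈ Finset.Ico a (a + (A.lcm id : ℕ)), ∏ n ∈ A, bernoulliChar p (h / n) =
      (((A.lcm id : ℕ) * (1 - p) ^ A.card : ℝ) : ℂ) := by
  simp only [prod_bernoulliChar_eq]
  rw [Finset.sum_comm]
  simp only [← Finset.mul_sum]
  rw [Finset.sum_eq_single ∅]
  · simp [phase_zero, mul_comm]
  · intro S hS hSne
    have hSA := Finset.mem_powerset.1 hS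
    -- `Q` times the reciprocal sum of `S` is an integer, while the sum itself is not: it lies
    -- strictly between `0` and `2` and differs from `1`.
    rw [sum_phase_Ico_eq_zero, mul_zero]
    · refine ⟨∑ n ∈ S, ((A.lcm id / n : ℕ) : ℤ), ?_⟩
      rw [Finset.mul_sum, Int.cast_sum]
      refine Finset.sum_congr rfl fun n hn ↦ ?_
      have hd : n ∣ A.lcm id := Finset.dvd_lcm (f := id) (hSA hn)
      have hn0 := hA0 n (hSA hn)
      rw [Int.cast_natCast, Nat.cast_div hd (by positivity)]
      ring
    · rintro ⟨k, hk⟩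
      have h1 : 0 < ∑ n ∈ S, (1 : ℝ) / n := by
        apply Finset.sum_pos
        · intro n hn
          have := hA0 n (hSA hn)
          positivity
        · exact Finset.nonempty_iff_ne_empty.2 hSne
      have h2 : ∑ n ∈ S, (1 : ℝ) / n < 2 :=
        (Finset.sum_le_sum_of_subset_of_nonneg hSA fun _ _ _ ↦ by positivity).trans_lt hA2
      rw [hk] at h1 h2
      have h3 : 0 < k := by exact_mod_cast h1
      have h4 : k < 2 := by exact_mod_cast h2
      have h5 : k = 1 := by omega
      exact hno ⟨S, hSA, by rw [hk, h5]; simp⟩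
  · intro h
    exact absurd (Finset.mem_powerset.2 (Finset.empty_subset A)) h

/-! ### Counting lemmas for the circle method. -/

lemma card_primeFactors_le_two_mul_log {n : ℕ} (hn : n ≠ 0) :
    (n.primeFactors.card : ℝ) ≤ 2 * Real.log n := by
  have h1 : 2 ^ n.primeFactors.card ≤ n :=
    (Finset.pow_card_le_prod n.primeFactors _ _ fun p hp ↦
      (Nat.prime_of_mem_primeFactors hp).two_le).trans
      (Nat.le_of_dvd (Nat.pos_of_ne_zero hn) (Nat.prod_primeFactors_dvd n))
  have h2 : ((2 : ℝ) ^ n.primeFactors.card) ≤ n := by exact_mod_cast h1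
  have h3 := Real.log_le_log (by positivity) h2
  rw [Real.log_pow] at h3
  have h4 := Real.log_two_gt_d9
  have h5 : (0 : ℝ) ≤ n.primeFactors.card := Nat.cast_nonneg _
  nlinarith

lemma norm_prod_bernoulliChar_le {A B : Finset ℕ} {p t : ℝ} {h : ℤ} (hBA : B ⊆ A)
    (hp0 : 0 ≤ p) (hp1 : p ≤ 1) (ht : 0 ≤ t)
    (hB : ∀ n ∈ B, ∀ k : ℤ, t ≤ |(h : ℝ) / n - k|) :
    ‖∏ n ∈ A, bernoulliChar p (h / n)‖ ≤ Real.exp (-(8 * p * (1 - p) * t ^ 2 * B.card)) := by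
  rw [norm_prod, ← Finset.prod_sdiff hBA]
  have h1 : ∏ n ∈ A \ B, ‖bernoulliChar p (h / n)‖ ≤ 1 :=
    Finset.prod_le_one (fun _ _ ↦ norm_nonneg _)
      fun n _ ↦ norm_bernoulliChar_le_one _ hp0 hp1
  have h2 : ∏ n ∈ B, ‖bernoulliChar p (h / n)‖ ≤
      ∏ n ∈ B, Real.exp (-(8 * p * (1 - p) * t ^ 2)) :=
    Finset.prod_le_prod (fun _ _ ↦ norm_nonneg _)
      fun n hn ↦ norm_bernoulliChar_le hp0 hp1 ht (hB n hn)
  rw [Finset.prod_const, ← Real.exp_nat_mul] at h2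
  calc _ ≤ 1 * Real.exp (B.card * -(8 * p * (1 - p) * t ^ 2)) :=
        mul_le_mul h1 h2 (Finset.prod_nonneg fun _ _ ↦ norm_nonneg _) zero_le_one
    _ = _ := by rw [one_mul]; congr 1; ring

/-- The bridge from divisibility to phases: every multiple `n k` is farther than `K` from `h`, and
dividing by `n ≤ N` separates `h / n` from `k`. -/
lemma le_abs_div_sub_of_not_dvd_near {n N : ℕ} {h : ℤ} {K : ℝ} (hn : 0 < n) (hnN : n ≤ N)
    (hK : 0 ≤ K) (hbad : ¬ ∃ y : ℤ, |(y : ℝ) - h| ≤ K ∧ (n : ℤ) ∣ y) (k : ℤ) :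
    K / N ≤ |(h : ℝ) / n - k| := by
  have hn' : (0 : ℝ) < n := by exact_mod_cast hn
  have hnN' : (n : ℝ) ≤ N := by exact_mod_cast hnN
  have h1 : K < |((n * k : ℤ) : ℝ) - h| := by
    by_contra hcon
    exact hbad ⟨n * k, not_lt.1 hcon, Dvd.intro k rfl⟩
  calc K / N ≤ K / n := div_le_div_of_nonneg_left hK hn' hnN'
    _ ≤ |((n * k : ℤ) : ℝ) - h| / n := by gcongr
    _ = |(h : ℝ) / n - k| := by
      rw [abs_sub_comm, ← abs_of_pos hn', ← abs_div, abs_of_pos hn']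
      congr 1
      push_cast
      field_simp

/-- Double counting: an element of `B` has at most `2 log N` prime factors, so the contributions of
distinct primes overlap only a little. -/
lemma card_mul_le_of_prime_powers {B E : Finset ℕ} {N : ℕ} {V : ℝ} {v : ℕ → ℕ}
    (hB : B ⊆ Finset.Icc 1 N) (hE : ∀ r ∈ E, r.Prime ∧ v r ≠ 0)
    (hV : ∀ r ∈ E, V ≤ ((B.filter (fun n ↦ r ^ v r ∣ n)).card : ℝ)) :
    E.card * V ≤ 2 * Real.log N * B.card := by
  have h1 : ∑ r ∈ E, (B.filter (fun n ↦ r ^ v r ∣ n)).card =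
      ∑ n ∈ B, (E.filter (fun r ↦ r ^ v r ∣ n)).card :=
    Finset.sum_card_bipartiteAbove_eq_sum_card_bipartiteBelow _
  have h2 : ∀ n ∈ B, ((E.filter (fun r ↦ r ^ v r ∣ n)).card : ℝ) ≤ 2 * Real.log N := by
    intro n hn
    have hn' := Finset.mem_Icc.1 (hB hn)
    have hn0 : n ≠ 0 := by omega
    have h3 : E.filter (fun r ↦ r ^ v r ∣ n) ⊆ n.primeFactors := by
      intro r hr
      have hr' := Finset.mem_filter.1 hr
      have hr2 := hE r hr'.1
      exact Nat.mem_primeFactors.2 ⟨hr2.1, (dvd_pow_self r hr2.2).trans hr'.2, hn0⟩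
    have h4 : ((E.filter (fun r ↦ r ^ v r ∣ n)).card : ℝ) ≤ n.primeFactors.card := by
      exact_mod_cast Finset.card_le_card h3
    refine h4.trans ((card_primeFactors_le_two_mul_log hn0).trans ?_)
    gcongr
    exact hn'.2
  calc E.card * V = ∑ r ∈ E, V := by rw [Finset.sum_const, nsmul_eq_mul]
    _ ≤ ∑ r ∈ E, ((B.filter (fun n ↦ r ^ v r ∣ n)).card : ℝ) := Finset.sum_le_sum hV
    _ = ∑ n ∈ B, ((E.filter (fun r ↦ r ^ v r ∣ n)).card : ℝ) := by exact_mod_cast h1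
    _ ≤ ∑ n ∈ B, 2 * Real.log N := Finset.sum_le_sum h2
    _ = _ := by rw [Finset.sum_const, nsmul_eq_mul, mul_comm]

open Classical in
/-- The number of integers in an interval that are near a multiple of `d`. -/
lemma card_near_multiples_le {J : Finset ℤ} {d m : ℕ} {K : ℝ} (hd : 0 < d) (hm : 1 ≤ m)
    (hK : 1 ≤ K)
    (hJ : ∀ h ∈ J, ∃ x : ℤ, |(x : ℝ) - h| ≤ K ∧ (d : ℤ) ∣ x ∧ |x| ≤ d * m) :
    (J.card : ℝ) ≤ 9 * K * m := by
  set k := ⌊K⌋₊ with hk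
  have hsub : J ⊆ (Finset.Icc (-(m : ℤ)) m ×ˢ Finset.Icc (-(k : ℤ)) k).image
      (fun x ↦ d * x.1 + x.2) := by
    intro h hh
    obtain ⟨x, hx, ⟨l, rfl⟩, hxm⟩ := hJ h hh
    refine Finset.mem_image.2 ⟨(l, h - d * l), ?_, by ring⟩
    rw [Finset.mem_product, Finset.mem_Icc, Finset.mem_Icc, ← abs_le, ← abs_le]
    constructor
    · rw [abs_mul, Nat.abs_cast] at hxm
      exact le_of_mul_le_mul_left hxm (by exact_mod_cast hd)
    · have h1 : ((h - d * l).natAbs : ℝ) ≤ K := by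
        rw [Nat.cast_natAbs, Int.cast_abs]
        rw [abs_sub_comm] at hx
        exact_mod_cast hx
      have h2 : (h - d * l).natAbs ≤ k := Nat.le_floor h1
      change |h - d * l| ≤ k
      rw [Int.abs_eq_natAbs]
      exact_mod_cast h2
  have h1 : J.card ≤ (2 * m + 1) * (2 * k + 1) := by
    refine (Finset.card_le_card hsub).trans (Finset.card_image_le.trans ?_)
    rw [Finset.card_product, Int.card_Icc, Int.card_Icc]
    apply Nat.mul_le_mul <;> omega
  have h2 : (J.card : ℝ) ≤ (2 * m + 1) * (2 * k + 1) := by exact_mod_cast h1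
  have h3 : (k : ℝ) ≤ K := Nat.floor_le (by linarith)
  have h4 : (1 : ℝ) ≤ m := by exact_mod_cast hm
  calc (J.card : ℝ) ≤ (2 * m + 1) * (2 * k + 1) := h2
    _ ≤ (3 * m) * (3 * K) := by gcongr <;> linarith
    _ = _ := by ring

/-- Otherwise every element would already divide the lcm divided by `r`. Information about prime
powers dividing elements of `A` thereby reaches those of the lcm. -/
lemma exists_prime_pow_factorization_dvd {A : Finset ℕ} (hA : ∀ n ∈ A, n ≠ 0) {r : ℕ}
    (hr : r ∈ (A.lcm id).primeFactors) :
    ∃ n ∈ A, r ^ (A.lcm id).factorization r ∣ n := by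
  classical
  have hrp := Nat.prime_of_mem_primeFactors hr
  have hpos : (A.lcm id).factorization r ≠ 0 := by
    rw [← Nat.support_factorization, Finsupp.mem_support_iff] at hr
    exact hr
  by_contra hcon
  push Not at hcon
  have hne : A.lcm id ≠ 0 := by
    rw [Ne, Finset.lcm_eq_zero_iff]
    rintro ⟨n, hn, h0⟩
    exact hA n hn h0
  set Q := A.lcm id with hQ
  have hd : Q ∣ Q / r := by
    apply Finset.lcm_dvd
    intro n hn
    have hnQ : n ∣ Q := Finset.dvd_lcm (f := id) hn
    obtain ⟨m, hm⟩ := hnQ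
    have hm0 : m ≠ 0 := by rintro rfl; exact hne (by rw [hm, mul_zero])
    have hn0 := hA n hn
    have hlt : n.factorization r < Q.factorization r := by
      by_contra h
      exact hcon n hn ((hrp.pow_dvd_iff_le_factorization hn0).2 (not_lt.1 h))
    have hfac : Q.factorization r = n.factorization r + m.factorization r := by
      conv_lhs => rw [hm]
      rw [Nat.factorization_mul hn0 hm0]
      rfl
    have hrm : r ∣ m := by
      by_contra h
      rw [Nat.factorization_eq_zero_of_not_dvd h] at hfac
      omega
    obtain ⟨l, rfl⟩ := hrm
    refine ⟨l, ?_⟩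
    rw [hm, id, show n * (r * l) = r * (n * l) by ring, Nat.mul_div_cancel_left _ hrp.pos]
  have h1 := Nat.le_of_dvd (Nat.div_pos (Nat.le_of_dvd (Nat.pos_of_ne_zero hne)
    (Nat.dvd_of_mem_primeFactors hr)) hrp.pos) hd
  exact absurd h1 (not_le.2 (Nat.div_lt_self (Nat.pos_of_ne_zero hne) hrp.one_lt))

lemma prod_factorization_dvd {Q : ℕ} {x : ℤ} (D : Finset ℕ) (hD : D ⊆ Q.primeFactors)
    (h : ∀ r ∈ D, ((r ^ Q.factorization r : ℕ) : ℤ) ∣ x) :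
    ((∏ r ∈ D, r ^ Q.factorization r : ℕ) : ℤ) ∣ x := by
  push_cast
  apply Finset.prod_dvd_of_coprime
  · intro a ha b hb hab
    have hap := Nat.prime_of_mem_primeFactors (hD ha)
    have hbp := Nat.prime_of_mem_primeFactors (hD hb)
    have : Nat.Coprime (a ^ Q.factorization a) (b ^ Q.factorization b) :=
      Nat.Coprime.pow _ _ ((Nat.coprime_primes hap hbp).2 hab)
    have := Nat.isCoprime_iff_coprime.2 this
    simpa [Function.onFun] using this
  · intro r hr
    simpa using h r hr

/-- The sum is `(1 + t)^|P| - 1 ≤ exp (t |P|) - 1`. It serves to sum over all nonempty exceptional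
sets of primes. -/
lemma sum_powerset_pow_card_erase_empty_le {P : Finset ℕ} {t : ℝ} (ht : 0 ≤ t)
    (htP : t * P.card ≤ 1) :
    ∑ E ∈ P.powerset.erase ∅, t ^ E.card ≤ 2 * (t * P.card) := by
  have h1 : ∑ E ∈ P.powerset, t ^ E.card = (t + 1) ^ P.card := by
    rw [← Finset.sum_pow_mul_eq_add_pow]
    simp
  rw [← Finset.add_sum_erase _ _ (Finset.empty_mem_powerset P), Finset.card_empty, pow_zero] at h1
  have h2 : (t + 1) ^ P.card ≤ Real.exp (t * P.card) := by
    rw [mul_comm, Real.exp_nat_mul]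
    exact pow_le_pow_left₀ (by linarith) (Real.add_one_le_exp t) _
  have h3 : |t * P.card| ≤ 1 := by rwa [abs_of_nonneg (by positivity)]
  have h4 := (abs_le.1 (Real.abs_exp_sub_one_le h3)).2
  rw [abs_of_nonneg (by positivity)] at h4
  linarith

/-! ### The circle method. -/

open Classical in
/-- The circle method: if every frequency is close to an integer that is divisible by all prime
powers at which few elements of `A` are far from dividing, then `A` has a subset of reciprocal
sum `1`. -/
theorem exists_subset_sum_inv_eq_one {N : ℕ} {A : Finset ℕ} {p K H V L : ℝ}
    (hAN : A ⊆ Finset.Icc 1 N) (hAL : ∀ n ∈ A, L ≤ n) (hp0 : 0 < p) (hp1 : p < 1)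
    (hpR : p * ∑ n ∈ A, (1 : ℝ) / n = 1) (hR2 : ∑ n ∈ A, (1 : ℝ) / n < 2)
    (hK : 1 ≤ K) (hKL : 2 * K < L) (hH : 0 ≤ H)
    (hnear : ∀ h : ℤ, ∃ x : ℤ, |(x : ℝ) - h| ≤ K ∧ ∀ r ∈ (A.lcm id).primeFactors,
      ((r ^ (A.lcm id).factorization r : ℕ) : ℤ) ∣ x ∨
      V ≤ ((A.filter (fun n ↦ r ^ (A.lcm id).factorization r ∣ n ∧
        ¬ ∃ y : ℤ, |(y : ℝ) - h| ≤ K ∧ (n : ℤ) ∣ y)).card : ℝ))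
    (hminor : 144 * (N : ℝ) ^ 3 * Real.exp (-(8 * p * (1 - p) * (K / N) ^ 2 *
      (V / (2 * Real.log N)))) ≤ 1)
    (hmid : 24 * N * Real.exp (-(8 * p * (1 - p) * (H / N) ^ 2 * A.card)) ≤ 1)
    (hmajor : 2 * Real.pi * H / L ≤ 1)
    (hmajor' : 8 * (A.card * (2 * Real.pi * H / L) ^ 3) ≤ 1)
    (htriv : (A.lcm id : ℕ) * (1 - p) ^ A.card ≤ 1 / 2) :
    ∃ S ⊆ A, ∑ n ∈ S, (1 : ℝ) / n = 1 := by
  by_contra hno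
  have hA0 : ∀ n ∈ A, 0 < n := fun n hn ↦ (Finset.mem_Icc.1 (hAN hn)).1
  have hAle : ∀ n ∈ A, n ≤ N := fun n hn ↦ (Finset.mem_Icc.1 (hAN hn)).2
  have hL0 : 0 < L := by linarith
  have hAne : A.Nonempty := by
    rw [Finset.nonempty_iff_ne_empty]
    rintro rfl
    simp at hpR
  obtain ⟨n₀, hn₀⟩ := hAne
  have hLN : L ≤ N := (hAL n₀ hn₀).trans (by exact_mod_cast hAle n₀ hn₀)
  have hN0 : (0 : ℝ) < N := hL0.trans_le hLN
  have hKN : K ≤ N := by linarith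
  set Q := A.lcm id with hQ
  have hQ0 : Q ≠ 0 := by
    rw [hQ, Ne, Finset.lcm_eq_zero_iff]
    rintro ⟨n, hn, h0⟩
    exact (hA0 n hn).ne' h0
  have hLQ : L ≤ Q := (hAL n₀ hn₀).trans (by
    exact_mod_cast Nat.le_of_dvd (Nat.pos_of_ne_zero hQ0) (Finset.dvd_lcm (f := id) hn₀))
  set P := Q.primeFactors with hP
  set v := Q.factorization with hv
  have hPq : ∀ r ∈ P, r.Prime ∧ v r ≠ 0 ∧ r ^ v r ≤ N := fun r hr ↦ by
    refine ⟨Nat.prime_of_mem_primeFactors hr, ?_, ?_⟩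
    · rw [hP, ← Nat.support_factorization, Finsupp.mem_support_iff] at hr
      exact hr
    · obtain ⟨n, hn, hd⟩ := exists_prime_pow_factorization_dvd (fun n hn ↦ (hA0 n hn).ne') hr
      exact (Nat.le_of_dvd (hA0 n hn) hd).trans (hAle n hn)
  have hPcard : (P.card : ℝ) ≤ N := by
    have h1 : P ⊆ Finset.Icc 1 N := fun r hr ↦ by
      obtain ⟨h1, h2, h3⟩ := hPq r hr
      exact Finset.mem_Icc.2 ⟨h1.pos, (Nat.le_self_pow h2 r).trans h3⟩
    have := Finset.card_le_card h1
    rw [Nat.card_Icc, Nat.add_sub_cancel] at this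
    exact_mod_cast this
  choose x hxK hxdvd using hnear
  set F : ℤ → ℂ := fun h ↦ ∏ n ∈ A, bernoulliChar p (h / n) with hF
  set E : ℤ → Finset ℕ := fun h ↦ P.filter (fun r ↦ ¬ ((r ^ v r : ℕ) : ℤ) ∣ x h) with hE
  set b := Real.exp (-(8 * p * (1 - p) * (K / N) ^ 2 * (V / (2 * Real.log N)))) with hb
  -- A complete residue system modulo `Q`, centred so that `|h| ≤ Q / 2`.
  set J := Finset.Ico (-((Q / 2 : ℕ) : ℤ)) (-((Q / 2 : ℕ) : ℤ) + (Q : ℕ)) with hJ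
  have hJabs : ∀ h ∈ J, 2 * |h| ≤ Q := by
    intro h hh
    have h1 := Finset.mem_Ico.1 hh
    rcases abs_cases h with h2 | h2 <;> omega
  have hJabs' : ∀ h ∈ J, 2 * |(h : ℝ)| ≤ Q := fun h hh ↦ by exact_mod_cast hJabs h hh
  have hpp : 0 < p * (1 - p) := mul_pos hp0 (by linarith)
  have hlogN : 0 < Real.log N := Real.log_pos (by linarith)
  -- the bound at a frequency in terms of the exceptional prime powers
  have hFE : ∀ h, ‖F h‖ ≤ b ^ (E h).card := by
    intro h
    set B := A.filter (fun n : ℕ ↦ ¬ ∃ y : ℤ, |(y : ℝ) - h| ≤ K ∧ (n : ℤ) ∣ y) with hB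
    have h1 := norm_prod_bernoulliChar_le (h := h) (t := K / N) (Finset.filter_subset _ A : B ⊆ A)
      hp0.le hp1.le (by positivity) (fun n hn ↦ by
        have hn' := Finset.mem_filter.1 hn
        exact le_abs_div_sub_of_not_dvd_near (hA0 n hn'.1) (hAle n hn'.1) (by linarith) hn'.2)
    have h2 : (E h).card * V ≤ 2 * Real.log N * B.card := by
      apply card_mul_le_of_prime_powers (v := v) ((Finset.filter_subset _ _).trans hAN)
      · intro r hr
        have hr' := hPq r (Finset.mem_filter.1 hr).1
        exact ⟨hr'.1, hr'.2.1⟩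
      · intro r hr
        have hr' := Finset.mem_filter.1 hr
        refine ((hxdvd h r hr'.1).resolve_left hr'.2).trans ?_
        apply Nat.cast_le.2
        apply Finset.card_le_card
        intro n hn
        simp only [Finset.mem_filter] at hn ⊢
        tauto
    refine h1.trans ?_
    rw [hb, ← Real.exp_nat_mul]
    apply Real.exp_le_exp.2
    have h3 : (E h).card * (V / (2 * Real.log N)) ≤ B.card := by
      rw [← mul_div_assoc, div_le_iff₀ (by positivity)]
      linarith
    have h4 : 0 ≤ 8 * p * (1 - p) * (K / N) ^ 2 := by
      have : 8 * p * (1 - p) = 8 * (p * (1 - p)) := by ring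
      rw [this]
      positivity
    have := mul_le_mul_of_nonneg_left h3 h4
    linarith
  -- frequencies without exceptional prime powers are small
  have hEempty : ∀ h ∈ J, E h = ∅ → |(h : ℝ)| ≤ K := by
    intro h hh hE0
    have hd : (Q : ℤ) ∣ x h := by
      have h1 := prod_factorization_dvd (x := x h) P subset_rfl (fun r hr ↦ by
        by_contra hnd
        have : r ∈ E h := Finset.mem_filter.2 ⟨hr, hnd⟩
        rw [hE0] at this
        simp at this)
      have h2 : ∏ r ∈ P, r ^ v r = Q := Nat.prod_factorization_pow_eq_self hQ0
      rwa [h2] at h1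
    -- A multiple of `Q` of size at most `K + Q / 2 < Q`, since `2 K < L ≤ Q`.
    have hx0 : x h = 0 := by
      by_contra hne
      have h1 := Int.le_of_dvd (abs_pos.2 hne) ((dvd_abs _ _).2 hd)
      have h2 : (Q : ℝ) ≤ |(x h : ℝ)| := by exact_mod_cast h1
      have h3 := hJabs' h hh
      have h4 := abs_sub_abs_le_abs_sub (x h : ℝ) h
      have h5 := hxK h
      linarith
    have := hxK h
    rw [hx0, Int.cast_zero, zero_sub, abs_neg] at this
    exact this
  -- minor arcs
  have hminorsum : ∑ h ∈ J with E h ≠ ∅, ‖F h‖ ≤ 1 / 8 := by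
    have h1 : ∑ h ∈ J with E h ≠ ∅, ‖F h‖ ≤
        ∑ e ∈ P.powerset.erase ∅, 9 * N * (N * b) ^ e.card := by
      rw [← Finset.sum_fiberwise_of_maps_to (g := E) (t := P.powerset.erase ∅)]
      · refine Finset.sum_le_sum fun e he ↦ ?_
        obtain ⟨he0, heP⟩ := Finset.mem_erase.1 he
        rw [Finset.mem_powerset] at heP
        have h2 : ∑ h ∈ (J.filter (fun h ↦ E h ≠ ∅)).filter (fun h ↦ E h = e), ‖F h‖ ≤
            ∑ h ∈ (J.filter (fun h ↦ E h ≠ ∅)).filter (fun h ↦ E h = e), b ^ e.card :=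
          Finset.sum_le_sum fun h hh ↦ by
            have := hFE h
            rwa [(Finset.mem_filter.1 hh).2] at this
        rw [Finset.sum_const, nsmul_eq_mul] at h2
        refine h2.trans ?_
        -- If the exceptional set is `e`, then `x h` is a multiple of `d = Q / m` of size at most
        -- `Q`, leaving `O(K m)` frequencies with `m ≤ N ^ |e|`. Each exceptional prime thus costs a
        -- factor `N` and saves a factor `b`.
        set d := ∏ r ∈ P \ e, r ^ v r with hd
        set m := ∏ r ∈ e, r ^ v r with hm
        have hdm : d * m = Q := by
          rw [hd, hm, Finset.prod_sdiff heP]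
          exact Nat.prod_factorization_pow_eq_self hQ0
        have hd0 : 0 < d := Nat.pos_of_ne_zero fun h ↦ hQ0 (by rw [← hdm, h, zero_mul])
        have hm0 : 0 < m := Nat.pos_of_ne_zero fun h ↦ hQ0 (by rw [← hdm, h, mul_zero])
        have h3 : (((J.filter (fun h ↦ E h ≠ ∅)).filter (fun h ↦ E h = e)).card : ℝ) ≤
            9 * K * m := by
          apply card_near_multiples_le hd0 hm0 hK
          intro h hh
          have hh' := Finset.mem_filter.1 hh
          have hhJ := (Finset.mem_filter.1 hh'.1).1
          refine ⟨x h, hxK h, ?_, ?_⟩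
          · apply prod_factorization_dvd _ Finset.sdiff_subset
            intro r hr
            obtain ⟨hrP, hre⟩ := Finset.mem_sdiff.1 hr
            by_contra hnd
            apply hre
            rw [← hh'.2]
            exact Finset.mem_filter.2 ⟨hrP, hnd⟩
          · have h4 := abs_sub_abs_le_abs_sub (x h : ℝ) h
            have h5 := hxK h
            have h6 := hJabs' h hhJ
            have h7 : |(x h : ℝ)| ≤ Q := by linarith
            rw [← hdm] at h7
            exact_mod_cast h7
        have h4 : (m : ℝ) ≤ (N : ℝ) ^ e.card := by
          have := Finset.prod_le_pow_card e (fun r ↦ r ^ v r) N fun r hr ↦ (hPq r (heP hr)).2.2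
          exact_mod_cast this
        have hb0 : 0 < b := Real.exp_pos _
        calc _ ≤ 9 * K * m * b ^ e.card := by gcongr
          _ ≤ 9 * N * (N : ℝ) ^ e.card * b ^ e.card := by gcongr
          _ = _ := by rw [mul_pow]; ring
      · intro h hh
        exact Finset.mem_erase.2 ⟨(Finset.mem_filter.1 hh).2,
          Finset.mem_powerset.2 (Finset.filter_subset _ _)⟩
    refine h1.trans ?_
    rw [← Finset.mul_sum]
    have hb0 : 0 < b := Real.exp_pos _
    have h144 : 144 * (N : ℝ) ^ 3 * b ≤ 1 := hminor
    have hN1 : 1 ≤ (N : ℝ) := by linarith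
    have h2 : N * b * P.card ≤ N ^ 2 * b := by
      calc N * b * P.card ≤ N * b * N := by gcongr
        _ = _ := by ring
    have h3 : (N : ℝ) ^ 2 * b ≤ N ^ 3 * b := by
      gcongr
      norm_num
    have h5 := sum_powerset_pow_card_erase_empty_le (P := P) (t := N * b) (by positivity)
      (by linarith)
    calc 9 * N * ∑ e ∈ P.powerset.erase ∅, (N * b) ^ e.card
        ≤ 9 * N * (2 * (N ^ 2 * b)) := by gcongr; linarith
      _ = 18 * (N ^ 3 * b) := by ring
      _ ≤ 1 / 8 := by linarith
  -- intermediate frequencies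
  have hmidsum : ∑ h ∈ J with E h = ∅ ∧ H < |(h : ℝ)|, ‖F h‖ ≤ 1 / 8 := by
    have h1 : ∀ h ∈ J.filter (fun h ↦ E h = ∅ ∧ H < |(h : ℝ)|),
        ‖F h‖ ≤ Real.exp (-(8 * p * (1 - p) * (H / N) ^ 2 * A.card)) := by
      intro h hh
      obtain ⟨hhJ, hE0, hHh⟩ := Finset.mem_filter.1 hh
      have hhK := hEempty h hhJ hE0
      apply norm_prod_bernoulliChar_le subset_rfl hp0.le hp1.le (by positivity)
      intro n hn k
      have hn0 : (0 : ℝ) < n := by exact_mod_cast hA0 n hn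
      have hnN : (n : ℝ) ≤ N := by exact_mod_cast hAle n hn
      have hnL := hAL n hn
      have hge : H / N ≤ |(h : ℝ) / n| := by
        rw [abs_div, abs_of_pos hn0]
        exact (div_le_div_of_nonneg_left hH hn0 hnN).trans (by gcongr)
      have hle : |(h : ℝ) / n| ≤ 1 / 2 := by
        rw [abs_div, abs_of_pos hn0, div_le_iff₀ hn0]
        linarith
      -- As `|h| ≤ K < L / 2`, one has `|h / n| ≤ 1 / 2`, so no nonzero integer is closer to `h / n`
      -- than `0` is.
      by_cases hk : k = 0
      · rw [hk, Int.cast_zero, sub_zero]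
        exact hge
      · have h2 : (1 : ℝ) ≤ |(k : ℝ)| := by exact_mod_cast Int.one_le_abs hk
        have h3 := abs_sub_abs_le_abs_sub (k : ℝ) (h / n)
        rw [abs_sub_comm] at h3
        linarith
    have h2 : ((J.filter (fun h ↦ E h = ∅ ∧ H < |(h : ℝ)|)).card : ℝ) ≤ 3 * K := by
      have h3 : J.filter (fun h ↦ E h = ∅ ∧ H < |(h : ℝ)|) ⊆
          Finset.Icc (-(⌊K⌋₊ : ℤ)) ⌊K⌋₊ := by
        intro h hh
        obtain ⟨hhJ, hE0, _⟩ := Finset.mem_filter.1 hh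
        rw [Finset.mem_Icc, ← abs_le, Int.abs_eq_natAbs]
        have h4 : (h.natAbs : ℝ) ≤ K := by
          rw [Nat.cast_natAbs, Int.cast_abs]
          exact hEempty h hhJ hE0
        exact_mod_cast Nat.le_floor h4
      have h4 := Finset.card_le_card h3
      rw [Int.card_Icc] at h4
      have h5 : (J.filter (fun h ↦ E h = ∅ ∧ H < |(h : ℝ)|)).card ≤ 2 * ⌊K⌋₊ + 1 := by omega
      have h6 : ((J.filter (fun h ↦ E h = ∅ ∧ H < |(h : ℝ)|)).card : ℝ) ≤ 2 * ⌊K⌋₊ + 1 := by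
        exact_mod_cast h5
      have h7 := Nat.floor_le (show 0 ≤ K by linarith)
      linarith
    refine (Finset.sum_le_sum h1).trans ?_
    rw [Finset.sum_const, nsmul_eq_mul]
    set w := Real.exp (-(8 * p * (1 - p) * (H / N) ^ 2 * A.card)) with hw
    have hw0 : 0 < w := Real.exp_pos _
    calc _ ≤ 3 * N * w := by
          apply mul_le_mul_of_nonneg_right _ hw0.le
          linarith
      _ ≤ 1 / 8 := by linarith
  -- the main frequencies
  have hmain : ∀ h : ℤ, |(h : ℝ)| ≤ H → 0 ≤ (F h).re := by
    intro h hh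
    -- Centring every factor multiplies the product by `e(-h) = 1`, because `p` times the reciprocal
    -- sum is `1`.
    have e : F h = ∏ n ∈ A, (bernoulliChar p (h / n) * phase (-(p * (h / n)))) := by
      rw [Finset.prod_mul_distrib, ← phase_sum]
      have h1 : ∑ n ∈ A, -(p * ((h : ℝ) / n)) = ((-h : ℤ) : ℝ) := by
        have h2 : ∑ n ∈ A, -(p * ((h : ℝ) / n)) = -(h * (p * ∑ n ∈ A, (1 : ℝ) / n)) := by
          rw [Finset.mul_sum, Finset.mul_sum, ← Finset.sum_neg_distrib]
          exact Finset.sum_congr rfl fun n _ ↦ by ring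
        rw [h2, hpR]
        push_cast
        ring
      rw [h1, phase_int, mul_one]
    rw [e]
    have hu0 : 0 ≤ 2 * Real.pi * H / L := by positivity
    refine (prod_nearly_real A _ (fun _ ↦ 2 * (2 * Real.pi * H / L) ^ 3) (fun _ _ ↦ by positivity)
      ?_ ?_).1
    · rw [Finset.sum_const, nsmul_eq_mul]
      linarith
    · intro n hn
      apply centred_bernoulliChar_bounds hp0.le hp1.le _ hmajor
      have hn0 : (0 : ℝ) < n := by exact_mod_cast hA0 n hn
      rw [abs_mul, abs_of_pos Real.two_pi_pos, abs_div, abs_of_pos hn0, ← mul_div_assoc]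
      have := hAL n hn
      gcongr
  -- conclusion
  have htotal := sum_prod_bernoulliChar_eq A p (-((Q / 2 : ℕ) : ℤ)) hA0 hR2 hno
  have hre := congrArg Complex.re htotal
  rw [Complex.ofReal_re] at hre
  have hre' : ∑ h ∈ J, (F h).re ≤ 1 / 2 := by
    rw [← Complex.re_sum]
    exact hre.le.trans htriv
  have h0J : (0 : ℤ) ∈ J := by
    rw [hJ, Finset.mem_Ico]
    omega
  have hF0 : (F 0).re = 1 := by
    simp [hF, bernoulliChar, phase_zero]
  have hsplit : ∀ h ∈ J, (if h = 0 then 1 else 0) - (if E h ≠ ∅ then ‖F h‖ else 0) -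
      (if E h = ∅ ∧ H < |(h : ℝ)| then ‖F h‖ else 0) ≤ (F h).re := by
    intro h _
    have h1 : -‖F h‖ ≤ (F h).re := (abs_le.1 (Complex.abs_re_le_norm _)).1
    have h2 := norm_nonneg (F h)
    by_cases hh0 : h = 0
    · rw [if_pos hh0, hh0, hF0]
      have t1 : 0 ≤ (if E 0 ≠ ∅ then ‖F 0‖ else 0) := by split_ifs <;> positivity
      have t2 : 0 ≤ (if E 0 = ∅ ∧ H < |((0 : ℤ) : ℝ)| then ‖F 0‖ else 0) := by
        split_ifs <;> positivity
      linarith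
    · rw [if_neg hh0]
      by_cases hE0 : E h = ∅
      · by_cases hHh : H < |(h : ℝ)|
        · rw [if_neg (not_not.2 hE0), if_pos ⟨hE0, hHh⟩]
          linarith
        · rw [if_neg (not_not.2 hE0), if_neg fun h ↦ hHh h.2]
          have := hmain h (not_lt.1 hHh)
          linarith
      · rw [if_pos hE0, if_neg fun h ↦ hE0 h.1]
        linarith
  -- The real parts add up to at least `1 - 1/8 - 1/8 = 3/4`, against the upper bound `1/2` in
  -- `hre'`.
  have hfinal := Finset.sum_le_sum hsplit
  rw [Finset.sum_sub_distrib, Finset.sum_sub_distrib, Finset.sum_ite_eq' J (0 : ℤ),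
    if_pos h0J, ← Finset.sum_filter, ← Finset.sum_filter] at hfinal
  linarith

/-! ### Pruning to a set with regular prime-power divisibility. -/

open Classical in
/-- Iteratively delete the multiples of those `g i` having few multiples left. -/
lemma exists_pruned_subset {ι : Type*} (g : ι → ℕ) (w : ι → ℝ) (s : Finset ι) (A : Finset ℕ)
    (hw : ∀ i ∈ s, 0 ≤ w i) :
    ∃ A' ⊆ A, (A.card : ℝ) ≤ A'.card + ∑ i ∈ s, w i ∧
      ∀ i ∈ s, (∃ n ∈ A', g i ∣ n) → w i < ((A'.filter (fun n ↦ g i ∣ n)).card : ℝ) := by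
  induction s using Finset.strongInduction generalizing A with
  | H s ih =>
    by_cases h : ∃ i ∈ s, ((A.filter (fun n ↦ g i ∣ n)).card : ℝ) ≤ w i
    · obtain ⟨i, hi, hle⟩ := h
      obtain ⟨A', hA', hcard, hA'g⟩ := ih (s.erase i) (Finset.erase_ssubset hi)
        (A.filter (fun n ↦ ¬ g i ∣ n)) (fun j hj ↦ hw j (Finset.mem_of_mem_erase hj))
      refine ⟨A', hA'.trans (Finset.filter_subset _ _), ?_, fun j hj hex ↦ ?_⟩
      · have h1 := Finset.card_filter_add_card_filter_not (s := A) (fun n ↦ g i ∣ n)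
        have h2 : (A.card : ℝ) = (A.filter (fun n ↦ g i ∣ n)).card +
            (A.filter (fun n ↦ ¬ g i ∣ n)).card := by exact_mod_cast h1.symm
        rw [← Finset.add_sum_erase s w hi]
        linarith
      -- For the deleted index the requirement is vacuous, since no multiple of `g i` remains. This
      -- is why each weight is paid at most once.
      · by_cases hji : j = i
        · subst hji
          obtain ⟨n, hn, hd⟩ := hex
          exact absurd hd (Finset.mem_filter.1 (hA' hn)).2
        · exact hA'g j (Finset.mem_erase.2 ⟨hji, hj⟩) hex
    · push Not at h
      exact ⟨A, subset_rfl, by linarith [Finset.sum_nonneg hw], fun i hi _ ↦ h i hi⟩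

lemma eventually_log_rpow_le (C r : ℝ) {s : ℝ} (hs : 0 < s) :
    ∀ᶠ N : ℕ in atTop, C * Real.log N ^ r ≤ (N : ℝ) ^ s := by
  have h := (isLittleO_log_rpow_rpow_atTop r hs).bound (show 0 < 1 / (|C| + 1) by positivity)
  have h' := tendsto_natCast_atTop_atTop.eventually h
  filter_upwards [h', eventually_ge_atTop 1] with N hN hN1
  have hlog : 0 ≤ Real.log N := Real.log_nonneg (by exact_mod_cast hN1)
  rw [Real.norm_of_nonneg (by positivity), Real.norm_of_nonneg (by positivity)] at hN
  calc C * Real.log N ^ r ≤ (|C| + 1) * Real.log N ^ r := by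
        gcongr
        linarith [le_abs_self C]
    _ ≤ (|C| + 1) * (1 / (|C| + 1) * (N : ℝ) ^ s) := by gcongr
    _ = _ := by field_simp

/-- The pairs `(p, k)` with `p` prime, `k ≥ 1` and `p ^ k ≤ N`. -/
def primePowerPairs (N : ℕ) : Finset (ℕ × ℕ) :=
  (N.primesLE ×ˢ Finset.Icc 1 N).filter (fun x ↦ x.1 ^ x.2 ≤ N)

lemma mem_primePowerPairs {N p k : ℕ} :
    (p, k) ∈ primePowerPairs N ↔ p.Prime ∧ 1 ≤ k ∧ p ^ k ≤ N := by
  simp only [primePowerPairs, Finset.mem_filter, Finset.mem_product, mem_primesLE, Finset.mem_Icc]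
  constructor
  · rintro ⟨⟨h1, h2⟩, h3⟩
    exact ⟨h1.2, h2.1, h3⟩
  · rintro ⟨hp, hk, h⟩
    exact ⟨⟨⟨(Nat.le_self_pow (by omega) p).trans h, hp⟩, hk,
      (Nat.lt_pow_self hp.one_lt).le.trans h⟩, h⟩

lemma sum_geometric_inv_le {p : ℕ} (hp : 2 ≤ p) (n : ℕ) :
    ∑ k ∈ Finset.Icc 1 n, (1 : ℝ) / (p : ℝ) ^ k ≤ 1 / p + 1 / (p * (p - 1)) := by
  have hp' : (2 : ℝ) ≤ p := by exact_mod_cast hp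
  have h : ∑ k ∈ Finset.Icc 1 n, (1 : ℝ) / (p : ℝ) ^ k =
      1 / (p - 1) - 1 / ((p - 1) * (p : ℝ) ^ n) := by
    have hp1 : (p : ℝ) - 1 ≠ 0 := by linarith
    induction n with
    | zero => simp
    | succ n ih =>
      rw [Finset.sum_Icc_succ_top (by omega), ih]
      field_simp
      ring
  rw [h]
  have h1 : (1 : ℝ) / (p - 1) = 1 / p + 1 / (p * (p - 1)) := by
    have hp1 : (p : ℝ) - 1 ≠ 0 := by linarith
    field_simp
    ring
  have h2 : 0 ≤ 1 / (((p : ℝ) - 1) * (p : ℝ) ^ n) :=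
    div_nonneg zero_le_one (mul_nonneg (by linarith) (by positivity))
  linarith

lemma exists_sum_primePowerPairs_le :
    ∃ C : ℝ, 0 < C ∧ ∀ N : ℕ, 2 ≤ N →
      ∑ x ∈ primePowerPairs N, (1 : ℝ) / (x.1 : ℝ) ^ x.2 ≤ Real.log (Real.log N) + C := by
  obtain ⟨C, hC, h⟩ := exists_sum_primes_le
  refine ⟨C + 1, by positivity, fun N hN ↦ ?_⟩
  have h1 : ∑ x ∈ primePowerPairs N, (1 : ℝ) / (x.1 : ℝ) ^ x.2 ≤
      ∑ x ∈ N.primesLE ×ˢ Finset.Icc 1 N, (1 : ℝ) / (x.1 : ℝ) ^ x.2 :=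
    Finset.sum_le_sum_of_subset_of_nonneg (Finset.filter_subset _ _) fun _ _ _ ↦ by positivity
  rw [Finset.sum_product] at h1
  have h2 : ∑ p ∈ N.primesLE, ∑ k ∈ Finset.Icc 1 N, (1 : ℝ) / (p : ℝ) ^ k ≤
      ∑ p ∈ N.primesLE, ((1 : ℝ) / p + 1 / (p * (p - 1))) :=
    Finset.sum_le_sum fun p hp ↦ sum_geometric_inv_le (mem_primesLE.1 hp).2.two_le N
  rw [Finset.sum_add_distrib] at h2
  have e : N.primesLE = primesIoc 0 N := by
    ext p
    rw [mem_primesLE, mem_primesIoc]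
    exact ⟨fun h ↦ ⟨⟨h.2.pos, h.1⟩, h.2⟩, fun h ↦ ⟨h.1.2, h.2⟩⟩
  have h3 : ∑ p ∈ N.primesLE, (1 : ℝ) / (p * (p - 1)) ≤ 1 := by
    have h4 := sum_inv_mul_pred_le N (by omega)
    have h5 : (0 : ℝ) ≤ 1 / N := by positivity
    refine le_trans (Finset.sum_le_sum_of_subset_of_nonneg ?_ ?_) (by linarith :
      ∑ k ∈ Finset.range (N + 1), (1 : ℝ) / (k * (k - 1)) ≤ 1)
    · rw [Nat.primesLE_eq_filter_range]; exact Finset.filter_subset _ _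
    · intro k _ _
      rcases Nat.eq_zero_or_pos k with rfl | hk
      · simp
      · have : (1 : ℝ) ≤ k := by exact_mod_cast hk
        exact div_nonneg zero_le_one (mul_nonneg (by linarith) (by linarith))
  have h6 := h N hN
  rw [← e] at h6
  linarith

/-- An exponent `k ≥ 2` forces `p ≤ √N`, and always `k ≤ log₂ N`; proper prime powers are therefore
negligible in number. -/
lemma card_primePowerPairs_two_le (N : ℕ) :
    ((primePowerPairs N).filter (fun x ↦ 2 ≤ x.2)).card ≤ (N.sqrt + 1) * (Nat.log 2 N + 1) := by
  have hsub : (primePowerPairs N).filter (fun x ↦ 2 ≤ x.2) ⊆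
      Finset.range (N.sqrt + 1) ×ˢ Finset.range (Nat.log 2 N + 1) := by
    rintro ⟨p, k⟩ hx
    obtain ⟨hx, hk2⟩ := Finset.mem_filter.1 hx
    obtain ⟨hp, hk, hle⟩ := mem_primePowerPairs.1 hx
    rw [Finset.mem_product, Finset.mem_range, Finset.mem_range, Nat.lt_succ_iff, Nat.lt_succ_iff]
    constructor
    · rw [Nat.le_sqrt']
      exact (Nat.pow_le_pow_right hp.pos hk2).trans hle
    · exact Nat.le_log_of_pow_le (by norm_num) ((Nat.pow_le_pow_left hp.two_le k).trans hle)
  refine (Finset.card_le_card hsub).trans ?_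
  rw [Finset.card_product, Finset.card_range, Finset.card_range]

/-- The large prime powers carry little reciprocal mass. -/
lemma eventually_sum_large_primePowerPairs_le {δ η : ℝ} (hδ : 0 < δ) (hδ4 : δ ≤ 1 / 4)
    (hη : 4 * δ ≤ η) :
    ∀ᶠ N : ℕ in atTop, ∑ x ∈ primePowerPairs N with (N : ℝ) ^ (1 - δ) < (x.1 : ℝ) ^ x.2,
      (1 : ℝ) / (x.1 : ℝ) ^ x.2 ≤ η := by
  have hδ1 : 0 < 1 - δ := by linarith
  filter_upwards [eventually_log_rpow_le (12 / δ) 1 (show (0 : ℝ) < 1 / 4 by norm_num),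
    tendsto_log_natCast.eventually_ge_atTop (32 / δ), eventually_ge_atTop 16] with N h1 h2 hN16
  rw [Real.rpow_one] at h1
  have hN16' : (16 : ℝ) ≤ N := by exact_mod_cast hN16
  have hN0 : (0 : ℝ) < N := by linarith
  set Y := (N : ℝ) ^ (1 - δ) with hY
  have hY0 : 0 < Y := by positivity
  have hY34 : (N : ℝ) ^ (3 / 4 : ℝ) ≤ Y :=
    Real.rpow_le_rpow_of_exponent_le (by linarith) (by linarith)
  have hYN : Y ≤ N := by
    conv_rhs => rw [← Real.rpow_one (N : ℝ)]
    exact Real.rpow_le_rpow_of_exponent_le (by linarith) (by linarith)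
  have hY2 : 2 ≤ Y := by
    refine le_trans ?_ hY34
    have e : (2 : ℝ) = 2 ^ (1 : ℝ) := (Real.rpow_one 2).symm
    calc (2 : ℝ) ≤ ((16 : ℝ) ^ (3 / 4 : ℝ)) := by
          rw [show (16 : ℝ) = 2 ^ (4 : ℝ) by norm_num, ← Real.rpow_mul (by norm_num)]
          norm_num
      _ ≤ _ := by gcongr
  have hlogY : Real.log Y = (1 - δ) * Real.log N := Real.log_rpow hN0 _
  have hlogN : 0 < Real.log N := Real.log_pos (by linarith)
  set s := (primePowerPairs N).filter (fun x ↦ Y < (x.1 : ℝ) ^ x.2) with hs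
  -- By Mertens the primes in `(N^(1-δ), N]` have mass about `-log (1 - δ) ≤ 2δ`; the remaining `δ`
  -- absorbs the error term.
  have hprimes : ∑ x ∈ s with ¬ 2 ≤ x.2, (1 : ℝ) / (x.1 : ℝ) ^ x.2 ≤ 3 * δ := by
    have hle : ∑ x ∈ s with ¬ 2 ≤ x.2, (1 : ℝ) / (x.1 : ℝ) ^ x.2 ≤
        ∑ p ∈ primesIoc ⌊Y⌋₊ ⌊(N : ℝ)⌋₊, (1 : ℝ) / p := by
      have hone : ∀ x ∈ s.filter (fun x ↦ ¬ 2 ≤ x.2), x.2 = 1 ∧ x.1.Prime ∧ x.1 ≤ N ∧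
          Y < x.1 := by
        rintro ⟨p, k⟩ hx
        obtain ⟨hx, hk⟩ := Finset.mem_filter.1 hx
        obtain ⟨hx, hY⟩ := Finset.mem_filter.1 hx
        obtain ⟨hp, hk1, hle⟩ := mem_primePowerPairs.1 hx
        have hk1 : k = 1 := by simp only at hk; omega
        subst hk1
        simp only [pow_one] at hle hY
        exact ⟨rfl, hp, hle, hY⟩
      have e : ∑ x ∈ s with ¬ 2 ≤ x.2, (1 : ℝ) / (x.1 : ℝ) ^ x.2 =
          ∑ p ∈ (s.filter (fun x ↦ ¬ 2 ≤ x.2)).image Prod.fst, (1 : ℝ) / p := by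
        rw [Finset.sum_image]
        · refine Finset.sum_congr rfl fun x hx ↦ ?_
          rw [(hone x hx).1, pow_one]
        · intro x hx y hy hxy
          exact Prod.ext hxy ((hone x hx).1.trans (hone y hy).1.symm)
      rw [e]
      apply Finset.sum_le_sum_of_subset_of_nonneg
      · intro p hp
        obtain ⟨x, hx, rfl⟩ := Finset.mem_image.1 hp
        obtain ⟨_, h2, h3, h4⟩ := hone x hx
        refine mem_primesIoc.2 ⟨⟨(Nat.floor_lt hY0.le).2 h4, ?_⟩, h2⟩
        rw [Nat.floor_natCast]
        exact h3
      · intro _ _ _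
        positivity
    have hm := (abs_le.1 (mertens_second hY2 hYN)).2
    rw [hlogY, Real.log_mul hδ1.ne' hlogN.ne'] at hm
    have h3 : -Real.log (1 - δ) ≤ 2 * δ := by
      have h4 := Real.log_le_sub_one_of_pos (show 0 < (1 - δ)⁻¹ by positivity)
      rw [Real.log_inv] at h4
      have h5 : (1 - δ)⁻¹ ≤ 1 + 2 * δ := by
        rw [inv_le_iff_one_le_mul₀ hδ1]
        nlinarith
      linarith
    have h4 : 24 / ((1 - δ) * Real.log N) ≤ δ := by
      rw [div_le_iff₀ (by positivity)]
      rw [div_le_iff₀ hδ] at h2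
      nlinarith
    linarith
  -- There are `O(√N log N)` proper powers, each with reciprocal at most `N^(-3/4)`.
  have hpowers : ∑ x ∈ s with 2 ≤ x.2, (1 : ℝ) / (x.1 : ℝ) ^ x.2 ≤ δ := by
    have h3 : ∑ x ∈ s with 2 ≤ x.2, (1 : ℝ) / (x.1 : ℝ) ^ x.2 ≤
        ∑ x ∈ s with 2 ≤ x.2, 1 / Y :=
      Finset.sum_le_sum fun x hx ↦ one_div_le_one_div_of_le hY0
        (Finset.mem_filter.1 (Finset.mem_filter.1 hx).1).2.le
    rw [Finset.sum_const, nsmul_eq_mul, mul_one_div] at h3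
    have h4 : ((s.filter (fun x ↦ 2 ≤ x.2)).card : ℝ) ≤
        ((N.sqrt + 1) * (Nat.log 2 N + 1) : ℕ) := by
      refine Nat.cast_le.2 ((Finset.card_le_card ?_).trans (card_primePowerPairs_two_le N))
      exact Finset.filter_subset_filter _ (Finset.filter_subset _ _)
    have h5 : (N.sqrt : ℝ) ≤ (N : ℝ) ^ (1 / 2 : ℝ) := by
      rw [← Real.sqrt_eq_rpow]
      exact Real.nat_sqrt_le_real_sqrt
    have h6 : (1 : ℝ) ≤ (N : ℝ) ^ (1 / 2 : ℝ) := Real.one_le_rpow (by linarith) (by norm_num)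
    have h7 : (Nat.log 2 N : ℝ) ≤ 2 * Real.log N := by
      have h8 : 2 ^ Nat.log 2 N ≤ N := Nat.pow_log_le_self 2 (by omega)
      have h9 : (2 : ℝ) ^ Nat.log 2 N ≤ N := by exact_mod_cast h8
      have h10 := Real.log_le_log (by positivity) h9
      rw [Real.log_pow] at h10
      have := Real.log_two_gt_d9
      have : (0 : ℝ) ≤ Nat.log 2 N := Nat.cast_nonneg _
      nlinarith
    have hl1 : 1 ≤ Real.log N := by
      have : (1 : ℝ) ≤ 32 / δ := by rw [le_div_iff₀ hδ]; linarith
      linarith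
    refine h3.trans ?_
    rw [div_le_iff₀ hY0]
    push_cast at h4
    calc _ ≤ ((N.sqrt : ℝ) + 1) * (Nat.log 2 N + 1) := h4
      _ ≤ ((N : ℝ) ^ (1 / 2 : ℝ) + (N : ℝ) ^ (1 / 2 : ℝ)) *
          (2 * Real.log N + Real.log N) := by gcongr
      _ = 6 * Real.log N * (N : ℝ) ^ (1 / 2 : ℝ) := by ring
      _ ≤ δ * (12 / δ * Real.log N) * (N : ℝ) ^ (1 / 2 : ℝ) := by
        have e : δ * (12 / δ * Real.log N) = 12 * Real.log N := by field_simp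
        rw [e]
        gcongr
        norm_num
      _ ≤ δ * (N : ℝ) ^ (1 / 4 : ℝ) * (N : ℝ) ^ (1 / 2 : ℝ) := by gcongr
      _ = δ * (N : ℝ) ^ (3 / 4 : ℝ) := by
        rw [mul_assoc, ← Real.rpow_add hN0]
        norm_num
      _ ≤ δ * Y := by gcongr
  have := Finset.sum_filter_add_sum_filter_not s (fun x ↦ 2 ≤ x.2)
    (fun x ↦ (1 : ℝ) / (x.1 : ℝ) ^ x.2)
  linarith

lemma card_multiples_le {A : Finset ℕ} {N q : ℕ} (hA : A ⊆ Finset.Icc 1 N) :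
    ((A.filter (fun n ↦ q ∣ n)).card : ℝ) ≤ N / q := by
  have h1 : A.filter (fun n ↦ q ∣ n) ⊆ (Finset.Ioc 0 N).filter (fun n ↦ q ∣ n) := by
    apply Finset.filter_subset_filter
    exact hA
  have h2 := Finset.card_le_card h1
  rw [Nat.Ioc_filter_dvd_card_eq_div] at h2
  exact (Nat.cast_le.2 h2).trans Nat.cast_div_le

/-- Every set of integers has a large subset for which each occurring prime power is small and
divides many elements. -/
theorem eventually_exists_regular_subset {δ η : ℝ} (hδ : 0 < δ) (hδ4 : δ ≤ 1 / 4)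
    (hη : 8 * δ ≤ η) :
    ∀ᶠ N : ℕ in atTop, ∀ A ⊆ Finset.Icc 1 N, ∃ A' ⊆ A, (A.card : ℝ) ≤ A'.card + η * N ∧
      ∀ p k : ℕ, p.Prime → 1 ≤ k → (∃ n ∈ A', p ^ k ∣ n) →
        ((p ^ k : ℕ) : ℝ) ≤ (N : ℝ) ^ (1 - δ) ∧
        Real.log N ^ (-(1 / 20) : ℝ) * (N / (p ^ k : ℕ)) ≤
          ((A'.filter (fun n ↦ p ^ k ∣ n)).card : ℝ) := by
  obtain ⟨C, hC, hsum⟩ := exists_sum_primePowerPairs_le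
  have hη0 : 0 < η := by linarith
  filter_upwards [eventually_sum_large_primePowerPairs_le hδ hδ4 (η := η / 2) (by linarith),
    tendsto_log_natCast.eventually (eventually_const_mul_rpow_le
      (show (0 : ℝ) < 1 / 20 by norm_num) C (show 0 < η / 4 by positivity)),
    tendsto_log_natCast.eventually ((isLittleO_log_rpow_atTop
      (show (0 : ℝ) < 1 / 20 by norm_num)).bound (show 0 < η / 4 by positivity)),
    tendsto_log_natCast.eventually_ge_atTop 1, eventually_ge_atTop 2]
    with N hlarge hClog hloglog hlog1 hN2 A hA
  have hN0 : (0 : ℝ) < N := by exact_mod_cast (by omega : 0 < N)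
  set t := Real.log N with ht
  have ht0 : 0 < t := by linarith
  rw [Real.rpow_zero, mul_one] at hClog
  rw [Real.norm_of_nonneg (Real.log_nonneg hlog1), Real.norm_of_nonneg (by positivity)] at hloglog
  set τ := t ^ (-(1 / 20) : ℝ) with hτ
  have hτ0 : 0 < τ := by positivity
  set Y := (N : ℝ) ^ (1 - δ) with hY
  set s := primePowerPairs N with hs
  -- A prime power `q > Y` gets the threshold `N / q`, which no set of multiples can exceed, so `q`
  -- must disappear. A smaller `q` gets `τ N / q`; these cost `τ N (log log N + O(1))` in total,
  -- which is `o(N)` as `τ = (log N)^(-1/20)`.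
  set w : ℕ × ℕ → ℝ := fun x ↦ if Y < (x.1 : ℝ) ^ x.2 then N * (1 / (x.1 : ℝ) ^ x.2)
    else τ * N * (1 / (x.1 : ℝ) ^ x.2) with hw
  have hw0 : ∀ x, 0 ≤ w x := fun x ↦ by
    simp only [hw]
    split_ifs <;> positivity
  obtain ⟨A', hA'A, hcard, hprop⟩ := exists_pruned_subset (fun x : ℕ × ℕ ↦ x.1 ^ x.2) w s A
    fun x _ ↦ hw0 x
  refine ⟨A', hA'A, ?_, ?_⟩
  · have h1 : ∑ x ∈ s, w x ≤ N * (∑ x ∈ s with Y < (x.1 : ℝ) ^ x.2, (1 : ℝ) / (x.1 : ℝ) ^ x.2) +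
        τ * N * ∑ x ∈ s, (1 : ℝ) / (x.1 : ℝ) ^ x.2 := by
      rw [Finset.sum_filter, Finset.mul_sum, Finset.mul_sum, ← Finset.sum_add_distrib]
      refine Finset.sum_le_sum fun x _ ↦ ?_
      simp only [hw]
      have : 0 ≤ τ * N * (1 / (x.1 : ℝ) ^ x.2) := by positivity
      split_ifs <;> linarith
    have h2 : τ * N * ∑ x ∈ s, (1 : ℝ) / (x.1 : ℝ) ^ x.2 ≤ η / 2 * N := by
      have h3 : ∑ x ∈ s, (1 : ℝ) / (x.1 : ℝ) ^ x.2 ≤ η / 2 * t ^ (1 / 20 : ℝ) := by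
        have := hsum N hN2
        linarith
      have h4 : τ * t ^ (1 / 20 : ℝ) = 1 := by
        rw [hτ, ← Real.rpow_add ht0]
        norm_num
      calc _ ≤ τ * N * (η / 2 * t ^ (1 / 20 : ℝ)) := by gcongr
        _ = η / 2 * N * (τ * t ^ (1 / 20 : ℝ)) := by ring
        _ = _ := by rw [h4, mul_one]
    have h3 : N * (∑ x ∈ s with Y < (x.1 : ℝ) ^ x.2, (1 : ℝ) / (x.1 : ℝ) ^ x.2) ≤
        N * (η / 2) := by gcongr
    linarith
  · intro p k hp hk hex
    obtain ⟨n, hn, hd⟩ := hex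
    have hnN := Finset.mem_Icc.1 (hA (hA'A hn))
    have hmem : (p, k) ∈ s := mem_primePowerPairs.2
      ⟨hp, hk, (Nat.le_of_dvd (by omega) hd).trans hnN.2⟩
    have h1 : w (p, k) < ((A'.filter (fun n ↦ p ^ k ∣ n)).card : ℝ) := hprop _ hmem ⟨n, hn, hd⟩
    simp only [hw] at h1
    push_cast
    split_ifs at h1 with hlt
    · have h2 := card_multiples_le (q := p ^ k) (hA'A.trans hA)
      push_cast at h2
      rw [mul_one_div] at h1
      linarith
    · refine ⟨not_lt.1 hlt, le_of_lt (lt_of_le_of_lt (le_of_eq ?_) h1)⟩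
      ring

/-! ### Reciprocal sums of dense sets, and sharpness. -/

lemma log_div_le_sum_Ioc {a N : ℕ} (h : a ≤ N) :
    Real.log ((N + 1) / (a + 1)) ≤ ∑ n ∈ Finset.Ioc a N, (1 : ℝ) / n := by
  induction N, h using Nat.le_induction with
  | base => simp [div_self (show (a : ℝ) + 1 ≠ 0 by positivity)]
  | succ N hN ih =>
    rw [Finset.sum_Ioc_succ_top hN]
    have h1 : Real.log (((N + 1 : ℕ) + 1) / (a + 1)) =
        Real.log ((N + 1) / (a + 1)) + Real.log (((N + 1 : ℕ) + 1) / (N + 1)) := by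
      rw [← Real.log_mul (by positivity) (by positivity)]
      congr 1
      field_simp
    have h2 : Real.log ((((N + 1 : ℕ) : ℝ) + 1) / (N + 1)) ≤ 1 / (N + 1 : ℕ) := by
      refine (Real.log_le_sub_one_of_pos (by positivity)).trans (le_of_eq ?_)
      push_cast
      field_simp
      ring
    rw [h1]
    linarith

/-- Among sets of a given size, a final segment minimises the reciprocal sum. -/
lemma log_div_le_sum_inv {A : Finset ℕ} {N : ℕ} (hA : A ⊆ Finset.Icc 1 N) :
    Real.log ((N + 1) / (N - A.card + 1)) ≤ ∑ n ∈ A, (1 : ℝ) / n := by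
  have hcard : A.card ≤ N := by
    have := Finset.card_le_card hA
    rwa [Nat.card_Icc, Nat.add_sub_cancel] at this
  set a := N - A.card with ha
  have ha' : (N : ℝ) - A.card = a := by rw [ha, Nat.cast_sub hcard]
  rw [ha']
  refine (log_div_le_sum_Ioc (show a ≤ N by omega)).trans ?_
  set B := Finset.Ioc a N with hB
  have hBcard : B.card = A.card := by rw [hB, Nat.card_Ioc]; omega
  -- Exchange argument: elements of `B \ A` are at least `a + 1`, those of `A \ B` are at most `a`,
  -- and the two sets have equal size.
  have hdiff : (B \ A).card = (A \ B).card := Finset.card_sdiff_comm hBcard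
  have h1 : ∑ n ∈ B \ A, (1 : ℝ) / n ≤ (B \ A).card * (1 / (a + 1)) := by
    rw [← nsmul_eq_mul]
    refine Finset.sum_le_card_nsmul _ _ _ fun n hn ↦ ?_
    have := (Finset.mem_Ioc.1 (Finset.mem_sdiff.1 hn).1).1
    apply one_div_le_one_div_of_le (by positivity)
    exact_mod_cast this
  have h2 : ((A \ B).card : ℝ) * (1 / (a + 1)) ≤ ∑ n ∈ A \ B, (1 : ℝ) / n := by
    rw [← nsmul_eq_mul]
    refine Finset.card_nsmul_le_sum _ _ _ fun n hn ↦ ?_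
    obtain ⟨hnA, hnB⟩ := Finset.mem_sdiff.1 hn
    have h3 := Finset.mem_Icc.1 (hA hnA)
    have h4 : n ≤ a := by
      by_contra h
      exact hnB (Finset.mem_Ioc.2 ⟨not_le.1 h, h3.2⟩)
    apply one_div_le_one_div_of_le
    · exact_mod_cast h3.1
    · exact_mod_cast h4.trans (Nat.le_succ a)
  have h3 := Finset.sum_inter_add_sum_sdiff A B (fun n : ℕ ↦ (1 : ℝ) / n)
  have h4 := Finset.sum_inter_add_sum_sdiff B A (fun n : ℕ ↦ (1 : ℝ) / n)
  rw [Finset.inter_comm] at h4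
  rw [hdiff] at h1
  linarith

/-- Adding elements one at a time, the sum overshoots `s` by at most one term. -/
lemma exists_subset_sum_between {ι : Type*} (A : Finset ι) (f : ι → ℝ) {s η : ℝ} (hs : 0 ≤ s)
    (hη : 0 ≤ η) (hf : ∀ i ∈ A, f i ≤ η) (hsum : s ≤ ∑ i ∈ A, f i) :
    ∃ B ⊆ A, s ≤ ∑ i ∈ B, f i ∧ ∑ i ∈ B, f i ≤ s + η := by
  classical
  induction A using Finset.induction_on with
  | empty => exact ⟨∅, subset_rfl, hsum, by rw [Finset.sum_empty]; linarith⟩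
  | insert a A ha ih =>
    by_cases h : s ≤ ∑ i ∈ A, f i
    · obtain ⟨B, hB, h1⟩ := ih (fun i hi ↦ hf i (Finset.mem_insert_of_mem hi)) h
      exact ⟨B, hB.trans (Finset.subset_insert _ _), h1⟩
    · refine ⟨insert a A, subset_rfl, hsum, ?_⟩
      rw [Finset.sum_insert ha]
      have := hf a (Finset.mem_insert_self a A)
      linarith

/-- Dense sets have a reciprocal sum exceeding `1`, even after discarding small elements. -/
lemma one_add_le_sum_inv {ε : ℝ} (hε : 0 < ε) (hε2 : ε < 1 / 2) {N : ℕ}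
    (hN : 2 * Real.exp 2 / ε ≤ N) {A : Finset ℕ} (hA : A ⊆ Finset.Icc 1 N)
    (hcard : (1 - 1 / Real.exp 1 + ε) * N ≤ A.card) :
    1 + ε / 2 ≤ ∑ n ∈ A with ε / 2 * N ≤ ((n : ℕ) : ℝ), (1 : ℝ) / n := by
  set A₁ := A.filter (fun n : ℕ ↦ ε / 2 * N ≤ (n : ℝ)) with hA₁
  have hN0 : (0 : ℝ) ≤ N := Nat.cast_nonneg N
  have hsmall : ((A.filter (fun n : ℕ ↦ ¬ ε / 2 * N ≤ (n : ℝ))).card : ℝ) ≤ ε / 2 * N := by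
    have hsub : A.filter (fun n : ℕ ↦ ¬ ε / 2 * N ≤ (n : ℝ)) ⊆ Finset.Icc 1 ⌊ε / 2 * N⌋₊ := by
      intro n hn
      obtain ⟨h1, h2⟩ := Finset.mem_filter.1 hn
      exact Finset.mem_Icc.2 ⟨(Finset.mem_Icc.1 (hA h1)).1, Nat.le_floor (not_le.1 h2).le⟩
    have h1 := Finset.card_le_card hsub
    rw [Nat.card_Icc, Nat.add_sub_cancel] at h1
    exact (Nat.cast_le.2 h1).trans (Nat.floor_le (by positivity))
  have hsplit : (A.card : ℝ) = A₁.card +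
      (A.filter (fun n : ℕ ↦ ¬ ε / 2 * N ≤ (n : ℝ))).card := by
    exact_mod_cast (Finset.card_filter_add_card_filter_not (s := A)
      (fun n : ℕ ↦ ε / 2 * N ≤ (n : ℝ))).symm
  have hA₁N : A₁ ⊆ Finset.Icc 1 N := (Finset.filter_subset _ _).trans hA
  have hle : (A₁.card : ℝ) ≤ N := by
    have := Finset.card_le_card hA₁N
    rw [Nat.card_Icc, Nat.add_sub_cancel] at this
    exact_mod_cast this
  refine le_trans ?_ (log_div_le_sum_inv hA₁N)
  have hpos : (0 : ℝ) < N - A₁.card + 1 := by linarith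
  rw [Real.le_log_iff_exp_le (by positivity), le_div_iff₀ hpos]
  have he : 0 < Real.exp 1 := Real.exp_pos 1
  have hbound : (N : ℝ) - A₁.card + 1 ≤ (1 / Real.exp 1 - ε / 2) * N + 1 := by linarith
  -- With `x = ε / 2` the left side is `e^x (1 - e x)`. Since `e ≥ 2`, it is at most `e^x (1 - x)^2
  -- ≤ 1 - x`. The slack `x N` later pays for the `+ 1` terms.
  have h1 : Real.exp (1 + ε / 2) * (1 / Real.exp 1 - ε / 2) ≤ 1 - ε / 2 := by
    have e : Real.exp (1 + ε / 2) * (1 / Real.exp 1 - ε / 2) =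
        Real.exp (ε / 2) * (1 - Real.exp 1 * (ε / 2)) := by
      rw [Real.exp_add]
      field_simp
    have h2 : Real.exp (ε / 2) * (1 - ε / 2) ≤ 1 := by
      have h3 := Real.add_one_le_exp (-(ε / 2))
      calc Real.exp (ε / 2) * (1 - ε / 2) ≤ Real.exp (ε / 2) * Real.exp (-(ε / 2)) := by
            gcongr
            linarith
        _ = 1 := by rw [← Real.exp_add]; simp
    have h4 : 1 - Real.exp 1 * (ε / 2) ≤ (1 - ε / 2) * (1 - ε / 2) := by
      have : 2 * (ε / 2) ≤ Real.exp 1 * (ε / 2) := by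
        gcongr
        linarith [Real.exp_one_gt_d9]
      nlinarith
    rw [e]
    calc _ ≤ Real.exp (ε / 2) * ((1 - ε / 2) * (1 - ε / 2)) := by gcongr
      _ = Real.exp (ε / 2) * (1 - ε / 2) * (1 - ε / 2) := by ring
      _ ≤ 1 * (1 - ε / 2) := by
        apply mul_le_mul_of_nonneg_right h2
        linarith
      _ = _ := one_mul _
  have h2 : Real.exp (1 + ε / 2) ≤ Real.exp 2 := Real.exp_le_exp.2 (by linarith)
  rw [div_le_iff₀ hε] at hN
  calc Real.exp (1 + ε / 2) * (N - A₁.card + 1)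
      ≤ Real.exp (1 + ε / 2) * ((1 / Real.exp 1 - ε / 2) * N + 1) := by gcongr
    _ = Real.exp (1 + ε / 2) * (1 / Real.exp 1 - ε / 2) * N + Real.exp (1 + ε / 2) := by ring
    _ ≤ (1 - ε / 2) * N + Real.exp 2 := by gcongr
    _ ≤ N + 1 := by linarith

/-- The final segment of `[1, N]` beyond `N / e` has reciprocal sum less than `1`. -/
theorem exists_dense_sum_inv_lt_one {γ : ℝ} (hγ : 0 < γ) :
    ∃ N₀ : ℕ, ∀ N : ℕ, N₀ ≤ N →
      ∃ A : Finset ℕ, A ⊆ Finset.Icc 1 N ∧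
        (1 - 1 / Real.exp 1 - γ) * (N : ℝ) ≤ (A.card : ℝ) ∧ ∑ n ∈ A, (1 : ℝ) / (n : ℝ) < 1 := by
  refine ⟨⌈1 / γ⌉₊ + 2, fun N hN ↦ ?_⟩
  have hN2 : (2 : ℝ) ≤ N := by exact_mod_cast (by omega : 2 ≤ N)
  have hNγ : 1 ≤ γ * N := by
    have h1 : (⌈1 / γ⌉₊ : ℝ) ≤ N := by exact_mod_cast (by omega : ⌈1 / γ⌉₊ ≤ N)
    have h2 := (Nat.le_ceil (1 / γ)).trans h1
    rw [div_le_iff₀ hγ] at h2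
    linarith
  -- The `+ 1` makes `k > N / e` strictly, so `log N - log k < 1`.
  set k := ⌊(N : ℝ) / Real.exp 1⌋₊ + 1 with hk
  have he : 2 < Real.exp 1 := by linarith [Real.exp_one_gt_d9]
  have hk1 : (N : ℝ) / Real.exp 1 < k := by
    rw [hk]
    push_cast
    exact Nat.lt_floor_add_one _
  have hk2 : (k : ℝ) ≤ N / Real.exp 1 + 1 := by
    rw [hk]
    push_cast
    linarith [Nat.floor_le (show 0 ≤ (N : ℝ) / Real.exp 1 by positivity)]
  have hkN : k ≤ N := by
    have h1 : (N : ℝ) / Real.exp 1 ≤ N / 2 := by gcongr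
    have : (k : ℝ) ≤ N := by linarith
    exact_mod_cast this
  refine ⟨Finset.Ioc k N, fun n hn ↦ ?_, ?_, ?_⟩
  · have := Finset.mem_Ioc.1 hn
    exact Finset.mem_Icc.2 ⟨by omega, this.2⟩
  · rw [Nat.card_Ioc, Nat.cast_sub hkN]
    have e : (1 - 1 / Real.exp 1 - γ) * (N : ℝ) = N - N / Real.exp 1 - γ * N := by ring
    rw [e]
    linarith
  · have hk0 : 0 < k := Nat.succ_pos _
    have hsum : ∀ M : ℕ, k ≤ M → ∑ n ∈ Finset.Ioc k M, (1 : ℝ) / n ≤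
        Real.log M - Real.log k := by
      intro M hM
      induction M, hM using Nat.le_induction with
      | base => simp
      | succ M hM ih =>
        rw [Finset.sum_Ioc_succ_top hM]
        have hM0 : (0 : ℝ) < M := by exact_mod_cast hk0.trans_le hM
        have h1 := Real.log_le_sub_one_of_pos (show 0 < (M : ℝ) / (M + 1) by positivity)
        rw [Real.log_div (by positivity) (by positivity)] at h1
        have e : (M : ℝ) / (M + 1) - 1 = -(1 / (M + 1)) := by field_simp; ring
        rw [e] at h1
        push_cast
        linarith
    refine (hsum N hkN).trans_lt ?_
    have hlt : Real.log (N / Real.exp 1) < Real.log k :=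
      Real.log_lt_log (by positivity) hk1
    rw [Real.log_div (by positivity) (by positivity), Real.log_exp] at hlt
    linarith

/-! ### Assembly: from regular sets to dense sets. -/

lemma lcm_le_pow_card {A : Finset ℕ} {N : ℕ} (hA : A ⊆ Finset.Icc 1 N) :
    A.lcm id ≤ N ^ (A.lcm id).primeFactors.card := by
  have hA0 : ∀ n ∈ A, n ≠ 0 := fun n hn ↦ by
    have := (Finset.mem_Icc.1 (hA hn)).1
    omega
  have hQ0 : A.lcm id ≠ 0 := by
    rw [Ne, Finset.lcm_eq_zero_iff]
    rintro ⟨n, hn, h0⟩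
    exact hA0 n hn h0
  have h1 : ∏ r ∈ (A.lcm id).primeFactors, r ^ (A.lcm id).factorization r = A.lcm id :=
    Nat.prod_factorization_pow_eq_self hQ0
  conv_lhs => rw [← h1]
  apply Finset.prod_le_pow_card
  intro r hr
  obtain ⟨n, hn, hd⟩ := exists_prime_pow_factorization_dvd hA0 hr
  have := Finset.mem_Icc.1 (hA hn)
  exact (Nat.le_of_dvd this.1 hd).trans this.2

open Classical in
/-- A regular set whose reciprocal sum lies in `[1 + κ, 2)` has a subset of reciprocal sum `1`. -/
theorem eventually_exists_subset_of_regular {δ c κ : ℝ} (hδ : 0 < δ) (hδ4 : δ ≤ 1 / 4)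
    (hc : 0 < c) (hκ : 0 < κ) :
    ∀ᶠ N : ℕ in atTop, ∀ A ⊆ Finset.Icc 1 N, (∀ n ∈ A, c * N ≤ n) →
      1 + κ ≤ ∑ n ∈ A, (1 : ℝ) / n → ∑ n ∈ A, (1 : ℝ) / n < 2 →
      (∀ p k : ℕ, p.Prime → 1 ≤ k → (∃ n ∈ A, p ^ k ∣ n) →
        ((p ^ k : ℕ) : ℝ) ≤ (N : ℝ) ^ (1 - δ) ∧
        Real.log N ^ (-(1 / 20) : ℝ) * (N / (p ^ k : ℕ)) ≤
          ((A.filter (fun n ↦ p ^ k ∣ n)).card : ℝ)) →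
      ∃ S ⊆ A, ∑ n ∈ S, (1 : ℝ) / n = 1 := by
  have hδ8 : 0 < δ / 8 := by positivity
  filter_upwards [eventually_exists_common_multiple hδ hc,
    eventually_log_rpow_le (4 / c) 0 hδ8,
    eventually_log_rpow_le (8 / κ) (41 / 20) (show 0 < 3 * δ / 4 by positivity),
    eventually_log_rpow_le (1 / (κ * c)) 1 (show (0 : ℝ) < 1 / 5 by norm_num),
    eventually_log_rpow_le (2 * Real.pi / c) 0 (show (0 : ℝ) < 2 / 5 by norm_num),
    eventually_log_rpow_le (8 * (2 * Real.pi / c) ^ 3) 0 (show (0 : ℝ) < 1 / 5 by norm_num),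
    eventually_log_rpow_le (4 / c) 1 hδ,
    tendsto_log_natCast.eventually_ge_atTop 1, eventually_ge_atTop 144]
    with N hcommon h1 h2 h3 h4 h5 h6 hlog1 hN144 A hA hAc hR1 hR2 hreg
  have hN144' : (144 : ℝ) ≤ N := by exact_mod_cast hN144
  have hN0 : (0 : ℝ) < N := by linarith
  set t := Real.log N with ht
  have ht0 : 0 < t := by linarith
  have hNexp : (N : ℝ) = Real.exp t := (Real.exp_log hN0).symm
  rw [Real.rpow_zero, mul_one] at h1 h4 h5
  rw [Real.rpow_one] at h3 h6
  set R := ∑ n ∈ A, (1 : ℝ) / n with hR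
  set τ := t ^ (-(1 / 20) : ℝ) with hτ
  have hτ0 : 0 < τ := by positivity
  set K := (N : ℝ) ^ (1 - δ / 8) with hK
  have hA0 : ∀ n ∈ A, n ≠ 0 := fun n hn ↦ by
    have := (Finset.mem_Icc.1 (hA hn)).1
    omega
  have hR0 : 0 < R := by linarith
  have hp1 : 1 / R < 1 := by rw [div_lt_one hR0]; linarith
  have hphalf : 1 / 2 < 1 / R := one_div_lt_one_div_of_lt hR0 hR2
  have h1p : κ / 2 ≤ 1 - 1 / R := by
    have e : 1 - 1 / R = (R - 1) / R := by field_simp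
    rw [e, div_le_div_iff₀ (by norm_num) hR0]
    have hκ1 : κ ≤ 1 := by linarith
    nlinarith
  have h8p : 2 * κ ≤ 8 * (1 / R) * (1 - 1 / R) := by nlinarith
  have hcard : c * N ≤ A.card := by
    have hle : R ≤ A.card * (1 / (c * N)) := by
      rw [← nsmul_eq_mul]
      refine Finset.sum_le_card_nsmul _ _ _ fun n hn ↦ ?_
      exact one_div_le_one_div_of_le (by positivity) (hAc n hn)
    rw [mul_one_div, le_div_iff₀ (by positivity)] at hle
    have : 1 * (c * N) ≤ R * (c * N) := by
      apply mul_le_mul_of_nonneg_right _ (by positivity)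
      linarith
    linarith
  have hcardN : (A.card : ℝ) ≤ N := by
    have := Finset.card_le_card hA
    rw [Nat.card_Icc, Nat.add_sub_cancel] at this
    exact_mod_cast this
  have hregQ : ∀ r ∈ (A.lcm id).primeFactors,
      0 < r ^ (A.lcm id).factorization r ∧
      ((r ^ (A.lcm id).factorization r : ℕ) : ℝ) ≤ (N : ℝ) ^ (1 - δ) ∧
      τ * (N / (r ^ (A.lcm id).factorization r : ℕ)) ≤
          ((A.filter (fun n ↦ r ^ (A.lcm id).factorization r ∣ n)).card : ℝ) := by
    intro r hr
    have hrp := Nat.prime_of_mem_primeFactors hr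
    refine ⟨pow_pos hrp.pos _, hreg r _ hrp ?_ (exists_prime_pow_factorization_dvd hA0 hr)⟩
    rw [← Nat.support_factorization, Finsupp.mem_support_iff] at hr
    omega
  -- `H` must lie between `N^(1/2)`, so that `N (H/N)^2` beats `log N`, and `N^(2/3)`, so that `N
  -- (H/N)^3` is small. On the minor arcs `(K/N)^2 V` is `N^(3δ/4)` up to logarithms.
  refine exists_subset_sum_inv_eq_one (p := 1 / R) (K := K) (H := (N : ℝ) ^ (3 / 5 : ℝ))
    (V := τ / 2 * (N : ℝ) ^ δ) (L := c * N) hA hAc (by positivity) hp1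
    (one_div_mul_cancel hR0.ne') hR2 (Real.one_le_rpow (by linarith) (by linarith)) ?_
    (by positivity) ?_ ?_ ?_ ?_ ?_ ?_
  · have e : (N : ℝ) = N ^ (1 - δ / 8) * N ^ (δ / 8) := by
      rw [← Real.rpow_add hN0]; simp
    have h7 : 2 * 2 ≤ c * (N : ℝ) ^ (δ / 8) := by
      rw [div_le_iff₀ hc] at h1; linarith
    have hK0 : 0 < K := by positivity
    calc 2 * K < 2 * 2 * K := by linarith
      _ ≤ c * (N : ℝ) ^ (δ / 8) * K := by gcongr
      _ = c * N := by rw [hK]; conv_rhs => rw [e]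
                      ring
  · intro h
    obtain ⟨x, hxK, hx⟩ := hcommon h A
      (((A.lcm id).primeFactors.filter (fun r ↦
        τ / 2 * (N / (r ^ (A.lcm id).factorization r : ℕ)) ≤
          ((A.filter (fun n ↦ r ^ (A.lcm id).factorization r ∣ n ∧
            ∃ y : ℤ, |(y : ℝ) - h| ≤ K ∧ (n : ℤ) ∣ y)).card : ℝ))).image
        (fun r ↦ r ^ (A.lcm id).factorization r)) hA hAc (by
        intro q hq
        obtain ⟨r, hr, rfl⟩ := Finset.mem_image.1 hq
        obtain ⟨hr1, hr2⟩ := Finset.mem_filter.1 hr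
        obtain ⟨h7, h8, h9⟩ := hregQ r hr1
        exact ⟨h7, h8, hr2⟩)
    refine ⟨x, hxK, fun r hr ↦ ?_⟩
    by_cases hgood : τ / 2 * (N / (r ^ (A.lcm id).factorization r : ℕ)) ≤
          ((A.filter (fun n ↦ r ^ (A.lcm id).factorization r ∣ n ∧
            ∃ y : ℤ, |(y : ℝ) - h| ≤ K ∧ (n : ℤ) ∣ y)).card : ℝ)
    · left
      exact hx _ (Finset.mem_image_of_mem _ (Finset.mem_filter.2 ⟨hr, hgood⟩))
    -- Regularity supplies `τ N / q` multiples of `q` in `A`. Fewer than half of that number are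
    -- good, so at least `τ N / (2 q) ≥ τ N^δ / 2` are bad.
    · right
      obtain ⟨h7, h8, h9⟩ := hregQ r hr
      set q := r ^ (A.lcm id).factorization r with hq
      have hq0 : (0 : ℝ) < q := by exact_mod_cast h7
      have h10 := Finset.card_filter_add_card_filter_not (s := A.filter (fun n ↦ q ∣ n))
        (fun n : ℕ ↦ ∃ y : ℤ, |(y : ℝ) - h| ≤ K ∧ (n : ℤ) ∣ y)
      rw [Finset.filter_filter, Finset.filter_filter] at h10
      have h11 : (((A.filter (fun n ↦ q ∣ n ∧
          ∃ y : ℤ, |(y : ℝ) - h| ≤ K ∧ (n : ℤ) ∣ y)).card : ℝ) +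
          ((A.filter (fun n ↦ q ∣ n ∧
          ¬ ∃ y : ℤ, |(y : ℝ) - h| ≤ K ∧ (n : ℤ) ∣ y)).card : ℝ)) =
          (A.filter (fun n ↦ q ∣ n)).card := by exact_mod_cast h10
      have h12 : (N : ℝ) ^ δ ≤ N / q := by
        rw [le_div_iff₀ hq0]
        calc (N : ℝ) ^ δ * q ≤ (N : ℝ) ^ δ * (N : ℝ) ^ (1 - δ) := by gcongr
          _ = N := by rw [← Real.rpow_add hN0]; simp
      have h13 : τ / 2 * (N : ℝ) ^ δ ≤ τ / 2 * (N / q) := by gcongr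
      linarith [not_le.1 hgood]
  · have hKN : K / N = (N : ℝ) ^ (-(δ / 8)) := by
      rw [hK, div_eq_iff hN0.ne']
      nth_rewrite 3 [← Real.rpow_one (N : ℝ)]
      rw [← Real.rpow_add hN0]
      congr 1
      ring
    have e : (K / N) ^ 2 * (τ / 2 * (N : ℝ) ^ δ / (2 * t)) =
        (N : ℝ) ^ (3 * δ / 4) * t ^ (-(21 / 20) : ℝ) / 4 := by
      have e1 : (K / N) ^ 2 * (N : ℝ) ^ δ = (N : ℝ) ^ (3 * δ / 4) := by
        rw [hKN, ← Real.rpow_natCast, ← Real.rpow_mul hN0.le, ← Real.rpow_add hN0]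
        congr 1
        push_cast
        ring
      have e2 : τ / t = t ^ (-(21 / 20) : ℝ) := by
        rw [hτ, div_eq_iff ht0.ne']
        nth_rewrite 3 [← Real.rpow_one t]
        rw [← Real.rpow_add ht0]
        norm_num
      rw [← e1, ← e2]
      field_simp
      norm_num
    have h7 : 4 * t ≤ 2 * κ * ((N : ℝ) ^ (3 * δ / 4) * t ^ (-(21 / 20) : ℝ) / 4) := by
      have e3 : t = t ^ (41 / 20 : ℝ) * t ^ (-(21 / 20) : ℝ) := by
        rw [← Real.rpow_add ht0]; norm_num
      calc 4 * t = 4 * (t ^ (41 / 20 : ℝ) * t ^ (-(21 / 20) : ℝ)) := by rw [← e3]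
        _ = κ / 2 * (8 / κ * t ^ (41 / 20 : ℝ)) * t ^ (-(21 / 20) : ℝ) := by field_simp; norm_num
        _ ≤ κ / 2 * (N : ℝ) ^ (3 * δ / 4) * t ^ (-(21 / 20) : ℝ) := by gcongr
        _ = _ := by ring
    have h8 : 4 * t ≤ 8 * (1 / R) * (1 - 1 / R) * (K / N) ^ 2 *
        (τ / 2 * (N : ℝ) ^ δ / (2 * t)) := by
      rw [mul_assoc, e]
      refine h7.trans ?_
      gcongr
    calc 144 * (N : ℝ) ^ 3 * Real.exp _ ≤ N * (N : ℝ) ^ 3 * Real.exp (-(4 * t)) := by gcongr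
      _ = 1 := by
        rw [hNexp, ← Real.exp_nat_mul, ← Real.exp_add, ← Real.exp_add, ← Real.exp_zero]
        congr 1
        push_cast
        ring
  · have h7 : 2 * t ≤ 8 * (1 / R) * (1 - 1 / R) * ((N : ℝ) ^ (3 / 5 : ℝ) / N) ^ 2 * A.card := by
      have e : ((N : ℝ) ^ (3 / 5 : ℝ) / N) ^ 2 * (c * N) = c * (N : ℝ) ^ (1 / 5 : ℝ) := by
        have e1 : (N : ℝ) ^ (3 / 5 : ℝ) / N = (N : ℝ) ^ (-(2 / 5) : ℝ) := by
          rw [div_eq_iff hN0.ne']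
          nth_rewrite 3 [← Real.rpow_one (N : ℝ)]
          rw [← Real.rpow_add hN0]
          norm_num
        have e2 : ((N : ℝ) ^ (-(2 / 5) : ℝ)) ^ 2 * N = (N : ℝ) ^ (1 / 5 : ℝ) := by
          nth_rewrite 2 [← Real.rpow_one (N : ℝ)]
          rw [← Real.rpow_natCast, ← Real.rpow_mul hN0.le, ← Real.rpow_add hN0]
          norm_num
        rw [e1, mul_left_comm, e2]
      have h8 : t ≤ κ * c * (N : ℝ) ^ (1 / 5 : ℝ) := by
        rw [one_div, ← div_eq_inv_mul, div_le_iff₀ (by positivity)] at h3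
        linarith
      calc 2 * t ≤ 2 * κ * (c * (N : ℝ) ^ (1 / 5 : ℝ)) := by linarith
        _ = 2 * κ * (((N : ℝ) ^ (3 / 5 : ℝ) / N) ^ 2 * (c * N)) := by rw [e]
        _ ≤ 8 * (1 / R) * (1 - 1 / R) * (((N : ℝ) ^ (3 / 5 : ℝ) / N) ^ 2 * A.card) := by gcongr
        _ = _ := by ring
    calc 24 * (N : ℝ) * Real.exp _ ≤ N * (N : ℝ) * Real.exp (-(2 * t)) := by
          gcongr
          linarith
      _ = 1 := by
        rw [hNexp, ← Real.exp_add, ← Real.exp_add, ← Real.exp_zero]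
        congr 1
        ring
  · rw [div_le_one (by positivity)]
    have e : (N : ℝ) = N ^ (2 / 5 : ℝ) * N ^ (3 / 5 : ℝ) := by
      rw [← Real.rpow_add hN0]; norm_num
    rw [div_le_iff₀ hc] at h4
    calc 2 * Real.pi * (N : ℝ) ^ (3 / 5 : ℝ) ≤
        (N : ℝ) ^ (2 / 5 : ℝ) * c * (N : ℝ) ^ (3 / 5 : ℝ) := by gcongr
      _ = c * (N ^ (2 / 5 : ℝ) * N ^ (3 / 5 : ℝ)) := by ring
      _ = _ := by rw [← e]
  · have e : 2 * Real.pi * (N : ℝ) ^ (3 / 5 : ℝ) / (c * N) =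
        2 * Real.pi / c * (N : ℝ) ^ (-(2 / 5) : ℝ) := by
      have e1 : (N : ℝ) ^ (3 / 5 : ℝ) = (N : ℝ) ^ (-(2 / 5) : ℝ) * N := by
        nth_rewrite 3 [← Real.rpow_one (N : ℝ)]
        rw [← Real.rpow_add hN0]
        norm_num
      rw [e1]
      field_simp
    have e2 : (N : ℝ) * ((N : ℝ) ^ (-(2 / 5) : ℝ)) ^ 3 * (N : ℝ) ^ (1 / 5 : ℝ) = 1 := by
      nth_rewrite 1 [← Real.rpow_one (N : ℝ)]
      rw [← Real.rpow_natCast, ← Real.rpow_mul hN0.le, ← Real.rpow_add hN0, ← Real.rpow_add hN0]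
      norm_num
    rw [e, mul_pow]
    calc 8 * (A.card * ((2 * Real.pi / c) ^ 3 * ((N : ℝ) ^ (-(2 / 5) : ℝ)) ^ 3))
        ≤ 8 * (N * ((2 * Real.pi / c) ^ 3 * ((N : ℝ) ^ (-(2 / 5) : ℝ)) ^ 3)) := by gcongr
      _ = 8 * (2 * Real.pi / c) ^ 3 * (N * ((N : ℝ) ^ (-(2 / 5) : ℝ)) ^ 3) := by ring
      _ ≤ (N : ℝ) ^ (1 / 5 : ℝ) * (N * ((N : ℝ) ^ (-(2 / 5) : ℝ)) ^ 3) := by gcongr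
      _ = N * ((N : ℝ) ^ (-(2 / 5) : ℝ)) ^ 3 * (N : ℝ) ^ (1 / 5 : ℝ) := by ring
      _ = 1 := e2
  -- The lcm has at most `N^(1-δ)` prime factors, each with prime power at most `N`, so it is `exp
  -- (O(N^(1-δ) log N))`. This is negligible against the decay `exp (-cN/2)` of `(1 - p)^|A|`.
  · have hPcard : ((A.lcm id).primeFactors.card : ℝ) ≤ (N : ℝ) ^ (1 - δ) := by
      have hsub : (A.lcm id).primeFactors ⊆ Finset.Icc 1 ⌊(N : ℝ) ^ (1 - δ)⌋₊ := by
        intro r hr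
        have hrp := Nat.prime_of_mem_primeFactors hr
        have hr' := hr
        rw [← Nat.support_factorization, Finsupp.mem_support_iff] at hr'
        refine Finset.mem_Icc.2 ⟨hrp.pos, Nat.le_floor (le_trans ?_ (hregQ r hr).2.1)⟩
        exact_mod_cast Nat.le_self_pow hr' r
      have := Finset.card_le_card hsub
      rw [Nat.card_Icc, Nat.add_sub_cancel] at this
      exact (Nat.cast_le.2 this).trans (Nat.floor_le (by positivity))
    have hQle : ((A.lcm id : ℕ) : ℝ) ≤ Real.exp (t * (N : ℝ) ^ (1 - δ)) := by
      have h7 : ((A.lcm id : ℕ) : ℝ) ≤ (N : ℝ) ^ (A.lcm id).primeFactors.card := by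
        exact_mod_cast lcm_le_pow_card hA
      refine h7.trans ?_
      rw [← Real.rpow_natCast, Real.rpow_def_of_pos hN0]
      apply Real.exp_le_exp.2
      gcongr
    have hqpow : (1 - 1 / R) ^ A.card ≤ Real.exp (-(c * N / 2)) := by
      have h7 : 1 - 1 / R ≤ Real.exp (-(1 / 2)) := by
        have := Real.add_one_le_exp (-(1 / 2) : ℝ)
        linarith
      have h8 : 0 ≤ 1 - 1 / R := by linarith
      calc (1 - 1 / R) ^ A.card ≤ Real.exp (-(1 / 2)) ^ A.card := by gcongr
        _ = Real.exp (A.card * -(1 / 2)) := (Real.exp_nat_mul _ _).symm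
        _ ≤ _ := by
          apply Real.exp_le_exp.2
          linarith
    have hfin : t * (N : ℝ) ^ (1 - δ) - c * N / 2 ≤ -1 := by
      have e : (N : ℝ) = N ^ δ * N ^ (1 - δ) := by
        rw [← Real.rpow_add hN0]; simp
      have h7 : 4 * t ≤ c * (N : ℝ) ^ δ := by
        rw [div_mul_eq_mul_div, div_le_iff₀ hc] at h6
        linarith
      have hp : 1 ≤ (N : ℝ) ^ (1 - δ) := Real.one_le_rpow (by linarith) (by linarith)
      have h8 : 4 * t * (N : ℝ) ^ (1 - δ) ≤ c * N := by
        calc _ ≤ c * (N : ℝ) ^ δ * (N : ℝ) ^ (1 - δ) := by gcongr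
          _ = c * (N ^ δ * N ^ (1 - δ)) := by ring
          _ = _ := by rw [← e]
      nlinarith
    calc ((A.lcm id : ℕ) : ℝ) * (1 - 1 / R) ^ A.card
        ≤ Real.exp (t * (N : ℝ) ^ (1 - δ)) * Real.exp (-(c * N / 2)) :=
          mul_le_mul hQle hqpow (pow_nonneg (by linarith) _) (Real.exp_pos _).le
      _ ≤ Real.exp (-1) := by
        rw [← Real.exp_add]
        apply Real.exp_le_exp.2
        linarith
      _ ≤ 1 / 2 := by
        rw [Real.exp_neg, ← one_div]
        apply one_div_le_one_div_of_le (by norm_num)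
        linarith [Real.exp_one_gt_d9]

/-- Sets of density exceeding `1 - 1/e` have a subset of reciprocal sum `1`. -/
theorem eventually_exists_subset_of_dense {ε : ℝ} (hε : 0 < ε) (hε2 : ε < 1 / 2) :
    ∀ᶠ N : ℕ in atTop, ∀ A ⊆ Finset.Icc 1 N,
      (1 - 1 / Real.exp 1 + ε) * (N : ℝ) ≤ (A.card : ℝ) →
      ∃ S ⊆ A, ∑ n ∈ S, (1 : ℝ) / n = 1 := by
  have hδ : 0 < ε ^ 2 / 64 := by positivity
  have hδ4 : ε ^ 2 / 64 ≤ 1 / 4 := by nlinarith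
  filter_upwards [eventually_exists_regular_subset hδ hδ4 (η := ε ^ 2 / 8) (by linarith),
    eventually_exists_subset_of_regular hδ hδ4 (c := ε / 2) (κ := ε / 4) (by positivity)
      (by positivity),
    tendsto_natCast_atTop_atTop.eventually_ge_atTop (2 * Real.exp 2 / ε),
    tendsto_natCast_atTop_atTop.eventually_ge_atTop (8 / ε)]
    with N hregular hsubset hN1 hN2 A hA hcard
  have hN0 : (0 : ℝ) < N := lt_of_lt_of_le (by positivity) hN2
  have hcN : 4 ≤ ε / 2 * N := by
    rw [div_le_iff₀ hε] at hN2
    linarith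
  have hsum := one_add_le_sum_inv hε hε2 hN1 hA hcard
  set A₁ := A.filter (fun n : ℕ ↦ ε / 2 * N ≤ (n : ℝ)) with hA₁
  have hinv : ∀ n ∈ A₁, (1 : ℝ) / n ≤ 1 / (ε / 2 * N) := fun n hn ↦
    one_div_le_one_div_of_le (by linarith) (Finset.mem_filter.1 hn).2
  -- Trimming keeps the sum between `1 + ε/2` and `1 + ε/2 + 1/4 < 2`, so that `1` is the only
  -- positive integer a subset sum can equal.
  obtain ⟨B, hBA, hB1, hB2⟩ := exists_subset_sum_between A₁ (fun n : ℕ ↦ (1 : ℝ) / n)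
    (by positivity) (by positivity) hinv hsum
  have hquarter : 1 / (ε / 2 * N) ≤ 1 / 4 := one_div_le_one_div_of_le (by norm_num) hcN
  have hBN : B ⊆ Finset.Icc 1 N := hBA.trans ((Finset.filter_subset _ _).trans hA)
  obtain ⟨A', hA'B, hA'card, hA'reg⟩ := hregular B hBN
  have hlow : 1 + ε / 4 ≤ ∑ n ∈ A', (1 : ℝ) / n := by
    have h1 := Finset.sum_sdiff (f := fun n : ℕ ↦ (1 : ℝ) / n) hA'B
    have h2 : ∑ n ∈ B \ A', (1 : ℝ) / n ≤ (B \ A').card * (1 / (ε / 2 * N)) := by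
      rw [← nsmul_eq_mul]
      exact Finset.sum_le_card_nsmul _ _ _ fun n hn ↦ hinv n (hBA (Finset.mem_sdiff.1 hn).1)
    have h3 : ((B \ A').card : ℝ) ≤ ε ^ 2 / 8 * N := by
      rw [Finset.cast_card_sdiff hA'B]
      linarith
    -- Pruning removes at most `ε² N / 8` elements, each of reciprocal at most `2 / (ε N)`. This
    -- fixes `η = ε² / 8`, and hence `δ = η / 8`.
    have h4 : ((B \ A').card : ℝ) * (1 / (ε / 2 * N)) ≤ ε / 4 := by
      rw [mul_one_div, div_le_iff₀ (by linarith)]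
      linarith
    linarith
  have hhigh : ∑ n ∈ A', (1 : ℝ) / n < 2 := by
    have h1 := Finset.sum_le_sum_of_subset_of_nonneg (f := fun n : ℕ ↦ (1 : ℝ) / n) hA'B
      fun _ _ _ ↦ by positivity
    linarith
  obtain ⟨S, hS, hS1⟩ := hsubset A' (hA'B.trans hBN)
    (fun n hn ↦ (Finset.mem_filter.1 (hBA (hA'B hn))).2) hlow hhigh
    (fun p k hp hk hex ↦ by
      obtain ⟨h1, h2⟩ := hA'reg p k hp hk hex
      refine ⟨h1, h2.trans (le_of_eq ?_)⟩
      congr)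
  exact ⟨S, hS.trans (hA'B.trans (hBA.trans (Finset.filter_subset _ _))), hS1⟩

theorem theorem1p4 :
    (∀ ε : ℝ, 0 < ε → ε < 1 / 2 →
      ∃ N₀ : ℕ, ∀ N : ℕ, N₀ ≤ N →
        ∀ A : Finset ℕ, A ⊆ Finset.Icc 1 N →
          (1 - 1 / Real.exp 1 + ε) * (N : ℝ) ≤ (A.card : ℝ) →
          ∃ A' : Finset ℕ, A' ⊆ A ∧ ∑ n ∈ A', (1 : ℝ) / (n : ℝ) = 1) ∧
    (∀ γ : ℝ, 0 < γ →
      ∃ N₀ : ℕ, ∀ N : ℕ, N₀ ≤ N →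
        ∃ A : Finset ℕ, A ⊆ Finset.Icc 1 N ∧
          (1 - 1 / Real.exp 1 - γ) * (N : ℝ) ≤ (A.card : ℝ) ∧
          ∑ n ∈ A, (1 : ℝ) / (n : ℝ) < 1 ∧
          ¬ ∃ A' : Finset ℕ, A' ⊆ A ∧ ∑ n ∈ A', (1 : ℝ) / (n : ℝ) = 1) := by
  refine ⟨fun ε hε hε2 ↦ eventually_atTop.1 (eventually_exists_subset_of_dense hε hε2),
    fun γ hγ ↦ ?_⟩
  obtain ⟨N₀, hN₀⟩ := exists_dense_sum_inv_lt_one hγ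
  refine ⟨N₀, fun N hN ↦ ?_⟩
  obtain ⟨A, hA, hcard, hsum⟩ := hN₀ N hN
  refine ⟨A, hA, hcard, hsum, ?_⟩
  rintro ⟨A', hA', hA'1⟩
  have := Finset.sum_le_sum_of_subset_of_nonneg (f := fun n : ℕ ↦ (1 : ℝ) / n) hA'
    fun _ _ _ ↦ by positivity
  linarith
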